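/- Models. There are $s\ge 1$ servers, each with a private input, and all protocols are deterministic. In the coordinator model, in each round the coordinator sends messages (nonempty bit strings) to some of the servers and each contacted server replies to the coordinator; in the blackboard model the servers write messages on a blackboard visible to all, the contents of which determine who writes next. The communication cost is the total number of bits sent. Let $B\subset\mathbb R^d$ be the closed Euclidean unit ball. Center-of-gravity protocol, with parameters $T,N\in\mathbb N$ and $\tau,H\in\mathbb R$. The objective $c\in\mathbb R^d$ is known to all. All parties maintain the same polytope $P$, initially $P=[-H,H]^d$. In each of $T$ rounds let $z$ be the centroid of $P$ and $\Sigma$ the covariance matrix of the uniform distribution on $P$. Each server tests $z$ against its own constraints. The first server (in a fixed order) that finds a violated constraint, with normal $a$, rounds it relative to the current covariance, that is, it rounds each coordinate of the unit vector $\Sigma^{1/2}a/\|\Sigma^{1/2}a\|_2$ down to a multiple of $1/N$, giving $\tilde a$. This $\tilde a$ is announced (written in binary) to everybody, and all set $P\leftarrow P\cap\{x:\langle \Sigma^{-1/2}\tilde a,x\rangle\le\langle \Sigma^{-1/2}\tilde a,z\rangle+\tau\}$. If no server finds a violation, all set $P\leftarrow P\cap\{x:\langle c,x\rangle\le\langle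 c,z\rangle\}$. At the end the coordinator computes its output, without further communication, from an accepted centroid $z$ (one at which no server found a violation) of smallest value $\langle c,z\rangle$, if there is one. Theorem. There is an absolute constant $C>0$ such that the following holds for all $d\ge 2$. (a) Convex programming. Let $0<\varepsilon\le R$. There are parameters $T,N,\tau,H$ and a $\delta>0$, depending only on $d,R,\varepsilon$, such that for all $s\ge1$, all $c\in\mathbb R^d$ and all convex sets $K_1,\dots,K_s\subseteq RB$ with $\bigcap_iK_i\neq\emptyset$, one per server, the protocol outputs a point $y$ with $$\langle c,y\rangle\le\inf\{\langle c,x\rangle:x\in\textstyle\bigcap_iK_i\}+\varepsilon\quad\text{and}\quad y\in\bigcap_i\,(K_i+\varepsilon B),$$ and moreover $y\in(\bigcap_iK_i)+\varepsilon B$ whenever $\bigcap_iK_i$ contains a ball of radius $\varepsilon$. Its cost is at most $C\,s\,d^2\log d\,\log(Rd/\varepsilon)$ in both the coordinator model and the blackboard model. Here server $i$ accepts $z$ if and only if $z\in K_i+\delta B$, and otherwise uses any $a\ne0$ with $\langle a,x\rangle\le\langle a,z\rangle$ for all $x\in K_i+\delta B$. (b) Linear programming. Let $L\ge1$. There are parameters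 $T,N,\tau,H$ and an $\eta>0$, depending only on $d,L$, such that for every $c\in\mathbb Z^d$ with entries in $[-2^L,2^L]$ the same protocol, with a suitable final local computation of the coordinator (depending only on $d,L,c$), solves exactly, for every $s\ge1$, every linear program $\min\{\langle c,x\rangle:Ax\le b\}$ with integer coefficients in $[-2^L,2^L]$ and any finite number of constraints, whose rows are distributed among the $s$ servers: it outputs an optimal solution if there is one, and otherwise reports that the program is infeasible or that it is unbounded. Its cost is at most $C\,s\,d^3L\log^2 d$ in both models. Here a server accepts $z$ if and only if all of its rows satisfy $\langle a,z\rangle\le b+\eta$, and otherwise uses the normal $a$ of any row with $\langle a,z\rangle>b+\eta$. -/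

import Mathlib

noncomputable section

namespace DistOpt

/-! ### Communication models -/

/-- A message is a nonempty bit string (so that contacting somebody is never free of charge). -/
abbrev Message := {l : List Bool // l ≠ []}

/-- The number of bits of a message; not sending anything costs nothing. -/
def bits (m : Message) : ℕ := m.1.length

/-- The number of bits of an optional message. -/
def optBits (m : Option Message) : ℕ := m.elim 0 bits

/-- A deterministic protocol in the coordinator model, with `s` servers holding inputs in `X` and
outputs in `Y`. At the beginning of a round the coordinator, who knows the replies of all former
rounds, either stops with an output or sends messages to some of the servers; each contacted server
replies, knowing only its own input and the messages that it has received itself. -/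
structure CoordinatorProtocol (s : ℕ) (X Y : Type) where
  /-- the coordinator's action, given the replies of the previous rounds -/
  coordinator : List (Fin s → Option Message) → Y ⊕ (Fin s → Option Message)
  /-- the reply of a server, given its input and all messages that it has received so far -/
  server : Fin s → X → List Message → Message

/-- `π.Runs x h m y k`: on inputs `x`, after the rounds with replies `h` and with `m i` the list of
messages received by server `i` so far, the protocol stops with output `y` after sending
another `k` bits in total. -/
inductive CoordinatorProtocol.Runs {s : ℕ} {X Y : Type} (π : CoordinatorProtocol s X Y)
    (x : Fin s → X) :
    List (Fin s → Option Message) → (Fin s → List Message) → Y → ℕ → Prop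
  | halt (h : List (Fin s → Option Message)) (m : Fin s → List Message) (y : Y)
      (hy : π.coordinator h = Sum.inl y) : CoordinatorProtocol.Runs π x h m y 0
  | round (h : List (Fin s → Option Message)) (m : Fin s → List Message) (y : Y) (k : ℕ)
      (q r : Fin s → Option Message) (m' : Fin s → List Message)
      (hq : π.coordinator h = Sum.inr q)
      (hm : m' = fun i => m i ++ (q i).toList)
      (hr : r = fun i => (q i).map fun _ => π.server i (x i) (m' i))
      (hrec : CoordinatorProtocol.Runs π x (h ++ [r]) m' y k) :
      CoordinatorProtocol.Runs π x h m y ((∑ i, optBits (q i) + ∑ i, optBits (r i)) + k)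

/-- On inputs `x` the protocol outputs `y` and communicates at most `B` bits in total. -/
def CoordinatorProtocol.OutputsWithin {s : ℕ} {X Y : Type} (π : CoordinatorProtocol s X Y)
    (x : Fin s → X) (y : Y) (B : ℝ) : Prop :=
  ∃ k : ℕ, π.Runs x [] (fun _ => []) y k ∧ (k : ℝ) ≤ B

/-- A deterministic protocol in the blackboard model. The contents of the blackboard decide whether
to stop (and with which output) or which server writes next; a server's message depends on its
input and on the contents of the blackboard. -/
structure BlackboardProtocol (s : ℕ) (X Y : Type) where
  /-- the output, or the server that writes next -/
  next : List Message → Y ⊕ Fin s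
  /-- the message that a server writes -/
  server : Fin s → X → List Message → Message

/-- `π.Runs x b y k`: on inputs `x` and with blackboard `b`, the protocol stops with output `y`
after another `k` bits have been written. -/
inductive BlackboardProtocol.Runs {s : ℕ} {X Y : Type} (π : BlackboardProtocol s X Y)
    (x : Fin s → X) : List Message → Y → ℕ → Prop
  | halt (b : List Message) (y : Y) (hy : π.next b = Sum.inl y) :
      BlackboardProtocol.Runs π x b y 0
  | write (b : List Message) (y : Y) (k : ℕ) (i : Fin s) (msg : Message)
      (hi : π.next b = Sum.inr i) (hmsg : msg = π.server i (x i) b)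
      (hrec : BlackboardProtocol.Runs π x (b ++ [msg]) y k) :
      BlackboardProtocol.Runs π x b y (bits msg + k)

/-- On inputs `x` the protocol outputs `y` and communicates at most `B` bits in total. -/
def BlackboardProtocol.OutputsWithin {s : ℕ} {X Y : Type} (π : BlackboardProtocol s X Y)
    (x : Fin s → X) (y : Y) (B : ℝ) : Prop :=
  ∃ k : ℕ, π.Runs x [] y k ∧ (k : ℝ) ≤ B

/-! ### The center-of-gravity protocol with cuts rounded relative to the covariance -/

/-- `ℝ^d` with the Euclidean norm. -/
abbrev Vec (d : ℕ) := EuclideanSpace ℝ (Fin d)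

/-- The parameters of the protocol: the number `T` of rounds, the resolution `N` (coordinates are
rounded to multiples of `1 / N`), the amount by which rounded cuts are shifted outwards, and the
half side length of the initial cube. -/
structure CogParams where
  rounds : ℕ
  resolution : ℕ
  shift : ℝ
  halfWidth : ℝ

/-- A rounded cut: the integer `k j` in `{0, …, 2N}` stands for the coordinate `(k j - N) / N`. -/
abbrev Cut (d N : ℕ) := Fin d → Fin (2 * N + 1)

/-- The vector that a rounded cut stands for. -/
def Cut.toVec {d N : ℕ} (k : Cut d N) : Vec d :=
  WithLp.toLp 2 fun j => (((k j : ℕ) : ℝ) - N) / N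

/-- Messages: `0` if there is no cut to report, and otherwise `1` followed by the coordinates
in binary, all with the same number of digits. -/
def encode {d N : ℕ} : Option (Cut d N) → Message
  | none => ⟨[false], by simp⟩
  | some k => ⟨true :: (List.ofFn fun j : Fin d =>
      List.ofFn fun t : Fin (Nat.size (2 * N)) => Nat.testBit (k j : ℕ) t).flatten, by simp⟩

/-- The (left) inverse of `encode`. -/
def decode {d N : ℕ} : Message → Option (Cut d N) := Function.invFun encode

/-- The center of gravity of a body. -/
def centroid {d : ℕ} (P : Set (Vec d)) : Vec d := ⨍ x in P, x

/-- The covariance matrix of the uniform distribution on a body. -/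
def covariance {d : ℕ} (P : Set (Vec d)) : Matrix (Fin d) (Fin d) ℝ :=
  Matrix.of fun j k => ⨍ x in P, (x j - centroid P j) * (x k - centroid P k)

section
open scoped MatrixOrder

/-- The positive semidefinite square root of the covariance matrix. -/
def sqrtCovariance {d : ℕ} (P : Set (Vec d)) : Matrix (Fin d) (Fin d) ℝ :=
  CFC.sqrt (covariance P)

end

/-- Rounding relative to the covariance of `P`: with `B` the square root of the covariance, the unit
vector `u = Ba / ‖Ba‖` is rounded down, in each coordinate, to the nearest multiple of `1 / N`. -/
def roundCut {d : ℕ} (N : ℕ) (P : Set (Vec d)) (a : Vec d) : Cut d N :=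
  let w : Vec d := Matrix.toEuclideanLin (sqrtCovariance P) a
  fun j => Fin.ofNat (2 * N + 1) (⌊(N : ℝ) * (w j / ‖w‖)⌋ + N).toNat

/-- The initial cube. -/
def cube (d : ℕ) (H : ℝ) : Set (Vec d) := {x | ∀ j, |x j| ≤ H}

/-- One update of the common body `P` with centroid `z`. If a rounded cut `k` has been announced,
`P` is intersected with the halfspace given by the normal `B⁻¹ k` and shifted outwards
from `z`. If no server has reported a violation, so that `z` was feasible, the objective serves as
the constraint. -/
def updateBody {d : ℕ} (prm : CogParams) (c : Vec d) (P : Set (Vec d)) :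
    Option (Cut d prm.resolution) → Set (Vec d)
  | some k =>
      let a : Vec d := Matrix.toEuclideanLin (sqrtCovariance P)⁻¹ k.toVec
      P ∩ {x | inner ℝ a x ≤ inner ℝ a (centroid P) + prm.shift}
  | none => P ∩ {x | inner ℝ c x ≤ inner ℝ c (centroid P)}

/-- The common body after rounds with the given outcomes (`some` cut, or `none` if the centroid was
accepted by all servers). -/
def body {d : ℕ} (prm : CogParams) (c : Vec d) (o : List (Option (Cut d prm.resolution))) :
    Set (Vec d) :=
  o.foldl (updateBody prm c) (cube d prm.halfWidth)

/-- What a server with local test `test` reports after rounds with outcomes `o`: nothing if its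
constraints hold at the current centroid, and otherwise a violated constraint, rounded relative to
the current covariance. -/
def report {d : ℕ} (prm : CogParams) (c : Vec d) (test : Vec d → Option (Vec d))
    (o : List (Option (Cut d prm.resolution))) : Option (Cut d prm.resolution) :=
  (test (centroid (body prm c o))).map (roundCut prm.resolution (body prm c o))

/-- The centroids that were accepted by all servers. -/
def accepted {d : ℕ} (prm : CogParams) (c : Vec d) (o : List (Option (Cut d prm.resolution))) :
    List (Vec d) :=
  (List.range o.length).filterMap fun t =>
    if o[t]? = some none then some (centroid (body prm c (o.take t))) else none

/-- The accepted centroid with the smallest objective value, if there is one. -/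
def best {d : ℕ} (prm : CogParams) (c : Vec d) (o : List (Option (Cut d prm.resolution))) :
    Option (Vec d) :=
  (accepted prm c o).argmin fun z => inner ℝ c z

/-- The outcome of a round in the coordinator model: the cut of the first server that reports one. -/
def roundOutcome {d N s : ℕ} (r : Fin s → Option Message) : Option (Cut d N) :=
  (List.finRange s).findSome? fun i => (r i).bind decode

/-- The center-of-gravity protocol in the coordinator model. The objective `c` is known to all,
`test i x z` is the local test of server `i` with input `x` at the point `z` (`none` if the point
is accepted, `some a` for the normal `a` of a violated constraint), and `finish` is a local
computation of the coordinator at the end. In each round the coordinator forwards the outcome of the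
previous round to all servers (in the first round: a start signal), and these reply with their
reports. -/
def cogCoordinator {d s : ℕ} {X Y : Type} (prm : CogParams) (c : Vec d)
    (test : Fin s → X → Vec d → Option (Vec d)) (finish : Option (Vec d) → Y) :
    CoordinatorProtocol s X Y where
  coordinator h :=
    let o : List (Option (Cut d prm.resolution)) := h.map roundOutcome
    if prm.rounds ≤ h.length then Sum.inl (finish (best prm c o))
    else Sum.inr fun _ => some (encode o.getLast?.join)
  server i x m := encode (report prm c (test i x) (m.tail.map decode))

/-- The outcomes of the completed rounds that can be read off the blackboard, when the servers write
in turn and each round consists of `s` messages. -/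
def boardOutcomes (d N s : ℕ) (b : List Message) : List (Option (Cut d N)) :=
  (List.range (b.length / s)).map fun t => ((b.drop (t * s)).take s).findSome? decode

/-- The center-of-gravity protocol in the blackboard model. The servers write in turn; a server
reports a cut only if no other server has reported one in the same round. -/
def cogBlackboard {d s : ℕ} [NeZero s] {X Y : Type} (prm : CogParams) (c : Vec d)
    (test : Fin s → X → Vec d → Option (Vec d)) (finish : Option (Vec d) → Y) :
    BlackboardProtocol s X Y where
  next b :=
    if prm.rounds * s ≤ b.length then
      Sum.inl (finish (best prm c (boardOutcomes d prm.resolution s b)))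
    else Sum.inr (Fin.ofNat s b.length)
  server i x b :=
    let current : Option (Cut d prm.resolution) :=
      (b.drop (b.length / s * s)).findSome? decode
    if current.isSome then encode (none : Option (Cut d prm.resolution))
    else encode (report prm c (test i x) (boardOutcomes d prm.resolution s b))

/-! ### Convex programming -/

/-- The Minkowski sum `K + δ B` with `B` the closed unit ball. -/
def enlarge {d : ℕ} (K : Set (Vec d)) (δ : ℝ) : Set (Vec d) := {y | ∃ x ∈ K, dist y x ≤ δ}

/-- A rule by which a server that holds a convex set `K` tests a point `z`: the points of `K + δ B`
are accepted, and for every other point the normal of a hyperplane through it that bounds `K + δ B`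
is returned. -/
def IsSeparationRule {d : ℕ} (δ : ℝ) (test : Set (Vec d) → Vec d → Option (Vec d)) : Prop :=
  ∀ K : Set (Vec d), Convex ℝ K → ∀ z : Vec d,
    (test K z = none ↔ z ∈ enlarge K δ) ∧
      ∀ a, test K z = some a → a ≠ 0 ∧ ∀ x ∈ enlarge K δ, inner ℝ a x ≤ inner ℝ a z

/-- `y` solves `min {cᵀx : x ∈ ⋂ K i}` to within an additive error `ε`: its value is at most
the optimum plus `ε`, it lies in all `K i + ε B`, and it lies in `(⋂ K i) + ε B`
as soon as `⋂ K i` contains a ball of radius `ε`. -/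
def IsAdditiveSolution {d s : ℕ} (c : Vec d) (K : Fin s → Set (Vec d)) (ε : ℝ) (y : Vec d) :
    Prop :=
  (∀ x ∈ ⋂ i, K i, inner ℝ c y ≤ inner ℝ c x + ε) ∧
  (∀ i, y ∈ enlarge (K i) ε) ∧
  ((∃ p, Metric.closedBall p ε ⊆ ⋂ i, K i) → y ∈ enlarge (⋂ i, K i) ε)

/-! ### Linear programming -/

/-- The rows `A x ≤ b` of an integer linear program that one server holds. -/
structure ConstraintBlock (d : ℕ) where
  n : ℕ
  A : Matrix (Fin n) (Fin d) ℤ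
  b : Fin n → ℤ

/-- All coefficients are integers in `[-2^L, 2^L]`. -/
def ConstraintBlock.BoundedBy {d : ℕ} (M : ConstraintBlock d) (L : ℕ) : Prop :=
  (∀ r j, |M.A r j| ≤ 2 ^ L) ∧ ∀ r, |M.b r| ≤ 2 ^ L

/-- An integer vector as a vector of `ℝ^d`. -/
def intVec {d : ℕ} (v : Fin d → ℤ) : Vec d := WithLp.toLp 2 fun j => (v j : ℝ)

/-- The feasible region of the linear program formed by all rows of all servers. -/
def feasibleRegion {d s : ℕ} (M : Fin s → ConstraintBlock d) : Set (Vec d) :=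
  {x | ∀ i r, inner ℝ (intVec ((M i).A r)) x ≤ ((M i).b r : ℝ)}

/-- A rule by which a server tests a point `z` against its rows, up to a tolerance `η`: if all hold,
the point is accepted, and otherwise the normal of some violated row is returned. -/
def IsRowRule {d : ℕ} (η : ℝ) (test : ConstraintBlock d → Vec d → Option (Vec d)) : Prop :=
  ∀ (M : ConstraintBlock d) (z : Vec d),
    (test M z = none ↔ ∀ r, inner ℝ (intVec (M.A r)) z ≤ (M.b r : ℝ) + η) ∧
      ∀ a, test M z = some a →
        ∃ r, a = intVec (M.A r) ∧ (M.b r : ℝ) + η < inner ℝ (intVec (M.A r)) z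

/-- The possible answers for a linear program. -/
inductive LPAnswer (d : ℕ) where
  | infeasible : LPAnswer d
  | unbounded : LPAnswer d
  | optimal (x : Vec d) : LPAnswer d

/-- The answer is correct for the program `min {cᵀx : x ∈ F}`. -/
def LPAnswer.IsCorrect {d : ℕ} (c : Vec d) (F : Set (Vec d)) : LPAnswer d → Prop
  | .infeasible => F = ∅
  | .unbounded => ∀ v : ℝ, ∃ x ∈ F, inner ℝ c x < v
  | .optimal x => x ∈ F ∧ ∀ x' ∈ F, inner ℝ c x ≤ inner ℝ c x'

end DistOpt

end

/-! ### Prékopa–Leindler and Brunn–Minkowski inequalities for midpoints -/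

section

open MeasureTheory Set
open scoped ENNReal

/-! The proof tracks the volume of the common body `P`. Every cut removes a constant fraction of it,
even when shifted slightly beyond the centroid. Indeed, the marginal of the uniform distribution on
`P` in any direction, normalised to mean 0 and variance 1, has log-concave tails by Brunn–Minkowski
(`volume_mul_volume_le_sq`). Hence its fourth moment is bounded, and mass at least 2⁻²⁴ lies beyond
1/5120 (`measureReal_right_tail_ge`, `IsBody.volume_cut_le`).

Rounding is harmless in the coordinates in which the covariance is the identity. There `P` lies
within distance 3d of its centroid (`IsBody.abs_inner_sub_centroid_le`), so a rounding error of norm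
d/N changes the functional by at most 3d²/N on `P`. With N = 30720d² this is the shift 1/10240, and
the shifted cut keeps all of `P` that the true cut keeps (`IsBody.inner_roundCut_le`). The rounded
normal has norm at least 1/2, so the shift is at most 1/5120 standard deviations. A coordinate thus
costs O(log d) bits, whatever the accuracy.

Suppose a ball satisfies all constraints with objective values at most v, while no accepted centroid
has value at most v. Then no cut touches the ball, although the volume decays geometrically; this is
absurd after O(d log(Hd/r)) rounds (`exists_best_le`).

For convex programs the ball is half of a δ-ball about a feasible point, contained in every K i +
δB. For δ = ε²/(4R), closeness to each K i gives closeness to the intersection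
(`mem_enlarge_iInter`).

For linear programs the ball lies near a feasible point with small coordinates. The coordinator does
not know the rows; it solves the program of all bounded integer rows that the best centroid
satisfies approximately. These include the true rows, so no infeasible point is added, and
integrality of basic solutions (`BoundedRows.exists_mem_of_approx`) shows that the optimal level is
still reached exactly. -/

/-- For compact K ⊆ A and K' ⊆ B, the translates K + min K' and max K + K' lie in 2C and share only
the point max K + min K', so their measures add up. -/
theorem volume_add_volume_le_of_midpoint {A B C : Set ℝ} (hA : MeasurableSet A)
    (hB : MeasurableSet B) (hA0 : A.Nonempty) (hB0 : B.Nonempty)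
    (h : ∀ x ∈ A, ∀ y ∈ B, (x + y) / 2 ∈ C) : volume A + volume B ≤ 2 * volume C := by
  set D : Set ℝ := (fun x : ℝ => x * (1 / 2)) ⁻¹' C with hD
  have hvD : volume D = 2 * volume C := by
    rw [hD, Real.volume_preimage_mul_right (by norm_num)]
    norm_num
  have hsub : ∀ x ∈ A, ∀ y ∈ B, x + y ∈ D := by
    intro x hx y hy
    have := h x hx y hy
    simpa [hD, div_eq_mul_inv] using this
  have htr : ∀ (S : Set ℝ) (u : ℝ), volume ((fun x => x + u) '' S) = volume S := by
    intro S u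
    simp
  have htl : ∀ (S : Set ℝ) (u : ℝ), volume ((fun x => u + x) '' S) = volume S := by
    intro S u
    simp
  rw [← hvD]
  -- A null set has no compact approximant of positive measure; here a translate of the other set
  -- suffices.
  rcases eq_or_ne (volume A) 0 with hA1 | hA1
  · obtain ⟨a, ha⟩ := hA0
    rw [hA1, zero_add, ← htl B a]
    apply measure_mono
    rintro _ ⟨y, hy, rfl⟩
    exact hsub a ha y hy
  rcases eq_or_ne (volume B) 0 with hB1 | hB1
  · obtain ⟨b, hb⟩ := hB0
    rw [hB1, add_zero, ← htr A b]
    apply measure_mono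
    rintro _ ⟨y, hy, rfl⟩
    exact hsub y hy b hb
  have key : ∀ r < volume A, ∀ t < volume B, r + t ≤ volume D := by
    intro r hr t ht
    obtain ⟨K, hKA, hK, hrK⟩ := hA.exists_lt_isCompact hr
    obtain ⟨K', hKB, hK', htK⟩ := hB.exists_lt_isCompact ht
    have hne : K.Nonempty := by
      rcases K.eq_empty_or_nonempty with rfl | h
      · simp at hrK
      · exact h
    have hne' : K'.Nonempty := by
      rcases K'.eq_empty_or_nonempty with rfl | h
      · simp at htK
      · exact h
    obtain ⟨M, hM, hMmax⟩ := hK.exists_isGreatest hne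
    obtain ⟨m, hm, hmmin⟩ := hK'.exists_isLeast hne'
    have hmeas : MeasurableSet ((fun x => M + x) '' K') :=
      (hK'.image (by fun_prop)).measurableSet
    have hu := measure_union_add_inter (μ := volume) ((fun x => x + m) '' K) hmeas
    have hint : volume ((fun x => x + m) '' K ∩ (fun x => M + x) '' K') = 0 := by
      refine measure_mono_null (t := {M + m}) ?_ (by simp)
      rintro _ ⟨⟨x, hx, rfl⟩, ⟨y, hy, hxy⟩⟩
      have h1 := hMmax hx
      have h2 := hmmin hy
      simp only [mem_singleton_iff] at *
      linarith
    rw [hint, add_zero, htr, htl] at hu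
    calc r + t ≤ volume K + volume K' := add_le_add hrK.le htK.le
      _ = _ := hu.symm
      _ ≤ volume D := by
        apply measure_mono
        apply union_subset
        · rintro _ ⟨x, hx, rfl⟩
          exact hsub x (hKA hx) m (hKB hm)
        · rintro _ ⟨x, hx, rfl⟩
          exact hsub M (hKA hM) x (hKB hx)
  refine le_of_forall_lt fun w hw => ?_
  obtain ⟨r, t, hwt, hr, ht⟩ : ∃ r t, w < r + t ∧ r < volume A ∧ t < volume B := by
    by_contra! hcon
    refine absurd hw (not_lt.2 ?_)
    have hs : ∀ u : ℝ≥0∞, u ≠ 0 → u = ⨆ (r : ℝ≥0∞) (_ : r < u), r := fun u _ =>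
      le_antisymm (le_of_forall_lt fun c hc => by
        obtain ⟨c', h1, h2⟩ := exists_between hc
        exact h1.trans_le (le_iSup₂_of_le c' h2 le_rfl)) (iSup₂_le fun r hr => hr.le)
    rw [hs _ hA1, hs _ hB1]
    refine ENNReal.biSup_add_biSup_le' (p := fun r => r < volume A) (q := fun r => r < volume B)
      ⟨0, pos_iff_ne_zero.2 hA1⟩ ⟨0, pos_iff_ne_zero.2 hB1⟩ fun r hr t ht => ?_
    by_contra hlt
    exact absurd ht (not_lt.2 (hcon r t (not_le.1 hlt) hr))
  exact hwt.trans_le (key r hr t ht)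

theorem ENNReal.mul_le_sq_of_add_le {u v w : ℝ≥0∞} (h : u + v ≤ 2 * w) : u * v ≤ w ^ 2 := by
  rcases eq_or_ne w ∞ with rfl | hw
  · simp
  have huv : u + v ≠ ∞ := ne_top_of_le_ne_top (ENNReal.mul_ne_top (by simp) hw) h
  have hu : u ≠ ∞ := fun h' => huv (by simp [h'])
  have hv : v ≠ ∞ := fun h' => huv (by simp [h'])
  lift u to NNReal using hu
  lift v to NNReal using hv
  lift w to NNReal using hw
  have h' : (u : ℝ) + v ≤ 2 * w := by exact_mod_cast h
  have : (u : ℝ) * v ≤ w ^ 2 := by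
    nlinarith [sq_nonneg ((u : ℝ) - v), u.2, v.2, w.2, mul_self_le_mul_self (add_nonneg u.2 v.2) h']
  exact_mod_cast this

theorem lintegral_eq_lintegral_Ioo_of_le_one {f : ℝ → ℝ≥0∞} (hf : Measurable f)
    (h1 : ∀ x, f x ≤ 1) :
    ∫⁻ x, f x = ∫⁻ t in Ioo (0 : ℝ) 1, volume {x | ENNReal.ofReal t < f x} := by
  have e1 : ∀ x, f x = ENNReal.ofReal (f x).toReal := fun x =>
    (ENNReal.ofReal_toReal (ne_top_of_le_ne_top (by simp) (h1 x))).symm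
  have e2 := lintegral_eq_lintegral_meas_lt volume (f := fun x => (f x).toReal)
    (Filter.Eventually.of_forall fun x => ENNReal.toReal_nonneg) hf.ennreal_toReal.aemeasurable
  simp_rw [← e1] at e2
  have hzero : ∫⁻ t in Ioi (0 : ℝ) \ Ioo 0 1, volume {x | t < (f x).toReal} = 0 := by
    rw [setLIntegral_congr_fun (g := fun _ => 0) (measurableSet_Ioi.diff measurableSet_Ioo)]
    · simp
    intro t ht
    have ht1 : 1 ≤ t := by
      by_contra hlt
      exact ht.2 ⟨ht.1, not_le.1 hlt⟩
    have : {x | t < (f x).toReal} = ∅ := by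
      ext x
      simp only [mem_ofPred_eq, mem_empty_iff_false, iff_false, not_lt]
      exact (ENNReal.toReal_mono (by simp) (h1 x)).trans (by simpa using ht1)
    simp [this]
  rw [e2, ← lintegral_inter_add_sdiff _ _ (measurableSet_Ioo (a := (0 : ℝ)) (b := 1)), hzero,
    add_zero, inter_eq_self_of_subset_right Ioo_subset_Ioi_self]
  refine setLIntegral_congr_fun measurableSet_Ioo fun t ht => ?_
  congr 1
  ext x
  simp only [mem_ofPred_eq]
  rw [ENNReal.ofReal_lt_iff_lt_toReal ht.1.le (ne_top_of_le_ne_top (by simp) (h1 x))]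

/-- With both suprema equal to 1, the superlevel sets of `f` and `g` are nonempty at every level
below 1. The inequality for sets therefore applies level by level in the layer-cake formula. -/
theorem lintegral_add_le_of_iSup_eq_one {f g h : ℝ → ℝ≥0∞} (hf : Measurable f) (hg : Measurable g)
    (hh : Measurable h) (H : ∀ x y, f x * g y ≤ h ((x + y) / 2) ^ 2) (hf1 : ⨆ x, f x = 1)
    (hg1 : ⨆ x, g x = 1) : (∫⁻ x, f x) + ∫⁻ x, g x ≤ 2 * ∫⁻ x, h x := by
  have hfle : ∀ x, f x ≤ 1 := fun x => hf1 ▸ le_iSup f x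
  have hgle : ∀ x, g x ≤ 1 := fun x => hg1 ▸ le_iSup g x
  set k : ℝ → ℝ≥0∞ := fun x => min (h x) 1 with hk
  have hkm : Measurable k := hh.min measurable_const
  have hkh : ∫⁻ x, k x ≤ ∫⁻ x, h x := lintegral_mono fun x => min_le_left _ _
  refine le_trans ?_ (mul_le_mul_right hkh 2)
  rw [lintegral_eq_lintegral_Ioo_of_le_one hf hfle, lintegral_eq_lintegral_Ioo_of_le_one hg hgle,
    lintegral_eq_lintegral_Ioo_of_le_one hkm fun x => min_le_right _ _]
  have hanti : Antitone fun t : ℝ => volume {x | ENNReal.ofReal t < f x} := fun s t hst =>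
    measure_mono fun x hx => lt_of_le_of_lt (ENNReal.ofReal_le_ofReal hst) hx
  rw [← lintegral_add_left hanti.measurable, ← lintegral_const_mul' _ _ (by simp)]
  refine setLIntegral_mono' measurableSet_Ioo fun t ht => ?_
  have ht1 : ENNReal.ofReal t < 1 := by
    rw [← ENNReal.ofReal_one]
    exact (ENNReal.ofReal_lt_ofReal_iff (by norm_num)).2 ht.2
  apply volume_add_volume_le_of_midpoint (measurableSet_lt measurable_const hf)
    (measurableSet_lt measurable_const hg)
  · exact lt_iSup_iff.1 (hf1 ▸ ht1)
  · exact lt_iSup_iff.1 (hg1 ▸ ht1)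
  · intro x hx y hy
    simp only [mem_ofPred_eq] at hx hy ⊢
    refine lt_min ?_ ht1
    by_contra hcon
    have h1 := H x y
    have h2 : ENNReal.ofReal t * ENNReal.ofReal t < f x * g y :=
      ENNReal.mul_lt_mul hx hy
    have h3 : h ((x + y) / 2) ^ 2 ≤ ENNReal.ofReal t * ENNReal.ofReal t := by
      rw [sq]
      exact mul_le_mul' (not_lt.1 hcon) (not_lt.1 hcon)
    exact absurd (h2.trans_le (h1.trans h3)) (lt_irrefl _)

/-- Dividing `f`, `g`, `h` by α, β, √(αβ) preserves the hypothesis and normalises the suprema. The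
arithmetic-geometric mean inequality then turns the sum into a product. -/
theorem lintegral_mul_lintegral_le_of_bdd {f g h : ℝ → ℝ≥0∞} (hf : Measurable f)
    (hg : Measurable g) (hh : Measurable h) (H : ∀ x y, f x * g y ≤ h ((x + y) / 2) ^ 2)
    (hfb : ⨆ x, f x ≠ ∞) (hgb : ⨆ x, g x ≠ ∞) :
    (∫⁻ x, f x) * ∫⁻ x, g x ≤ (∫⁻ x, h x) ^ 2 := by
  set α := ⨆ x, f x
  set β := ⨆ x, g x
  rcases eq_or_ne α 0 with hα | hα
  · have : ∀ x, f x = 0 := fun x => le_antisymm (hα ▸ le_iSup f x) zero_le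
    simp [this]
  rcases eq_or_ne β 0 with hβ | hβ
  · have : ∀ x, g x = 0 := fun x => le_antisymm (hβ ▸ le_iSup g x) zero_le
    simp [this]
  have hαβ : α * β ≠ 0 := mul_ne_zero hα hβ
  have hαβ' : α * β ≠ ∞ := ENNReal.mul_ne_top hfb hgb
  set γ := (α * β) ^ (1 / 2 : ℝ) with hγ
  have hγ2 : γ ^ 2 = α * β := by
    rw [hγ, ← ENNReal.rpow_natCast, ← ENNReal.rpow_mul]
    norm_num
  have hγ0 : γ ≠ 0 := fun h0 => hαβ (by rw [← hγ2, h0]; simp)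
  have hγt : γ ≠ ∞ := fun h0 => hαβ' (by rw [← hγ2, h0]; simp)
  have key := lintegral_add_le_of_iSup_eq_one (f := fun x => f x / α) (g := fun x => g x / β)
    (h := fun x => h x / γ) (hf.div_const _) (hg.div_const _) (hh.div_const _) ?_ ?_ ?_
  · have k2 := ENNReal.mul_le_sq_of_add_le key
    simp only [div_eq_mul_inv] at k2
    rw [lintegral_mul_const _ hf, lintegral_mul_const _ hg, lintegral_mul_const _ hh] at k2
    calc (∫⁻ x, f x) * ∫⁻ x, g x
        = ((∫⁻ x, f x) * α⁻¹ * ((∫⁻ x, g x) * β⁻¹)) * (α * β) := by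
          rw [mul_mul_mul_comm _ _ _ β⁻¹, mul_assoc _ (α⁻¹ * β⁻¹),
            ← ENNReal.mul_inv (Or.inl hα) (Or.inl hfb), ENNReal.inv_mul_cancel hαβ hαβ', mul_one]
      _ ≤ ((∫⁻ x, h x) * γ⁻¹) ^ 2 * γ ^ 2 := by
          rw [hγ2]
          exact mul_le_mul_left k2 _
      _ = (∫⁻ x, h x) ^ 2 := by
          rw [← mul_pow, mul_assoc, ENNReal.inv_mul_cancel hγ0 hγt, mul_one]
  · intro x y
    have : f x / α * (g y / β) = f x * g y / γ ^ 2 := by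
      rw [hγ2]
      simp only [div_eq_mul_inv]
      rw [ENNReal.mul_inv (Or.inl hα) (Or.inl hfb)]
      ring
    show f x / α * (g y / β) ≤ (h ((x + y) / 2) / γ) ^ 2
    rw [this, div_eq_mul_inv, div_eq_mul_inv, mul_pow, ENNReal.inv_pow]
    exact mul_le_mul_left (H x y) _
  · rw [← ENNReal.iSup_div, ENNReal.div_self hα hfb]
  · rw [← ENNReal.iSup_div, ENNReal.div_self hβ hgb]

theorem iSup_lintegral_min {f : ℝ → ℝ≥0∞} (hf : Measurable f) :
    ∫⁻ x, f x = ⨆ n : ℕ, ∫⁻ x, min (f x) n := by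
  rw [← lintegral_iSup (fun n => hf.min measurable_const)]
  · congr with x
    have : (⨆ n : ℕ, min (f x) (n : ℝ≥0∞)) = min (f x) (⨆ n : ℕ, (n : ℝ≥0∞)) :=
      (inf_iSup_eq (f x) _).symm
    rw [this, ENNReal.iSup_natCast]
    simp
  · intro m n hmn x
    exact min_le_min le_rfl (by exact_mod_cast hmn)

/-- The one-dimensional Prékopa-Leindler inequality for midpoints. -/
theorem lintegral_mul_lintegral_le_sq {f g h : ℝ → ℝ≥0∞} (hf : Measurable f)
    (hg : Measurable g) (hh : Measurable h) (H : ∀ x y, f x * g y ≤ h ((x + y) / 2) ^ 2) :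
    (∫⁻ x, f x) * ∫⁻ x, g x ≤ (∫⁻ x, h x) ^ 2 := by
  rw [iSup_lintegral_min hf, iSup_lintegral_min hg, ENNReal.iSup_mul]
  refine iSup_le fun m => ?_
  rw [ENNReal.mul_iSup]
  refine iSup_le fun n => ?_
  have hbd : ∀ (u : ℝ → ℝ≥0∞) (m : ℕ), ⨆ x, min (u x) m ≠ ∞ := fun u m =>
    ne_top_of_le_ne_top (ENNReal.natCast_ne_top m) (iSup_le fun x => min_le_right _ _)
  exact lintegral_mul_lintegral_le_of_bdd (hf.min measurable_const) (hg.min measurable_const) hh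
    (fun x y => (mul_le_mul' (min_le_left _ _) (min_le_left _ _)).trans (H x y)) (hbd f m) (hbd g n)

theorem lintegral_fin_succ {n : ℕ} {f : (Fin (n + 1) → ℝ) → ℝ≥0∞} (hf : Measurable f) :
    ∫⁻ x, f x = ∫⁻ s : ℝ, ∫⁻ x : Fin n → ℝ, f (Fin.cons s x) := by
  have hmp := (volume_preserving_piFinSuccAbove (fun _ : Fin (n + 1) => ℝ) 0).symm
  have he : ⇑(MeasurableEquiv.piFinSuccAbove (fun _ : Fin (n + 1) => ℝ) 0).symm =
      fun p => (Fin.cons p.1 p.2 : Fin (n + 1) → ℝ) := by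
    ext p i
    simp [MeasurableEquiv.piFinSuccAbove]
  rw [← hmp.lintegral_comp hf]
  refine (lintegral_prod _ (hf.comp hmp.measurable).aemeasurable).trans ?_
  rw [he]
  rfl

/-- The Prékopa-Leindler inequality for midpoints. -/
theorem lintegral_mul_lintegral_le_sq_pi : ∀ {n : ℕ} {f g h : (Fin n → ℝ) → ℝ≥0∞},
    Measurable f → Measurable g → Measurable h →
    (∀ x y, f x * g y ≤ h ((1 / 2 : ℝ) • (x + y)) ^ 2) →
    (∫⁻ x, f x) * ∫⁻ x, g x ≤ (∫⁻ x, h x) ^ 2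
  | 0, f, g, h, _, _, _, H => by
    have e : ∀ u : (Fin 0 → ℝ) → ℝ≥0∞, ∫⁻ x, u x = u 0 := by
      intro u
      rw [volume_pi, Measure.pi_of_empty _ (0 : Fin 0 → ℝ), lintegral_dirac]
    rw [e, e, e]
    simpa using H 0 0
  | n + 1, f, g, h, hf, hg, hh, H => by
    rw [lintegral_fin_succ hf, lintegral_fin_succ hg, lintegral_fin_succ hh]
    have hc : Measurable fun p : ℝ × (Fin n → ℝ) => (Fin.cons p.1 p.2 : Fin (n + 1) → ℝ) :=
  by
      refine measurable_pi_lambda _ fun i => ?_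
      refine Fin.cases ?_ (fun j => ?_) i
      · simpa using measurable_fst
      · simpa using! (measurable_pi_apply j).comp measurable_snd
    have hc' : ∀ s : ℝ, Measurable fun x : Fin n → ℝ => (Fin.cons s x : Fin (n + 1) → ℝ) :=
      fun s => hc.comp (measurable_const.prodMk measurable_id)
    -- The one-dimensional inequality is applied to the marginals; its hypothesis at heights s and t
    -- is the inductive inequality for the slices at s, t and (s + t)/2.
    refine lintegral_mul_lintegral_le_sq (hf.comp hc).lintegral_prod_right'
      (hg.comp hc).lintegral_prod_right' (hh.comp hc).lintegral_prod_right' fun s t => ?_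
    refine lintegral_mul_lintegral_le_sq_pi (hf.comp (hc' s)) (hg.comp (hc' t))
      (hh.comp (hc' _)) fun x y => ?_
    refine (H _ _).trans_eq ?_
    congr 2
    ext i
    refine Fin.cases ?_ (fun j => ?_) i
    · simp
      ring
    · simp
      ring

open DistOpt in
/-- The multiplicative Brunn-Minkowski inequality for midpoints. -/
theorem volume_mul_volume_le_sq {d : ℕ} {A B C : Set (Vec d)} (hA : MeasurableSet A)
    (hB : MeasurableSet B) (hC : MeasurableSet C)
    (h : ∀ x ∈ A, ∀ y ∈ B, (1 / 2 : ℝ) • (x + y) ∈ C) :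
    volume A * volume B ≤ volume C ^ 2 := by
  have hmp := PiLp.volume_preserving_toLp (Fin d)
  have e : ∀ S : Set (Vec d), MeasurableSet S →
      volume S = ∫⁻ x : Fin d → ℝ, (WithLp.toLp 2 ⁻¹' S).indicator 1 x := by
    intro S hS
    rw [← hmp.measure_preimage hS.nullMeasurableSet, lintegral_indicator_one (hmp.measurable hS)]
  rw [e A hA, e B hB, e C hC]
  refine lintegral_mul_lintegral_le_sq_pi (measurable_one.indicator (hmp.measurable hA))
    (measurable_one.indicator (hmp.measurable hB)) (measurable_one.indicator (hmp.measurable hC))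
    fun x y => ?_
  by_cases hx : x ∈ WithLp.toLp 2 ⁻¹' A
  · by_cases hy : y ∈ WithLp.toLp 2 ⁻¹' B
    · have : (1 / 2 : ℝ) • (x + y) ∈ WithLp.toLp 2 ⁻¹' C := h _ hx _ hy
      rw [indicator_of_mem hx, indicator_of_mem hy, indicator_of_mem this]
      simp
    · rw [indicator_of_notMem hy]
      simp
  · rw [indicator_of_notMem hx]
    simp

end

/-! ### Log-concave tails and the volume removed by a shifted cut -/

section

open MeasureTheory Set
open scoped ENNReal

/-- Log-concavity makes the successive ratios nonincreasing, so a first ratio of at most 1/3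
persists; after a zero term, monotonicity takes over. -/
theorem geometric_of_mul_le_sq {h : ℕ → ℝ} (h0 : ∀ j, 0 ≤ h j) (hanti : Antitone h)
    (hlc : ∀ j, h j * h (j + 2) ≤ h (j + 1) ^ 2) (ha : h 0 ≤ 1) (h1 : h 1 ≤ h 0 / 3) (j : ℕ) :
    h j ≤ (1 / 3) ^ j := by
  have step : ∀ j, h (j + 1) ≤ h j / 3 := by
    intro j
    induction j with
    | zero => exact h1
    | succ j ih =>
      rcases (h0 j).eq_or_lt with hj | hj
      · have e1 := hanti (Nat.le_succ j)
        have e2 := hanti (Nat.le_succ (j + 1))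
        have e3 := h0 (j + 1)
        simp only [Nat.succ_eq_add_one] at e1 e2
        have : h (j + 1) = 0 := by linarith
        linarith
      · have e1 := hlc j
        have e2 : h (j + 1) ^ 2 ≤ h j * (h (j + 1) / 3) := by
          nlinarith [h0 (j + 1)]
        exact le_of_mul_le_mul_left (e1.trans e2) hj
  induction j with
  | zero => simpa using ha
  | succ j ih =>
    rw [pow_succ]
    linarith [step j]

theorem two_mul_add_three_pow_four_le (j : ℕ) : (2 * j + 3) ^ 4 ≤ 1000 * 2 ^ j := by
  rcases lt_or_ge j 4 with hj | hj
  · interval_cases j <;> norm_num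
  · induction j, hj using Nat.le_induction with
    | base => norm_num
    | succ j hj ih =>
      obtain ⟨k, rfl⟩ := Nat.exists_eq_add_of_le hj
      have : (2 * (4 + k + 1) + 3) ^ 4 ≤ 2 * (2 * (4 + k) + 3) ^ 4 := by
        ring_nf
        nlinarith [sq_nonneg k]
      calc (2 * (4 + k + 1) + 3) ^ 4 ≤ 2 * (2 * (4 + k) + 3) ^ 4 := this
        _ ≤ 2 * (1000 * 2 ^ (4 + k)) := by omega
        _ = 1000 * 2 ^ (4 + k + 1) := by ring

section OneDim

variable {Ω : Type*} [MeasurableSpace Ω] {μ : Measure Ω} [IsProbabilityMeasure μ] {X : Ω → ℝ}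

/-- Exponential tails of a distribution of unit second moment whose tails are logarithmically
concave. -/
theorem measureReal_tail_le (hX : Measurable X) (hi : Integrable (fun ω => X ω ^ 2) μ)
    (h2 : ∫ ω, X ω ^ 2 ∂μ = 1)
    (hlc : ∀ s t, μ {ω | s < X ω} * μ {ω | t < X ω} ≤ μ {ω | (s + t) / 2 < X ω} ^ 2) (j : ℕ) :
    μ.real {ω | 4 * (j : ℝ) - 2 < X ω} ≤ (1 / 3) ^ j := by
  -- By Chebyshev the tail beyond 2 (j = 1) is at most 1/4 and the tail beyond -2 (j = 0) at least
  -- 3/4, which is the initial ratio 1/3.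
  have hcheb : μ.real {ω | 4 ≤ X ω ^ 2} ≤ 1 / 4 := by
    have := mul_meas_ge_le_integral_of_nonneg (μ := μ) (f := fun ω => X ω ^ 2)
      (Filter.Eventually.of_forall fun ω => sq_nonneg _) hi 4
    rw [h2] at this
    linarith
  have hms : MeasurableSet {ω | 4 ≤ X ω ^ 2} := measurableSet_le measurable_const (hX.pow_const 2)
  refine geometric_of_mul_le_sq (h := fun j : ℕ => μ.real {ω | 4 * (j : ℝ) - 2 < X ω})
    (fun j => measureReal_nonneg) ?_ ?_ measureReal_le_one ?_ j
  · intro i j hij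
    refine measureReal_mono fun ω hω => ?_
    have : (i : ℝ) ≤ j := by exact_mod_cast hij
    simp only [mem_ofPred_eq] at *
    linarith
  · intro j
    have := ENNReal.toReal_mono (by finiteness) (hlc (4 * (j : ℝ) - 2) (4 * ((j + 2 : ℕ) : ℝ) - 2))
    rw [ENNReal.toReal_mul, ENNReal.toReal_pow] at this
    have e : (4 * (j : ℝ) - 2 + (4 * ((j + 2 : ℕ) : ℝ) - 2)) / 2 = 4 * ((j + 1 : ℕ) : ℝ) - 2 := by
      push_cast
      ring
    rw [e] at this
    exact this
  · have e1 : μ.real {ω | 4 * ((1 : ℕ) : ℝ) - 2 < X ω} ≤ 1 / 4 := by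
      refine le_trans (measureReal_mono fun ω hω => ?_) hcheb
      simp only [mem_ofPred_eq, Nat.cast_one] at *
      nlinarith
    have e2 : 3 / 4 ≤ μ.real {ω | 4 * ((0 : ℕ) : ℝ) - 2 < X ω} := by
      have h3 := probReal_compl_eq_one_sub (μ := μ) hms
      have h4 : μ.real {ω | 4 ≤ X ω ^ 2}ᶜ ≤ μ.real {ω | 4 * ((0 : ℕ) : ℝ) - 2 < X ω} := by
        refine measureReal_mono fun ω hω => ?_
        simp only [mem_ofPred_eq, mem_compl_iff, not_le, Nat.cast_zero] at *
        nlinarith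
      refine le_trans ?_ (h3.ge.trans h4)
      linarith only [hcheb]
    show μ.real {ω | 4 * ((1 : ℕ) : ℝ) - 2 < X ω} ≤ μ.real {ω | 4 * ((0 : ℕ) : ℝ) - 2 < X ω} / 3
    linarith

/-- A value with |x| > 2 lies in a band 4j + 2 < |x| ≤ 4j + 6, and the j-th term alone pays for it.
This turns the fourth moment into a sum of tails. -/
theorem pow_four_le_sum_indicator {J : ℕ} {x : ℝ} (hx : |x| ≤ 4 * J + 2) :
    x ^ 4 ≤ 16 + ∑ j ∈ Finset.range J, (4 * (j : ℝ) + 6) ^ 4 *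
      ((Ioi (4 * ((j + 1 : ℕ) : ℝ) - 2)).indicator 1 x +
        (Ioi (4 * ((j + 1 : ℕ) : ℝ) - 2)).indicator 1 (-x)) := by
  have habs : x ^ 4 = |x| ^ 4 := by rw [pow_abs, abs_of_nonneg (by positivity)]
  have hnn : ∀ j ∈ Finset.range J, 0 ≤ (4 * (j : ℝ) + 6) ^ 4 *
      ((Ioi (4 * ((j + 1 : ℕ) : ℝ) - 2)).indicator 1 x +
        (Ioi (4 * ((j + 1 : ℕ) : ℝ) - 2)).indicator 1 (-x)) := fun j _ =>
    mul_nonneg (by positivity) (add_nonneg (indicator_nonneg (by simp) _)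
      (indicator_nonneg (by simp) _))
  rcases le_or_gt |x| 2 with h2 | h2
  · have : |x| ^ 4 ≤ 2 ^ 4 := pow_le_pow_left₀ (abs_nonneg _) h2 4
    have := Finset.sum_nonneg hnn
    linarith
  · obtain ⟨n, hn⟩ : ∃ n : ℕ, n = ⌈(|x| - 2) / 4⌉₊ := ⟨_, rfl⟩
    have hpos : 0 < (|x| - 2) / 4 := by linarith
    have hn0 : 0 < n := hn ▸ Nat.ceil_pos.2 hpos
    have hn1 : (|x| - 2) / 4 ≤ n := hn ▸ Nat.le_ceil _
    have hn2 : (n : ℝ) < (|x| - 2) / 4 + 1 := hn ▸ Nat.ceil_lt_add_one hpos.le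
    obtain ⟨j, rfl⟩ := Nat.exists_eq_add_of_lt hn0
    have hjJ : j < J := by
      have : 0 + j + 1 ≤ J := by
        rw [hn]
        exact Nat.ceil_le.2 (by linarith)
      omega
    have hs := Finset.single_le_sum hnn (Finset.mem_range.2 hjJ)
    have hj1 : |x| ≤ 4 * j + 6 := by push_cast at hn1; linarith
    have hj2 : 4 * ((j + 1 : ℕ) : ℝ) - 2 < |x| := by push_cast at hn2 ⊢; linarith
    have h1 : (1 : ℝ) ≤ (Ioi (4 * ((j + 1 : ℕ) : ℝ) - 2)).indicator 1 x +
        (Ioi (4 * ((j + 1 : ℕ) : ℝ) - 2)).indicator 1 (-x) := by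
      have n1 : (0 : ℝ) ≤ (Ioi (4 * ((j + 1 : ℕ) : ℝ) - 2)).indicator 1 x :=
        indicator_nonneg (by simp) _
      have n2 : (0 : ℝ) ≤ (Ioi (4 * ((j + 1 : ℕ) : ℝ) - 2)).indicator 1 (-x) :=
        indicator_nonneg (by simp) _
      rcases le_total 0 x with h0 | h0
      · rw [abs_of_nonneg h0] at hj2
        rw [indicator_of_mem (mem_Ioi.2 hj2)]
        simpa using n2
      · rw [abs_of_nonpos h0] at hj2
        rw [indicator_of_mem (a := -x) (mem_Ioi.2 hj2)]
        simpa using n1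
    have h4 : |x| ^ 4 ≤ (4 * (j : ℝ) + 6) ^ 4 := pow_le_pow_left₀ (abs_nonneg _) hj1 4
    have h5 := mul_le_mul_of_nonneg_left h1 (by positivity : (0 : ℝ) ≤ (4 * (j : ℝ) + 6) ^ 4)
    linarith

theorem integrable_pow_of_bound (hX : Measurable X) {B : ℝ} (hB : ∀ᵐ ω ∂μ, |X ω| ≤ B) (n : ℕ) :
    Integrable (fun ω => X ω ^ n) μ := by
  refine Integrable.of_bound (hX.pow_const n).aestronglyMeasurable (B ^ n) ?_
  filter_upwards [hB] with ω hω
  rw [norm_pow, Real.norm_eq_abs]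
  exact pow_le_pow_left₀ (abs_nonneg _) hω n

/-- The fourth moment is controlled by the second one. -/
theorem integral_pow_four_le (hX : Measurable X) {B : ℝ} (hB : ∀ᵐ ω ∂μ, |X ω| ≤ B)
    (h2 : ∫ ω, X ω ^ 2 ∂μ = 1)
    (hlc : ∀ s t, μ {ω | s < X ω} * μ {ω | t < X ω} ≤ μ {ω | (s + t) / 2 < X ω} ^ 2)
    (hlc' : ∀ s t, μ {ω | s < -X ω} * μ {ω | t < -X ω} ≤ μ {ω | (s + t) / 2 < -X ω} ^ 2) :
    ∫ ω, X ω ^ 4 ∂μ ≤ 50000 := by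
  have hi := fun n => integrable_pow_of_bound hX hB n
  obtain ⟨J, hJ⟩ := exists_nat_ge B
  have hms : ∀ j : ℕ, MeasurableSet {ω | 4 * ((j + 1 : ℕ) : ℝ) - 2 < X ω} := fun j =>
    measurableSet_lt measurable_const hX
  have hms' : ∀ j : ℕ, MeasurableSet {ω | 4 * ((j + 1 : ℕ) : ℝ) - 2 < -X ω} := fun j =>
    measurableSet_lt measurable_const hX.neg
  have hI : ∀ j : ℕ, Integrable ({ω | 4 * ((j + 1 : ℕ) : ℝ) - 2 < X ω}.indicator (1 : Ω → ℝ)) μ :=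
    fun j => (integrable_const (1 : ℝ)).indicator (hms j)
  have hI' : ∀ j : ℕ,
      Integrable ({ω | 4 * ((j + 1 : ℕ) : ℝ) - 2 < -X ω}.indicator (1 : Ω → ℝ)) μ :=
    fun j => (integrable_const (1 : ℝ)).indicator (hms' j)
  have hIs : ∀ j : ℕ, Integrable (fun ω => (4 * (j : ℝ) + 6) ^ 4 *
      ({ω | 4 * ((j + 1 : ℕ) : ℝ) - 2 < X ω}.indicator (1 : Ω → ℝ) ω +
        {ω | 4 * ((j + 1 : ℕ) : ℝ) - 2 < -X ω}.indicator (1 : Ω → ℝ) ω)) μ :=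
    fun j => ((hI j).add (hI' j)).const_mul _
  have step : ∫ ω, X ω ^ 4 ∂μ ≤ ∫ ω, (16 + ∑ j ∈ Finset.range J, (4 * (j : ℝ) + 6) ^ 4 *
      ({ω | 4 * ((j + 1 : ℕ) : ℝ) - 2 < X ω}.indicator (1 : Ω → ℝ) ω +
        {ω | 4 * ((j + 1 : ℕ) : ℝ) - 2 < -X ω}.indicator (1 : Ω → ℝ) ω)) ∂μ := by
    refine integral_mono_ae (hi 4)
      ((integrable_const _).add (integrable_finsetSum _ fun j _ => hIs j)) ?_
    filter_upwards [hB] with ω hω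
    have hωJ : |X ω| ≤ 4 * J + 2 := by
      have : (0 : ℝ) ≤ J := Nat.cast_nonneg J
      linarith
    exact pow_four_le_sum_indicator hωJ
  have hneg2 : ∫ ω, (-X ω) ^ 2 ∂μ = 1 := by simpa using h2
  have hnegi : Integrable (fun ω => (-X ω) ^ 2) μ := by simpa using hi 2
  -- The weights are at most 16000 · 2^j and the two tails together at most 2 · 3^(-j-1), so the
  -- series is dominated by a geometric one of ratio 2/3.
  have hterm : ∀ j : ℕ, ∫ ω, (4 * (j : ℝ) + 6) ^ 4 *
      ({ω | 4 * ((j + 1 : ℕ) : ℝ) - 2 < X ω}.indicator (1 : Ω → ℝ) ω +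
        {ω | 4 * ((j + 1 : ℕ) : ℝ) - 2 < -X ω}.indicator (1 : Ω → ℝ) ω) ∂μ ≤
      32000 / 3 * (2 / 3) ^ j := by
    intro j
    rw [integral_const_mul, integral_add (hI j) (hI' j), integral_indicator_one (hms j),
      integral_indicator_one (hms' j)]
    have e1 := measureReal_tail_le hX (hi 2) h2 hlc (j + 1)
    have e2 := measureReal_tail_le hX.neg hnegi hneg2 hlc' (j + 1)
    have e3 : (4 * (j : ℝ) + 6) ^ 4 ≤ 16 * (1000 * 2 ^ j) := by
      have : ((2 * j + 3 : ℕ) : ℝ) ^ 4 ≤ 1000 * 2 ^ j := by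
        exact_mod_cast two_mul_add_three_pow_four_le j
      push_cast at this
      calc (4 * (j : ℝ) + 6) ^ 4 = 16 * (2 * (j : ℝ) + 3) ^ 4 := by ring
        _ ≤ _ := by linarith
    calc _ ≤ 16 * (1000 * 2 ^ j) * ((1 / 3) ^ (j + 1) + (1 / 3 : ℝ) ^ (j + 1)) := by
          gcongr
          exact e2
      _ = _ := by
          rw [pow_succ, div_pow, div_pow]
          ring
  rw [integral_add (integrable_const _) (integrable_finsetSum _ fun j _ => hIs j),
    integral_finsetSum _ fun j _ => hIs j] at step
  have hsum : ∑ j ∈ Finset.range J, (32000 / 3 : ℝ) * (2 / 3) ^ j ≤ 32000 := by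
    rw [← Finset.mul_sum]
    have : ∑ j ∈ Finset.range J, (2 / 3 : ℝ) ^ j ≤ 3 := by
      rw [geom_sum_eq (by norm_num)]
      have : (0 : ℝ) ≤ (2 / 3) ^ J := by positivity
      rw [div_le_iff_of_neg (by norm_num)]
      linarith
    linarith
  have := Finset.sum_le_sum fun j (_ : j ∈ Finset.range J) => hterm j
  simp only [integral_const, probReal_univ, smul_eq_mul, one_mul] at step
  linarith

/-- A centred distribution of unit variance with logarithmically concave tails has a constant
proportion of its mass at a constant distance to the right of its mean. -/
theorem measureReal_right_tail_ge (hX : Measurable X) {B : ℝ} (hB : ∀ᵐ ω ∂μ, |X ω| ≤ B)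
    (h1 : ∫ ω, X ω ∂μ = 0) (h2 : ∫ ω, X ω ^ 2 ∂μ = 1)
    (hlc : ∀ s t, μ {ω | s < X ω} * μ {ω | t < X ω} ≤ μ {ω | (s + t) / 2 < X ω} ^ 2)
    (hlc' : ∀ s t, μ {ω | s < -X ω} * μ {ω | t < -X ω} ≤ μ {ω | (s + t) / 2 < -X ω} ^ 2) :
    1 / 2 ^ 24 ≤ μ.real {ω | 1 / 5120 < X ω} := by
  have hi := fun n => integrable_pow_of_bound hX hB n
  have h4 := integral_pow_four_le hX hB h2 hlc hlc'
  have hi1 : Integrable X μ := by simpa using hi 1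
  have hi1' : Integrable (fun ω => |X ω|) μ := hi1.abs
  have hms : MeasurableSet {ω | 1 / 5120 < X ω} := measurableSet_lt measurable_const hX
  have hI : Integrable ({ω | 1 / 5120 < X ω}.indicator (1 : Ω → ℝ)) μ :=
    (integrable_const (1 : ℝ)).indicator hms
  -- The linear term covers |X| ≤ 320 and the quartic one the rest. Unit variance and the
  -- fourth-moment bound then give E|X| > 1/640.
  have a1 : ∫ ω, X ω ^ 2 ∂μ ≤ ∫ ω, (320 * |X ω| + 1 / 102400 * X ω ^ 4) ∂μ := by
    refine integral_mono (hi 2) ((hi1'.const_mul _).add ((hi 4).const_mul _)) fun ω => ?_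
    show X ω ^ 2 ≤ 320 * |X ω| + 1 / 102400 * X ω ^ 4
    rw [← sq_abs (X ω), show X ω ^ 4 = |X ω| ^ 4 by rw [pow_abs, abs_of_nonneg (by positivity)]]
    have hx := abs_nonneg (X ω)
    rcases le_total |X ω| 320 with h | h
    · nlinarith [pow_nonneg hx 4]
    · nlinarith [mul_le_mul h h (by norm_num) hx, sq_nonneg |X ω|,
        mul_nonneg (sq_nonneg |X ω|) (sub_nonneg.2 (mul_le_mul h h (by norm_num) hx))]
  rw [h2, integral_add (hi1'.const_mul _) ((hi 4).const_mul _), integral_const_mul,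
    integral_const_mul] at a1
  -- The left side equals E|X| because X is centred. The integrand is at most 2/5120 off the event
  -- and is bounded on it by the other two terms. So 10240 times the probability is at least 1/640 -
  -- 4/5120 = 1/1280.
  have a2 : ∫ ω, (|X ω| + X ω) ∂μ ≤ ∫ ω, (2 / 5120 + 10240 *
      {ω | 1 / 5120 < X ω}.indicator (1 : Ω → ℝ) ω + 2 / 5120 * X ω ^ 2) ∂μ := by
    refine integral_mono (hi1'.add hi1)
      (((integrable_const _).add (hI.const_mul _)).add ((hi 2).const_mul _)) fun ω => ?_
    show |X ω| + X ω ≤ 2 / 5120 + 10240 *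
      {ω | 1 / 5120 < X ω}.indicator (1 : Ω → ℝ) ω + 2 / 5120 * X ω ^ 2
    by_cases hω : 1 / 5120 < X ω
    · rw [indicator_of_mem (by exact hω), abs_of_nonneg (by linarith)]
      simp only [Pi.one_apply]
      nlinarith [sq_nonneg (X ω - 5120)]
    · rw [indicator_of_notMem (by exact hω)]
      rw [not_lt] at hω
      have := sq_nonneg (X ω)
      rcases abs_cases (X ω) with h | h <;> linarith
  have e1 : Integrable (fun ω => 10240 * {ω | 1 / 5120 < X ω}.indicator (1 : Ω → ℝ) ω) μ :=
    hI.const_mul _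
  have e2 : Integrable
      (fun ω => 2 / 5120 + 10240 * {ω | 1 / 5120 < X ω}.indicator (1 : Ω → ℝ) ω) μ :=
    (integrable_const _).add e1
  rw [integral_add hi1' hi1, h1, integral_add e2 ((hi 2).const_mul _),
    integral_add (integrable_const _) e1, integral_const_mul, integral_const_mul, h2,
    integral_indicator_one hms] at a2
  simp only [integral_const, probReal_univ, smul_eq_mul, one_mul] at a2
  norm_num at a1 a2 ⊢
  linarith

end OneDim

namespace DistOpt

/-- The uniform distribution on a body. -/
noncomputable def uniformOn {d : ℕ} (P : Set (Vec d)) : Measure (Vec d) :=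
  (volume P)⁻¹ • volume.restrict P

/-- Bounded convex measurable sets of positive volume. -/
structure IsBody {d : ℕ} (P : Set (Vec d)) : Prop where
  convex : Convex ℝ P
  measurable : MeasurableSet P
  bounded : Bornology.IsBounded P
  volume_ne_zero : volume P ≠ 0

variable {d : ℕ} {P : Set (Vec d)}

theorem IsBody.volume_ne_top (hP : IsBody P) : volume P ≠ ∞ := hP.bounded.measure_lt_top.ne

theorem IsBody.isProbabilityMeasure (hP : IsBody P) : IsProbabilityMeasure (uniformOn P) :=
  ⟨by simp [uniformOn, ENNReal.inv_mul_cancel hP.volume_ne_zero hP.volume_ne_top]⟩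

theorem average_eq_integral_uniformOn {E : Type*} [NormedAddCommGroup E] [NormedSpace ℝ E]
    (f : Vec d → E) : ⨍ x in P, f x = ∫ x, f x ∂uniformOn P := setAverage_eq' _ f P

theorem IsBody.ae_mem (hP : IsBody P) : ∀ᵐ x ∂uniformOn P, x ∈ P :=
  Measure.ae_smul_measure (ae_restrict_mem hP.measurable) _

theorem IsBody.integrable (hP : IsBody P) {E : Type*} [NormedAddCommGroup E]
    {f : Vec d → E} (hf : Continuous f) : Integrable f (uniformOn P) := by
  have h1 : IntegrableOn f (closure P) volume :=
    hf.continuousOn.integrableOn_compact hP.bounded.isCompact_closure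
  exact (h1.mono_set subset_closure).smul_measure (ENNReal.inv_ne_top.2 hP.volume_ne_zero)

theorem IsBody.integral_inner_sub_centroid (hP : IsBody P) (v : Vec d) :
    ∫ x, inner ℝ v (x - centroid P) ∂uniformOn P = 0 := by
  have := hP.isProbabilityMeasure
  have hi : Integrable (fun x : Vec d => x - centroid P) (uniformOn P) :=
    hP.integrable (by fun_prop)
  rw [integral_inner hi, integral_sub (hP.integrable continuous_id') (integrable_const _),
    ← average_eq_integral_uniformOn]
  simp [centroid]

/-- The variance of the linear functional given by `v` under the uniform distribution on `P`. -/
noncomputable def directionalVariance (P : Set (Vec d)) (v : Vec d) : ℝ :=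
  ∫ x, inner ℝ v (x - centroid P) ^ 2 ∂uniformOn P

theorem uniformOn_apply {A : Set (Vec d)} (hA : MeasurableSet A) :
    uniformOn P A = (volume P)⁻¹ * volume (P ∩ A) := by
  rw [uniformOn, Measure.smul_apply, Measure.restrict_apply hA, inter_comm, smul_eq_mul]

/-- Midpoints of points of `P` above the levels s and t lie in `P` above (s + t)/2, so
Brunn–Minkowski applies to the parts of `P` cut off. -/
theorem IsBody.uniformOn_tail_mul_le (hP : IsBody P) {X : Vec d → ℝ} (hX : Measurable X)
    (hmid : ∀ x y, X ((1 / 2 : ℝ) • (x + y)) = (X x + X y) / 2) (s t : ℝ) :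
    uniformOn P {x | s < X x} * uniformOn P {x | t < X x} ≤
      uniformOn P {x | (s + t) / 2 < X x} ^ 2 := by
  have hm : ∀ s, MeasurableSet {x | s < X x} := fun s => measurableSet_lt measurable_const hX
  rw [uniformOn_apply (hm _), uniformOn_apply (hm _), uniformOn_apply (hm _), mul_mul_mul_comm,
    mul_pow, ← sq]
  refine mul_le_mul_right (volume_mul_volume_le_sq (hP.measurable.inter (hm _))
    (hP.measurable.inter (hm _)) (hP.measurable.inter (hm _)) fun x hx y hy => ⟨?_, ?_⟩) _
  · rw [smul_add]
    exact hP.convex hx.1 hy.1 (by norm_num) (by norm_num) (by norm_num)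
  · have h1 : s < X x := hx.2
    have h2 : t < X y := hy.2
    show (s + t) / 2 < X _
    rw [hmid]
    linarith

/-- A cut at a small constant multiple of the standard deviation beyond the centroid removes
a constant fraction of the volume. -/
theorem IsBody.volume_cut_le (hP : IsBody P) {v : Vec d} {t : ℝ}
    (hv : 0 < directionalVariance P v) (ht : t ≤ √(directionalVariance P v) / 5120) :
    volume (P ∩ {x | inner ℝ v x ≤ inner ℝ v (centroid P) + t}) ≤
      ENNReal.ofReal (1 - 1 / 2 ^ 24) * volume P := by
  have := hP.isProbabilityMeasure
  set σ := √(directionalVariance P v) with hσ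
  have hσ0 : 0 < σ := Real.sqrt_pos.2 hv
  set X : Vec d → ℝ := fun x => inner ℝ v (x - centroid P) / σ with hX
  have hXc : Continuous X := by fun_prop
  have hXm : Measurable X := hXc.measurable
  obtain ⟨B, hB⟩ : ∃ B, ∀ x ∈ P, |X x| ≤ B := by
    obtain ⟨B, hB⟩ := hP.bounded.isCompact_closure.exists_bound_of_continuousOn hXc.continuousOn
    exact ⟨B, fun x hx => hB x (subset_closure hx)⟩
  have hmid : ∀ x y, X ((1 / 2 : ℝ) • (x + y)) = (X x + X y) / 2 := by
    intro x y
    simp only [hX, inner_sub_right, inner_smul_right, inner_add_right]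
    ring
  have key := measureReal_right_tail_ge (μ := uniformOn P) hXm
    (hP.ae_mem.mono fun x hx => hB x hx) ?_ ?_ (hP.uniformOn_tail_mul_le hXm hmid)
    (hP.uniformOn_tail_mul_le (X := fun x => -X x) hXm.neg fun x y => by
      simp only [hmid]
      ring)
  · have hms : MeasurableSet {x | 1 / 5120 < X x} := measurableSet_lt measurable_const hXm
    have hsub : P ∩ {x | inner ℝ v x ≤ inner ℝ v (centroid P) + t} ⊆
        P ∩ {x | 1 / 5120 < X x}ᶜ := by
      refine inter_subset_inter_right _ fun x hx => ?_
      simp only [mem_ofPred_eq, mem_compl_iff, not_lt, hX] at hx ⊢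
      rw [div_le_iff₀ hσ0, inner_sub_right]
      linarith
    refine (measure_mono hsub).trans ?_
    have e1 : uniformOn P {x | 1 / 5120 < X x}ᶜ ≤ ENNReal.ofReal (1 - 1 / 2 ^ 24) := by
      rw [← ENNReal.ofReal_toReal (measure_ne_top (uniformOn P) _)]
      apply ENNReal.ofReal_le_ofReal
      have := probReal_compl_eq_one_sub (μ := uniformOn P) hms
      rw [measureReal_def] at this
      linarith
    rw [uniformOn_apply hms.compl] at e1
    calc volume (P ∩ {x | 1 / 5120 < X x}ᶜ)
        = (volume P)⁻¹ * volume (P ∩ {x | 1 / 5120 < X x}ᶜ) * volume P := by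
          rw [mul_right_comm, ENNReal.inv_mul_cancel hP.volume_ne_zero hP.volume_ne_top, one_mul]
      _ ≤ _ := mul_le_mul_left e1 _
  · simp only [hX, integral_div, hP.integral_inner_sub_centroid, zero_div]
  · simp only [hX, div_pow, integral_div]
    rw [hσ, Real.sq_sqrt hv.le]
    exact div_self hv.ne'

end DistOpt

end

/-! ### Covariance, width of a body, and rounded cuts -/

section

open MeasureTheory Set
open scoped ENNReal

namespace DistOpt

variable {d : ℕ} {P : Set (Vec d)}

/-- The factor `d` in place of `√d` is harmless, as it affects the costs only through logarithms. -/
theorem norm_le_of_forall_abs_le {x : Vec d} {t : ℝ} (ht : 0 ≤ t) (h : ∀ j, |x j| ≤ t) :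
    ‖x‖ ≤ d * t := by
  rw [EuclideanSpace.norm_eq]
  apply Real.sqrt_le_iff.2 ⟨by positivity, ?_⟩
  calc ∑ j, ‖x j‖ ^ 2 ≤ ∑ _j : Fin d, t ^ 2 :=
        Finset.sum_le_sum fun j _ => pow_le_pow_left₀ (norm_nonneg _) (h j) 2
    _ = d * t ^ 2 := by simp
    _ ≤ (d * t) ^ 2 := by
        rw [mul_pow]
        have : (d : ℝ) ≤ d ^ 2 := by exact_mod_cast Nat.le_self_pow two_ne_zero d
        gcongr

theorem directionalVariance_nonneg (P : Set (Vec d)) (v : Vec d) :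
    0 ≤ directionalVariance P v := integral_nonneg fun _ => sq_nonneg _

/-- By convexity `P` contains its image under the homothety with centre p and ratio r; the change of
variables contributes r^d. -/
theorem IsBody.integral_comp_homothety_le (hP : IsBody P) {p : Vec d} (hp : p ∈ P) {r : ℝ}
    (hr : 0 < r) (hr1 : r ≤ 1) {g : Vec d → ℝ} (hg : Continuous g) (hg0 : ∀ x, 0 ≤ g x) :
    r ^ d * ∫ x, g (p + r • (x - p)) ∂uniformOn P ≤ ∫ x, g x ∂uniformOn P := by
  have hder : ∀ x ∈ P, HasFDerivWithinAt (fun x => p + r • (x - p))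
      (r • ContinuousLinearMap.id ℝ (Vec d)) P x := fun x _ =>
    (((hasFDerivWithinAt_id x P).sub_const p).const_smul r).const_add p
  have hinj : InjOn (fun x => p + r • (x - p)) P := by
    intro x _ y _ hxy
    have h1 := smul_right_injective _ hr.ne' (add_left_cancel hxy)
    exact sub_left_injective h1
  have himg : (fun x => p + r • (x - p)) '' P ⊆ P := by
    rintro _ ⟨x, hx, rfl⟩
    have := hP.convex hp hx (sub_nonneg.2 hr1) hr.le (by ring)
    convert this using 1
    module
  have hint : IntegrableOn g P volume :=
    (hg.continuousOn.integrableOn_compact hP.bounded.isCompact_closure).mono_set subset_closure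
  have key := integral_image_eq_integral_abs_det_fderiv_smul volume hP.measurable hder hinj g
  have hdet : |(r • ContinuousLinearMap.id ℝ (Vec d)).det| = r ^ d := by
    rw [show (r • ContinuousLinearMap.id ℝ (Vec d)).det = r ^ d by
      simp [ContinuousLinearMap.det]]
    exact abs_of_nonneg (by positivity)
  rw [hdet, integral_smul] at key
  have hmono : ∫ x in (fun x => p + r • (x - p)) '' P, g x ≤ ∫ x in P, g x :=
    setIntegral_mono_set hint (Filter.Eventually.of_forall hg0)
      (Filter.Eventually.of_forall himg)
  rw [key, smul_eq_mul] at hmono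
  rw [uniformOn, integral_smul_measure, integral_smul_measure, smul_eq_mul, smul_eq_mul,
    mul_left_comm]
  exact mul_le_mul_of_nonneg_left hmono ENNReal.toReal_nonneg

/-- A body is contained in a dilate of its ellipsoid of inertia. -/
theorem IsBody.inner_sub_centroid_sq_le (hP : IsBody P) (hd : 0 < d) {p : Vec d} (hp : p ∈ P)
    (v : Vec d) :
    inner ℝ v (p - centroid P) ^ 2 ≤ 8 * d ^ 2 * directionalVariance P v := by
  have := hP.isProbabilityMeasure
  have hd' : (1 : ℝ) ≤ d := by exact_mod_cast hd
  -- Bernoulli gives r^d ≥ 1/2, while 1 - r is still of order 1/d. The copy of `P` shrunk towards p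
  -- has its centroid displaced by (1 - r)(p - centroid), and the square of this displacement along
  -- v enters the second moment of `P`.
  set r : ℝ := 1 - 1 / (2 * d) with hr
  have hr2 : 1 / (2 * (d : ℝ)) ≤ 1 / 2 := by
    apply one_div_le_one_div_of_le <;> linarith
  have hr0 : 0 < r := by linarith
  have hr1 : r ≤ 1 := by
    have : 0 ≤ 1 / (2 * (d : ℝ)) := by positivity
    linarith
  have hpow : 1 / 2 ≤ r ^ d := by
    have h1 := one_add_mul_le_pow (a := -(1 / (2 * (d : ℝ)))) (by linarith) d
    have h2 : 1 + (d : ℝ) * -(1 / (2 * (d : ℝ))) = 1 / 2 := by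
      field_simp
      ring
    rw [h2] at h1
    exact h1.trans_eq (by rw [hr]; ring)
  set m := inner ℝ v (p - centroid P) with hm
  have key := hP.integral_comp_homothety_le hp hr0 hr1
    (g := fun x => inner ℝ v (x - centroid P) ^ 2) (by fun_prop) fun x => sq_nonneg _
  have hexp : ∀ x : Vec d, inner ℝ v (p + r • (x - p) - centroid P) ^ 2 =
      ((1 - r) * m) ^ 2 + 2 * ((1 - r) * m) * r * inner ℝ v (x - centroid P) +
        r ^ 2 * inner ℝ v (x - centroid P) ^ 2 := by
    intro x
    have : p + r • (x - p) - centroid P =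
        (1 - r) • (p - centroid P) + r • (x - centroid P) := by module
    rw [this, inner_add_right, inner_smul_right, inner_smul_right]
    ring
  have i1 : Integrable (fun x : Vec d => inner ℝ v (x - centroid P)) (uniformOn P) :=
    hP.integrable (by fun_prop)
  have i2 : Integrable (fun x : Vec d => inner ℝ v (x - centroid P) ^ 2) (uniformOn P) :=
    hP.integrable (by fun_prop)
  have i3 : Integrable (fun x : Vec d => ((1 - r) * m) ^ 2 +
      2 * ((1 - r) * m) * r * inner ℝ v (x - centroid P)) (uniformOn P) :=
    hP.integrable (by fun_prop)
  simp only [hexp] at key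
  rw [integral_add i3 (i2.const_mul _), integral_add (integrable_const _) (i1.const_mul _),
    integral_const_mul, integral_const_mul, hP.integral_inner_sub_centroid] at key
  simp only [integral_const, probReal_univ, smul_eq_mul, one_mul, mul_zero, add_zero] at key
  change r ^ d * (((1 - r) * m) ^ 2 + r ^ 2 * directionalVariance P v) ≤
    directionalVariance P v at key
  have hV := directionalVariance_nonneg P v
  have h1 : 1 / 2 * ((1 - r) * m) ^ 2 ≤ directionalVariance P v := by
    refine le_trans ?_ key
    have : ((1 - r) * m) ^ 2 ≤ ((1 - r) * m) ^ 2 + r ^ 2 * directionalVariance P v :=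
      le_add_of_nonneg_right (by positivity)
    gcongr
  have h2 : ((1 - r) * m) ^ 2 = m ^ 2 / (4 * d ^ 2) := by
    rw [hr]
    field_simp
    ring
  rw [h2] at h1
  have h3 : m ^ 2 / (4 * d ^ 2) ≤ 2 * directionalVariance P v := by linarith
  rw [div_le_iff₀ (by positivity)] at h3
  linarith

theorem IsBody.abs_inner_sub_centroid_le (hP : IsBody P) (hd : 0 < d) {p : Vec d} (hp : p ∈ P)
    (v : Vec d) :
    |inner ℝ v (p - centroid P)| ≤ 3 * d * √(directionalVariance P v) := by
  apply abs_le_of_sq_le_sq _ (by positivity)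
  rw [mul_pow, Real.sq_sqrt (directionalVariance_nonneg P v)]
  refine (hP.inner_sub_centroid_sq_le hd hp v).trans ?_
  have := directionalVariance_nonneg P v
  have h2 : 0 ≤ (d : ℝ) ^ 2 * directionalVariance P v := by positivity
  nlinarith

/-- Zero variance would confine `P` to a hyperplane through the centroid, a null set. -/
theorem IsBody.directionalVariance_pos (hP : IsBody P) (hd : 0 < d) {v : Vec d} (hv : v ≠ 0) :
    0 < directionalVariance P v := by
  refine (directionalVariance_nonneg P v).lt_of_ne' fun h0 => hP.volume_ne_zero ?_
  set S : AffineSubspace ℝ (Vec d) := AffineSubspace.mk' (centroid P) (innerₛₗ ℝ v).ker with hS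
  have hne : S ≠ ⊤ := by
    intro h
    have h1 : centroid P + v ∈ S := h ▸ AffineSubspace.mem_top ℝ _ _
    rw [hS, AffineSubspace.mem_mk'] at h1
    simp [hv] at h1
  refine measure_mono_null (fun p hp => ?_) (Measure.addHaar_affineSubspace volume S hne)
  have h1 := hP.inner_sub_centroid_sq_le hd hp v
  rw [h0, mul_zero] at h1
  have h2 : inner ℝ v (p - centroid P) = 0 := by
    nlinarith [sq_nonneg (inner ℝ v (p - centroid P))]
  show p ∈ S
  rw [hS, AffineSubspace.mem_mk']
  simpa using h2

open Matrix

theorem IsBody.directionalVariance_eq (hP : IsBody P) (v : Vec d) :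
    directionalVariance P v = v.ofLp ⬝ᵥ covariance P *ᵥ v.ofLp := by
  have hexp : ∀ x : Vec d, inner ℝ v (x - centroid P) ^ 2 =
      ∑ j, ∑ k, v j * v k * ((x j - centroid P j) * (x k - centroid P k)) := by
    intro x
    rw [sq, PiLp.inner_apply, Finset.sum_mul_sum]
    refine Finset.sum_congr rfl fun j _ => Finset.sum_congr rfl fun k _ => ?_
    simp
    ring
  have hi : ∀ j k, Integrable
      (fun x : Vec d => v j * v k * ((x j - centroid P j) * (x k - centroid P k)))
      (uniformOn P) := fun j k => hP.integrable (by fun_prop)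
  rw [directionalVariance]
  simp only [hexp]
  rw [integral_finsetSum _ fun j _ => integrable_finsetSum _ fun k _ => hi j k]
  simp only [dotProduct, mulVec, Finset.mul_sum]
  refine Finset.sum_congr rfl fun j _ => ?_
  rw [integral_finsetSum _ fun k _ => hi j k]
  refine Finset.sum_congr rfl fun k _ => ?_
  rw [integral_const_mul, covariance, Matrix.of_apply, average_eq_integral_uniformOn]
  ring

theorem IsBody.covariance_posDef (hP : IsBody P) (hd : 0 < d) : (covariance P).PosDef := by
  refine Matrix.PosDef.of_dotProduct_mulVec_pos ?_ fun x hx => ?_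
  · ext j k
    simp only [conjTranspose_apply, covariance, of_apply, star_trivial]
    congr 1
    ext x
    ring
  · have := hP.directionalVariance_pos hd (v := WithLp.toLp 2 x) (by simpa using hx)
    rw [hP.directionalVariance_eq] at this
    simpa using this

open scoped MatrixOrder in
theorem IsBody.sqrtCovariance_mul_self (hP : IsBody P) (hd : 0 < d) :
    sqrtCovariance P * sqrtCovariance P = covariance P :=
  CFC.sqrt_mul_sqrt_self _ (hP.covariance_posDef hd).posSemidef.nonneg

open scoped MatrixOrder in
theorem transpose_sqrtCovariance (P : Set (Vec d)) : (sqrtCovariance P)ᵀ = sqrtCovariance P :=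
  (Matrix.nonneg_iff_posSemidef.1 (CFC.sqrt_nonneg (covariance P))).isHermitian

theorem IsBody.isUnit_det_sqrtCovariance (hP : IsBody P) (hd : 0 < d) :
    IsUnit (sqrtCovariance P).det := by
  have h := (Matrix.isUnit_iff_isUnit_det _).1 (hP.covariance_posDef hd).isUnit
  rw [← hP.sqrtCovariance_mul_self hd, det_mul] at h
  exact isUnit_of_mul_isUnit_left h

/-- With B² the covariance, the quadratic form B² at B⁻¹e is ‖e‖². Standard deviations thus become
Euclidean norms, the quantity that rounding controls. -/
theorem IsBody.directionalVariance_inv_sqrt (hP : IsBody P) (hd : 0 < d) (e : Vec d) :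
    directionalVariance P (toEuclideanLin (sqrtCovariance P)⁻¹ e) = ‖e‖ ^ 2 := by
  have hu := hP.isUnit_det_sqrtCovariance hd
  rw [hP.directionalVariance_eq, ← hP.sqrtCovariance_mul_self hd]
  set B := sqrtCovariance P with hB
  have hBt : Bᵀ = B := transpose_sqrtCovariance P
  change (B⁻¹ *ᵥ e.ofLp) ⬝ᵥ (B * B) *ᵥ (B⁻¹ *ᵥ e.ofLp) = _
  rw [← mulVec_mulVec, mulVec_mulVec _ B B⁻¹, mul_nonsing_inv _ hu, one_mulVec, dotProduct_mulVec,
    ← mulVec_transpose, hBt, mulVec_mulVec, mul_nonsing_inv _ hu, one_mulVec,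
    EuclideanSpace.real_norm_sq_eq]
  exact Finset.sum_congr rfl fun j _ => (sq _).symm

theorem IsBody.inv_sqrt_sqrt_apply (hP : IsBody P) (hd : 0 < d) (a : Vec d) :
    toEuclideanLin (sqrtCovariance P)⁻¹ (toEuclideanLin (sqrtCovariance P) a) = a := by
  have hu := hP.isUnit_det_sqrtCovariance hd
  rw [toLpLin_apply, toLpLin_apply]
  simp [nonsing_inv_mul _ hu]

theorem abs_roundCut_sub_le {N : ℕ} (hN : 0 < N) (P : Set (Vec d)) (a : Vec d) (j : Fin d) :
    |(roundCut N P a).toVec j - (‖toEuclideanLin (sqrtCovariance P) a‖⁻¹ •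
      toEuclideanLin (sqrtCovariance P) a : Vec d) j| ≤ 1 / N := by
  set w : Vec d := toEuclideanLin (sqrtCovariance P) a with hw
  have hN' : (0 : ℝ) < N := by exact_mod_cast hN
  set u : ℝ := w j / ‖w‖ with hu
  have hu1 : |u| ≤ 1 := by
    rw [hu, abs_div, abs_norm]
    exact div_le_one_of_le₀ (by simpa using PiLp.norm_apply_le w j) (norm_nonneg _)
  obtain ⟨hl, hr⟩ := abs_le.1 hu1
  have hf1 : -(N : ℤ) ≤ ⌊(N : ℝ) * u⌋ := by
    rw [Int.le_floor]
    push_cast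
    nlinarith
  have hf2 : ⌊(N : ℝ) * u⌋ ≤ N := by
    have : (⌊(N : ℝ) * u⌋ : ℝ) ≤ N := (Int.floor_le _).trans (by nlinarith)
    exact_mod_cast this
  -- The floor lies in [-N, N], so `Fin.ofNat` does not wrap around.
  have hval : ((roundCut N P a j : ℕ) : ℤ) = ⌊(N : ℝ) * u⌋ + N := by
    have h1 : (⌊(N : ℝ) * u⌋ + N).toNat < 2 * N + 1 := by omega
    have h2 : (roundCut N P a j : ℕ) = (⌊(N : ℝ) * u⌋ + N).toNat := by
      show (⌊(N : ℝ) * (w j / ‖w‖)⌋ + N).toNat % (2 * N + 1) = _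
      exact Nat.mod_eq_of_lt h1
    omega
  have hval' : ((roundCut N P a j : ℕ) : ℝ) = ⌊(N : ℝ) * u⌋ + N := by exact_mod_cast hval
  have hvec : (roundCut N P a).toVec j = ⌊(N : ℝ) * u⌋ / N := by
    simp only [Cut.toVec]
    rw [hval']
    ring
  have hsm : (‖w‖⁻¹ • w : Vec d) j = u := by
    rw [PiLp.smul_apply, hu, smul_eq_mul]
    ring
  rw [hvec, hsm, show (⌊(N : ℝ) * u⌋ / N - u : ℝ) = -((N * u - ⌊(N : ℝ) * u⌋) / N) by
    field_simp
    ring, abs_neg, abs_of_nonneg (div_nonneg (sub_nonneg.2 (Int.floor_le _)) hN'.le)]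
  gcongr
  linarith [Int.lt_floor_add_one ((N : ℝ) * u)]

theorem norm_roundCut_sub_le {N : ℕ} (hN : 0 < N) (P : Set (Vec d)) (a : Vec d) :
    ‖(roundCut N P a).toVec - ‖toEuclideanLin (sqrtCovariance P) a‖⁻¹ •
      toEuclideanLin (sqrtCovariance P) a‖ ≤ d / N := by
  have := norm_le_of_forall_abs_le (x := (roundCut N P a).toVec -
    ‖toEuclideanLin (sqrtCovariance P) a‖⁻¹ • toEuclideanLin (sqrtCovariance P) a)
    (by positivity) fun j => abs_roundCut_sub_le hN P a j
  rwa [mul_one_div] at this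

theorem IsBody.sqrtCovariance_apply_ne_zero (hP : IsBody P) (hd : 0 < d) {a : Vec d}
    (ha : a ≠ 0) : toEuclideanLin (sqrtCovariance P) a ≠ 0 := fun h => ha <| by
  rw [← hP.inv_sqrt_sqrt_apply hd a, h, map_zero]

/-- A rounded and shifted cut keeps every point of the halfspace from which it was rounded. -/
theorem IsBody.inner_roundCut_le (hP : IsBody P) (hd : 0 < d) {N : ℕ} (hN : 0 < N) {a x : Vec d}
    (hx : x ∈ P) (hax : inner ℝ a x ≤ inner ℝ a (centroid P)) {t : ℝ}
    (ht : 3 * (d : ℝ) ^ 2 / N ≤ t) :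
    inner ℝ (toEuclideanLin (sqrtCovariance P)⁻¹ (roundCut N P a).toVec) x ≤
      inner ℝ (toEuclideanLin (sqrtCovariance P)⁻¹ (roundCut N P a).toVec) (centroid P) + t := by
  set w : Vec d := toEuclideanLin (sqrtCovariance P) a with hw
  set e : Vec d := (roundCut N P a).toVec - ‖w‖⁻¹ • w with he
  have hen : ‖e‖ ≤ d / N := norm_roundCut_sub_le hN P a
  -- The rounded normal is a nonnegative multiple of `a` plus the image of the rounding error. The
  -- first part respects the halfspace; the second varies by at most 3d‖e‖ ≤ 3d²/N from its value at
  -- the centroid.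
  have hsplit : toEuclideanLin (sqrtCovariance P)⁻¹ (roundCut N P a).toVec =
      toEuclideanLin (sqrtCovariance P)⁻¹ e + ‖w‖⁻¹ • a := by
    rw [he, map_sub, map_smul, hw, hP.inv_sqrt_sqrt_apply hd, sub_add_cancel]
  have h1 := (le_abs_self _).trans
    (hP.abs_inner_sub_centroid_le hd hx (toEuclideanLin (sqrtCovariance P)⁻¹ e))
  rw [hP.directionalVariance_inv_sqrt hd, Real.sqrt_sq (norm_nonneg _)] at h1
  have h2 : 3 * (d : ℝ) * ‖e‖ ≤ t := by
    refine le_trans ?_ ht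
    calc 3 * (d : ℝ) * ‖e‖ ≤ 3 * d * (d / N) := by gcongr
      _ = 3 * (d : ℝ) ^ 2 / N := by ring
  have h3 : inner ℝ (‖w‖⁻¹ • a) (x - centroid P) ≤ 0 := by
    rw [real_inner_smul_left, inner_sub_right]
    exact mul_nonpos_of_nonneg_of_nonpos (by positivity) (by linarith)
  have h4 : inner ℝ (toEuclideanLin (sqrtCovariance P)⁻¹ (roundCut N P a).toVec)
      (x - centroid P) ≤ t := by
    rw [hsplit, inner_add_left]
    linarith
  rw [inner_sub_right] at h4
  linarith

/-- The rounded vector is within 1/2 of a unit vector. Its norm is the standard deviation of the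
announced functional, so a shift of 1/10240 stays within 1/5120 standard deviations. -/
theorem half_le_norm_roundCut {N : ℕ} (hN : 0 < N) (hNd : 2 * d ≤ N) {a : Vec d}
    (ha : toEuclideanLin (sqrtCovariance P) a ≠ 0) : 1 / 2 ≤ ‖(roundCut N P a).toVec‖ := by
  have h1 := norm_roundCut_sub_le hN P a
  have h2 : ‖‖toEuclideanLin (sqrtCovariance P) a‖⁻¹ • toEuclideanLin (sqrtCovariance P) a‖ = 1 :=
    norm_smul_inv_norm ha
  have h3 := norm_sub_norm_le (‖toEuclideanLin (sqrtCovariance P) a‖⁻¹ •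
    toEuclideanLin (sqrtCovariance P) a) (roundCut N P a).toVec
  rw [norm_sub_rev, h2] at h3
  have h4 : (d : ℝ) / N ≤ 1 / 2 := by
    rw [div_le_iff₀ (by exact_mod_cast hN)]
    have : (2 * d : ℝ) ≤ N := by exact_mod_cast hNd
    linarith
  linarith

/-- A rounded cut removes a constant fraction of the volume. -/
theorem IsBody.volume_updateBody_some_le (hP : IsBody P) (hd : 0 < d) {prm : CogParams}
    (hN : 0 < prm.resolution) (hNd : 2 * d ≤ prm.resolution) (ht : prm.shift ≤ 1 / 10240)
    (c : Vec d) {a : Vec d} (ha : a ≠ 0) :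
    volume (updateBody prm c P (some (roundCut prm.resolution P a))) ≤
      ENNReal.ofReal (1 - 1 / 2 ^ 24) * volume P := by
  have h1 := half_le_norm_roundCut hN hNd (hP.sqrtCovariance_apply_ne_zero hd ha)
  have h2 := hP.directionalVariance_inv_sqrt hd (roundCut prm.resolution P a).toVec
  refine hP.volume_cut_le ?_ ?_
  · rw [h2]
    positivity
  · rw [h2, Real.sqrt_sq (norm_nonneg _)]
    linarith

/-- A cut through the centroid along the objective removes a constant fraction of the volume. -/
theorem IsBody.volume_updateBody_none_le (hP : IsBody P) (hd : 0 < d) (prm : CogParams)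
    {c : Vec d} (hc : c ≠ 0) :
    volume (updateBody prm c P none) ≤ ENNReal.ofReal (1 - 1 / 2 ^ 24) * volume P := by
  have := hP.volume_cut_le (hP.directionalVariance_pos hd hc) (t := 0) (by positivity)
  simpa [updateBody] using this

end DistOpt

end

/-! ### Encoding, and execution in the two communication models -/

section

namespace DistOpt

variable {d N s : ℕ}

/-- The first bit tells the two cases apart, blocks of equal length can be separated again, and
binary digits beyond the size of 2N vanish. -/
theorem encode_injective : Function.Injective (encode : Option (Cut d N) → Message) := by
  have hk : ∀ k k' : Cut d N, encode (some k) = encode (some k') → k = k' := by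
    intro k k' h
    have h1 := congrArg Subtype.val h
    simp only [encode, List.cons.injEq, true_and] at h1
    have h2 := (List.eq_iff_flatten_eq (L := List.ofFn fun j : Fin d =>
        List.ofFn fun t : Fin (Nat.size (2 * N)) => Nat.testBit (k j : ℕ) t)
      (L' := List.ofFn fun j : Fin d =>
        List.ofFn fun t : Fin (Nat.size (2 * N)) => Nat.testBit (k' j : ℕ) t)).2
      ⟨h1, by simp [List.map_ofFn, Function.comp_def]⟩
    have h3 := List.ofFn_injective h2
    funext j
    have h4 := List.ofFn_injective (congrFun h3 j)
    apply Fin.ext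
    apply Nat.eq_of_testBit_eq
    intro t
    rcases lt_or_ge t (Nat.size (2 * N)) with ht | ht
    · exact congrFun h4 ⟨t, ht⟩
    · have hlt : ∀ l : Cut d N, (l j : ℕ) < 2 ^ t := fun l =>
        (Nat.lt_succ_iff.1 (l j).2).trans_lt
          ((Nat.lt_size_self _).trans_le (Nat.pow_le_pow_right (by norm_num) ht))
      rw [Nat.testBit_lt_two_pow (hlt k), Nat.testBit_lt_two_pow (hlt k')]
  intro o o' h
  cases o with
  | none =>
    cases o' with
    | none => rfl
    | some k => simpa [encode] using congrArg Subtype.val h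
  | some k =>
    cases o' with
    | none => simpa [encode] using congrArg Subtype.val h
    | some k' => rw [hk k k' h]

@[simp] theorem decode_encode (o : Option (Cut d N)) : decode (encode o) = o :=
  Function.leftInverse_invFun encode_injective o

theorem bits_encode_le (o : Option (Cut d N)) :
    bits (encode o) ≤ 1 + d * Nat.size (2 * N) := by
  cases o with
  | none => simp [bits, encode]
  | some k => simp [bits, encode, List.length_flatten, List.map_ofFn, Function.comp_def, add_comm]

variable (prm : CogParams) (c : Vec d)

/-- The outcome of a round of the protocol, given the outcomes of the rounds before. -/
noncomputable def nextOutcome (test : Fin s → Vec d → Option (Vec d))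
    (o : List (Option (Cut d prm.resolution))) : Option (Cut d prm.resolution) :=
  (List.finRange s).findSome? fun i => report prm c (test i) o

/-- The outcomes of the first rounds of the protocol. -/
noncomputable def outcomes (test : Fin s → Vec d → Option (Vec d)) :
    ℕ → List (Option (Cut d prm.resolution))
  | 0 => []
  | t + 1 => outcomes test t ++ [nextOutcome prm c test (outcomes test t)]

@[simp] theorem length_outcomes (test : Fin s → Vec d → Option (Vec d)) (t : ℕ) :
    (outcomes prm c test t).length = t := by
  induction t with
  | zero => rfl
  | succ t ih => simp [outcomes, ih]

section Coordinator

variable {X Y : Type} (test : Fin s → X → Vec d → Option (Vec d)) (finish : Option (Vec d) → Y)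
  (x : Fin s → X)

/-- Induction on the number r of remaining rounds. Broadcasts lag by one: `hm` says that the pending
message completes a server's list to the start signal followed by all outcomes so far. For t = 0 the
pending message is the start signal itself, because `getLast?.join` of the empty list is `none`. -/
theorem cogCoordinator_runs (r t : ℕ) (hrt : t + r = prm.rounds)
    (h : List (Fin s → Option Message)) (m : Fin s → List Message)
    (hh : h.map roundOutcome = outcomes prm c (fun i => test i (x i)) t)
    (hm : ∀ i, m i ++ [encode (outcomes prm c (fun i => test i (x i)) t).getLast?.join] =
      encode (none : Option (Cut d prm.resolution)) ::
        (outcomes prm c (fun i => test i (x i)) t).map encode) :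
    ∃ k ≤ r * (2 * s * (1 + d * Nat.size (2 * prm.resolution))),
      (cogCoordinator prm c test finish).Runs x h m
        (finish (best prm c (outcomes prm c (fun i => test i (x i)) prm.rounds))) k := by
  have hlen : h.length = t := by
    rw [← List.length_map (f := roundOutcome (N := prm.resolution) (d := d)), hh, length_outcomes]
  induction r generalizing t h m with
  | zero =>
    refine ⟨0, by simp, CoordinatorProtocol.Runs.halt _ _ _ ?_⟩
    have ht : t = prm.rounds := by omega
    subst ht
    simp [cogCoordinator, hlen, hh]
  | succ r ih =>
    set tr := fun i => test i (x i) with htr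
    set o := outcomes prm c tr t with ho
    set q : Fin s → Option Message := fun _ => some (encode o.getLast?.join) with hq
    set m' : Fin s → List Message := fun i => m i ++ (q i).toList with hm'
    set rep : Fin s → Option Message := fun i => some (encode (report prm c (tr i) o)) with hrep
    have hm'eq : ∀ i, m' i = encode (none : Option (Cut d prm.resolution)) :: o.map encode :=
      fun i => by simpa [hm', hq] using hm i
    have hserver : ∀ i, (cogCoordinator prm c test finish).server i (x i) (m' i) =
        encode (report prm c (tr i) o) := by
      intro i
      have e : (fun k : Option (Cut d prm.resolution) =>
          (decode (encode k) : Option (Cut d prm.resolution))) = id := by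
        ext1 k
        simp
      simp only [cogCoordinator, hm'eq, List.tail_cons, List.map_map, Function.comp_def, e,
        List.map_id, htr]
    have hout : roundOutcome rep = nextOutcome prm c tr o := by
      simp [roundOutcome, nextOutcome, hrep]
    have hstep : (h ++ [rep]).map roundOutcome = outcomes prm c tr (t + 1) := by
      rw [List.map_append, hh, List.map_singleton, hout]
      rfl
    obtain ⟨k, hk, hrun⟩ := ih (t + 1) (by omega) (h ++ [rep]) m' hstep (fun i => by
      rw [hm'eq]
      simp [outcomes, ← ho]) (by simp [hlen])
    refine ⟨_, ?_, CoordinatorProtocol.Runs.round h m _ k q rep m' ?_ rfl ?_ hrun⟩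
    · have hW : ∀ o' : Option (Cut d prm.resolution),
          optBits (some (encode o')) ≤ 1 + d * Nat.size (2 * prm.resolution) := bits_encode_le
      have h1 : ∑ i, optBits (q i) ≤ s * (1 + d * Nat.size (2 * prm.resolution)) := by
        simpa [hq] using Finset.sum_le_card_nsmul (Finset.univ : Finset (Fin s)) _ _ fun i _ => hW o.getLast?.join
      have h2 : ∑ i, optBits (rep i) ≤ s * (1 + d * Nat.size (2 * prm.resolution)) := by
        simpa [hq] using Finset.sum_le_card_nsmul (Finset.univ : Finset (Fin s)) _ _ fun i _ => hW (report prm c (tr i) o)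
      calc _ ≤ (s * (1 + d * Nat.size (2 * prm.resolution)) +
            s * (1 + d * Nat.size (2 * prm.resolution))) +
            r * (2 * s * (1 + d * Nat.size (2 * prm.resolution))) :=
          add_le_add (add_le_add h1 h2) hk
        _ = _ := by ring
    · have : ¬ prm.rounds ≤ h.length := by omega
      simp only [cogCoordinator, if_neg this, hh, hq]
    · funext i
      simp only [hq, Option.map_some, hrep]
      rw [hserver]

theorem cogCoordinator_outputsWithin {B : ℝ}
    (hB : (prm.rounds * (2 * s * (1 + d * Nat.size (2 * prm.resolution))) : ℝ) ≤ B) :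
    (cogCoordinator prm c test finish).OutputsWithin x
      (finish (best prm c (outcomes prm c (fun i => test i (x i)) prm.rounds))) B := by
  obtain ⟨k, hk, hrun⟩ := cogCoordinator_runs prm c test finish x prm.rounds 0 (by simp) []
    (fun _ => []) rfl (fun i => by simp [outcomes])
  exact ⟨k, hrun, le_trans (by exact_mod_cast hk) hB⟩

/-- Integer division hides an unfinished round, so all servers writing in one round work with the
same body. -/
theorem boardOutcomes_append_of_lt (b q : List Message) {t : ℕ} (hb : b.length = t * s)
    (hq : q.length < s) : boardOutcomes d N s (b ++ q) = boardOutcomes d N s b := by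
  have hs : 0 < s := by omega
  have e1 : (b ++ q).length / s = t := by
    rw [List.length_append, hb, add_comm, Nat.add_mul_div_right _ _ hs, Nat.div_eq_of_lt hq,
      zero_add]
  have e2 : b.length / s = t := by rw [hb, Nat.mul_div_cancel _ hs]
  rw [boardOutcomes, boardOutcomes, e1, e2]
  refine List.map_congr_left fun j hj => ?_
  have hj' : (j + 1) * s ≤ t * s := Nat.mul_le_mul_right s (List.mem_range.1 hj)
  rw [add_mul, one_mul] at hj'
  rw [List.drop_append_of_le_length (by omega), List.take_append_of_le_length]
  rw [List.length_drop]
  omega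

theorem boardOutcomes_append_block (b q : List Message) {t : ℕ} (hs : 0 < s)
    (hb : b.length = t * s) (hq : q.length = s) :
    boardOutcomes d N s (b ++ q) = boardOutcomes d N s b ++ [q.findSome? decode] := by
  have e1 : (b ++ q).length / s = t + 1 := by
    rw [List.length_append, hb, hq, ← Nat.succ_mul, Nat.mul_div_cancel _ hs]
  have e2 : b.length / s = t := by rw [hb, Nat.mul_div_cancel _ hs]
  rw [boardOutcomes, boardOutcomes, e1, e2, List.range_succ, List.map_append, List.map_singleton]
  congr 1
  · refine List.map_congr_left fun j hj => ?_
    have hj' : (j + 1) * s ≤ t * s := Nat.mul_le_mul_right s (List.mem_range.1 hj)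
    rw [add_mul, one_mul] at hj'
    rw [List.drop_append_of_le_length (by omega), List.take_append_of_le_length]
    rw [List.length_drop]
    omega
  · rw [← hb, List.drop_left, ← hq, List.take_length]

/-- Induction on the number r of messages still to be written, the board being split into t complete
rounds `b` and the i messages `q` of the current one. By `hqo`, the first cut in `q` is the first
report among the servers that have already written. -/
theorem cogBlackboard_runs [NeZero s] (r t i : ℕ) (hi : i < s)
    (hr : t * s + i + r = prm.rounds * s) (b q : List Message) (hb : b.length = t * s)
    (hq : q.length = i)
    (hbo : boardOutcomes d prm.resolution s b = outcomes prm c (fun i => test i (x i)) t)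
    (hqo : q.findSome? decode = ((List.finRange s).take i).findSome? fun j =>
      report prm c (test j (x j)) (outcomes prm c (fun i => test i (x i)) t)) :
    ∃ k ≤ r * (1 + d * Nat.size (2 * prm.resolution)),
      (cogBlackboard prm c test finish).Runs x (b ++ q)
        (finish (best prm c (outcomes prm c (fun i => test i (x i)) prm.rounds))) k := by
  have hs : 0 < s := by omega
  induction r generalizing t i b q with
  | zero =>
    have ht : t = prm.rounds ∧ i = 0 := by
      have h1 : t * s ≤ prm.rounds * s := by omega
      have h2 : prm.rounds * s < (t + 1) * s := by
        rw [add_mul]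
        omega
      have h3 := Nat.le_of_mul_le_mul_right h1 hs
      have h4 := Nat.lt_of_mul_lt_mul_right h2
      have : t = prm.rounds := by omega
      subst this
      exact ⟨rfl, by omega⟩
    obtain ⟨rfl, rfl⟩ := ht
    have hq0 : q = [] := List.length_eq_zero_iff.1 hq
    subst hq0
    refine ⟨0, by simp, BlackboardProtocol.Runs.halt _ _ ?_⟩
    simp [cogBlackboard, hb, hbo]
  | succ r ih =>
    set tr := fun i => test i (x i) with htr
    set o := outcomes prm c tr t with ho
    set i' : Fin s := ⟨i, hi⟩ with hi'
    have hlen : (b ++ q).length = t * s + i := by simp [hb, hq]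
    have hdiv : (b ++ q).length / s = t := by
      rw [hlen, add_comm, Nat.add_mul_div_right _ _ hs, Nat.div_eq_of_lt hi, zero_add]
    have hdrop : (b ++ q).drop ((b ++ q).length / s * s) = q := by
      rw [hdiv, ← hb, List.drop_left]
    have hboard : boardOutcomes d prm.resolution s (b ++ q) = o := by
      rw [boardOutcomes_append_of_lt b q hb (by omega), hbo]
    have hnext : (cogBlackboard prm c test finish).next (b ++ q) = Sum.inr i' := by
      have h1 : ¬ prm.rounds * s ≤ (b ++ q).length := by omega
      have h2 : Fin.ofNat s (b ++ q).length = i' := by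
        apply Fin.ext
        rw [Fin.val_ofNat, hlen, add_comm, Nat.add_mul_mod_self_right, Nat.mod_eq_of_lt hi]
      simp only [cogBlackboard, if_neg h1, h2]
    set msg := (cogBlackboard prm c test finish).server i' (x i') (b ++ q) with hmsg
    have hmsg' : msg = if (q.findSome? (decode (d := d) (N := prm.resolution))).isSome then
        encode (none : Option (Cut d prm.resolution)) else encode (report prm c (tr i') o) := by
      simp only [hmsg, cogBlackboard, hdrop, hboard, htr]
    have hbits : bits msg ≤ 1 + d * Nat.size (2 * prm.resolution) := by
      rw [hmsg']
      split_ifs <;> exact bits_encode_le _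
    have htake : (List.finRange s).take (i + 1) = (List.finRange s).take i ++ [i'] := by
      rw [List.take_add_one, List.getElem?_eq_getElem (by simpa using hi)]
      simp [hi']
    have hqo' : (q ++ [msg]).findSome? decode =
        ((List.finRange s).take (i + 1)).findSome? fun j => report prm c (tr j) o := by
      rw [htake, List.findSome?_append, List.findSome?_append, ← hqo, hmsg']
      -- If `q` already contains a cut, neither the new message nor the report it suppresses can
      -- change the first hit.
      cases hcase : q.findSome? (decode (d := d) (N := prm.resolution)) with
      | none => simp
      | some k => simp
    have hrec : ∃ k ≤ r * (1 + d * Nat.size (2 * prm.resolution)),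
        (cogBlackboard prm c test finish).Runs x (b ++ q ++ [msg])
          (finish (best prm c (outcomes prm c tr prm.rounds))) k := by
      rcases Nat.lt_or_ge (i + 1) s with hlt | hge
      · rw [List.append_assoc]
        exact ih t (i + 1) hlt (by omega) b (q ++ [msg]) hb (by simp [hq]) hbo hqo'
      · have his : i + 1 = s := by omega
        have hlast : (List.finRange s).take (i + 1) = List.finRange s := by
          rw [his, List.take_of_length_le (by simp)]
        rw [hlast] at hqo'
        have hres := ih (t + 1) 0 hs (by rw [add_mul]; omega) (b ++ (q ++ [msg])) []
          (by simp [hb, hq, add_mul, his]) rfl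
          (by
            rw [boardOutcomes_append_block b (q ++ [msg]) hs hb (by simp [hq, his]), hbo, hqo']
            rfl) (by simp)
        simpa using hres
    obtain ⟨k, hk, hrun⟩ := hrec
    refine ⟨_, ?_, BlackboardProtocol.Runs.write _ _ k i' msg hnext hmsg hrun⟩
    calc bits msg + k ≤ (1 + d * Nat.size (2 * prm.resolution)) +
          r * (1 + d * Nat.size (2 * prm.resolution)) := add_le_add hbits hk
      _ = _ := by ring

theorem cogBlackboard_outputsWithin [NeZero s] {B : ℝ}
    (hB : (prm.rounds * (2 * s * (1 + d * Nat.size (2 * prm.resolution))) : ℝ) ≤ B) :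
    (cogBlackboard prm c test finish).OutputsWithin x
      (finish (best prm c (outcomes prm c (fun i => test i (x i)) prm.rounds))) B := by
  obtain ⟨k, hk, hrun⟩ := cogBlackboard_runs prm c test finish x (prm.rounds * s) 0 0
    (NeZero.pos s) (by simp) [] [] (by simp) rfl (by simp [boardOutcomes, outcomes]) (by simp)
  refine ⟨k, hrun, le_trans ?_ hB⟩
  have h2 : k ≤ prm.rounds * (2 * s * (1 + d * Nat.size (2 * prm.resolution))) := by
    calc k ≤ _ := hk
      _ = prm.rounds * (1 * s * (1 + d * Nat.size (2 * prm.resolution))) := by ring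
      _ ≤ _ := by gcongr; norm_num
  exact_mod_cast h2

end Coordinator

end DistOpt

end

/-! ### Volume decay and the surviving ball -/

section

open MeasureTheory Set
open scoped ENNReal

namespace DistOpt

variable {d s : ℕ}

theorem measurableSet_cube (d : ℕ) (H : ℝ) : MeasurableSet (cube d H) := by
  have : cube d H = ⋂ j, {x : Vec d | |x j| ≤ H} := by
    ext x
    simp [cube]
  rw [this]
  exact MeasurableSet.iInter fun j => measurableSet_le (by fun_prop) measurable_const

theorem volume_cube (d : ℕ) (H : ℝ) : volume (cube d H) = ENNReal.ofReal (2 * H) ^ d := by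
  have hmp := PiLp.volume_preserving_toLp (Fin d)
  have he : WithLp.toLp 2 ⁻¹' cube d H = Set.pi univ fun _ : Fin d => Icc (-H) H := by
    ext x
    simp [cube, abs_le, Pi.le_def, forall_and]
  rw [← hmp.measure_preimage (measurableSet_cube d H).nullMeasurableSet, he, volume_pi_pi]
  simp only [Real.volume_Icc, Finset.prod_const, Finset.card_univ, Fintype.card_fin]
  congr 2
  ring

theorem convex_cube (d : ℕ) (H : ℝ) : Convex ℝ (cube d H) := by
  intro x hx y hy a b ha hb hab j
  have h1 := hx j
  have h2 := hy j
  rw [PiLp.add_apply, PiLp.smul_apply, PiLp.smul_apply, smul_eq_mul, smul_eq_mul]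
  calc |a * x j + b * y j| ≤ |a * x j| + |b * y j| := abs_add_le _ _
    _ = a * |x j| + b * |y j| := by rw [abs_mul, abs_mul, abs_of_nonneg ha, abs_of_nonneg hb]
    _ ≤ a * H + b * H := by gcongr
    _ = H := by rw [← add_mul, hab, one_mul]

theorem isBounded_cube (d : ℕ) {H : ℝ} (hH : 0 ≤ H) : Bornology.IsBounded (cube d H) :=
  (Metric.isBounded_closedBall (x := (0 : Vec d)) (r := d * H)).subset fun x hx => by
    rw [mem_closedBall_zero_iff]
    exact norm_le_of_forall_abs_le hH hx

/-- The inscribed cube of half side r/d is a crude lower bound, but the loss only affects the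
argument of a logarithm. -/
theorem ofReal_pow_le_volume_closedBall (hd : 0 < d) (q : Vec d) {r : ℝ} (hr : 0 ≤ r) :
    ENNReal.ofReal (2 * (r / d)) ^ d ≤ volume (Metric.closedBall q r) := by
  have hd' : (d : ℝ) ≠ 0 := by exact_mod_cast hd.ne'
  rw [← volume_cube, ← measure_preimage_add_right volume (-q) (cube d (r / d))]
  refine measure_mono fun x hx => ?_
  rw [mem_closedBall_iff_norm]
  have h1 : x - q ∈ cube d (r / d) := by simpa [sub_eq_add_neg] using hx
  have h2 := norm_le_of_forall_abs_le (by positivity) h1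
  rwa [mul_div_cancel₀ _ hd'] at h2

/-- Since (1 - x)^T ≤ exp(-xT), the hypothesis on T pushes the volume left of the initial cube below
that of the cube inscribed in the ball. -/
theorem one_sub_pow_mul_lt {T : ℕ} {H r : ℝ} (hd : 0 < d) (hH : 0 < H) (hr : 0 < r)
    (hT : 2 ^ 24 * d * Real.log (H * d / r) < T) :
    (1 - 1 / 2 ^ 24 : ℝ) ^ T * (2 * H) ^ d < (2 * (r / d)) ^ d := by
  have hd' : (0 : ℝ) < d := by exact_mod_cast hd
  have hpos : 0 < H * d / r := by positivity
  have h1 : (1 - 1 / 2 ^ 24 : ℝ) ^ T ≤ Real.exp (-(T / 2 ^ 24)) := by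
    have := Real.one_sub_le_exp_neg (1 / 2 ^ 24 : ℝ)
    calc (1 - 1 / 2 ^ 24 : ℝ) ^ T ≤ Real.exp (-(1 / 2 ^ 24)) ^ T :=
          pow_le_pow_left₀ (by norm_num) this T
      _ = Real.exp (-(T / 2 ^ 24)) := by
          rw [← Real.exp_nat_mul]
          congr 1
          ring
  have h2 : Real.exp (-(T / 2 ^ 24)) < (r / (H * d)) ^ d := by
    have e : (r / (H * d)) ^ d = Real.exp (-(d * Real.log (H * d / r))) := by
      rw [Real.exp_neg, Real.exp_nat_mul, Real.exp_log hpos, ← inv_pow, inv_div]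
    rw [e, Real.exp_lt_exp, neg_lt_neg_iff, lt_div_iff₀ (by norm_num)]
    linarith
  calc (1 - 1 / 2 ^ 24 : ℝ) ^ T * (2 * H) ^ d < (r / (H * d)) ^ d * (2 * H) ^ d :=
        mul_lt_mul_of_pos_right (h1.trans_lt h2) (by positivity)
    _ = (2 * (r / d)) ^ d := by
        rw [← mul_pow]
        congr 1
        field_simp

theorem convex_updateBody {prm : CogParams} {c : Vec d} {P : Set (Vec d)} (hP : Convex ℝ P)
    (o : Option (Cut d prm.resolution)) : Convex ℝ (updateBody prm c P o) := by
  cases o with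
  | none => exact hP.inter (convex_halfSpace_le (innerₛₗ ℝ c).isLinear _)
  | some k => exact hP.inter (convex_halfSpace_le (innerₛₗ ℝ _).isLinear _)

theorem measurableSet_updateBody {prm : CogParams} {c : Vec d} {P : Set (Vec d)}
    (hP : MeasurableSet P) (o : Option (Cut d prm.resolution)) :
    MeasurableSet (updateBody prm c P o) := by
  have h : ∀ (a : Vec d) (t : ℝ), MeasurableSet {x : Vec d | inner ℝ a x ≤ t} := fun a t =>
    measurableSet_le (by fun_prop) measurable_const
  cases o with
  | none => exact hP.inter (h _ _)
  | some k => exact hP.inter (h _ _)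

theorem updateBody_subset {prm : CogParams} {c : Vec d} {P : Set (Vec d)}
    (o : Option (Cut d prm.resolution)) : updateBody prm c P o ⊆ P := by
  cases o <;> exact inter_subset_left

variable (prm : CogParams) (c : Vec d) (test : Fin s → Vec d → Option (Vec d))

theorem body_outcomes_succ (t : ℕ) :
    body prm c (outcomes prm c test (t + 1)) =
      updateBody prm c (body prm c (outcomes prm c test t))
        (nextOutcome prm c test (outcomes prm c test t)) := by
  simp [body, outcomes]

theorem take_outcomes {t T : ℕ} (h : t ≤ T) :
    (outcomes prm c test T).take t = outcomes prm c test t := by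
  induction T, h using Nat.le_induction with
  | base => exact List.take_of_length_le (by simp)
  | succ T hT ih => rw [outcomes, List.take_append_of_le_length (by simpa using hT), ih]

theorem getElem?_outcomes {t T : ℕ} (h : t < T) :
    (outcomes prm c test T)[t]? = some (nextOutcome prm c test (outcomes prm c test t)) := by
  have h1 : (outcomes prm c test T)[t]? = ((outcomes prm c test T).take (t + 1))[t]? := by
    rw [List.getElem?_take_of_lt (Nat.lt_succ_self t)]
  rw [h1, take_outcomes prm c test h, outcomes, List.getElem?_append_right (by simp)]
  simp

theorem mem_accepted_iff {T : ℕ} {z : Vec d} :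
    z ∈ accepted prm c (outcomes prm c test T) ↔
      ∃ t < T, nextOutcome prm c test (outcomes prm c test t) = none ∧
        z = centroid (body prm c (outcomes prm c test t)) := by
  simp only [accepted, List.mem_filterMap, List.mem_range, length_outcomes]
  constructor
  · rintro ⟨t, ht, h⟩
    rw [getElem?_outcomes prm c test ht, take_outcomes prm c test ht.le] at h
    split_ifs at h with h'
    exact ⟨t, ht, by simpa using h', by simpa using h.symm⟩
  · rintro ⟨t, ht, h, rfl⟩
    refine ⟨t, ht, ?_⟩
    rw [getElem?_outcomes prm c test ht, take_outcomes prm c test ht.le, h, if_pos rfl]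

theorem nextOutcome_eq_none_iff (o : List (Option (Cut d prm.resolution))) :
    nextOutcome prm c test o = none ↔ ∀ i, test i (centroid (body prm c o)) = none := by
  simp [nextOutcome, report]

theorem exists_of_nextOutcome_eq_some {o : List (Option (Cut d prm.resolution))}
    {k : Cut d prm.resolution} (h : nextOutcome prm c test o = some k) :
    ∃ i a, test i (centroid (body prm c o)) = some a ∧
      k = roundCut prm.resolution (body prm c o) a := by
  obtain ⟨i, _, hi⟩ := List.exists_of_findSome?_eq_some h
  simp only [report, Option.map_eq_some_iff] at hi
  obtain ⟨a, ha, hk⟩ := hi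
  exact ⟨i, a, ha, hk.symm⟩

theorem forall_test_of_best_eq_some {T : ℕ} {z : Vec d}
    (h : best prm c (outcomes prm c test T) = some z) (i : Fin s) : test i z = none := by
  obtain ⟨t, _, h1, rfl⟩ := (mem_accepted_iff prm c test).1 (List.argmin_mem h)
  exact (nextOutcome_eq_none_iff prm c test _).1 h1 i

/-- The parameters under which rounded cuts are sound and effective. -/
structure CogParams.IsFine (prm : CogParams) (d : ℕ) : Prop where
  resolution_pos : 0 < prm.resolution
  two_mul_le : 2 * d ≤ prm.resolution
  le_shift : 3 * (d : ℝ) ^ 2 / prm.resolution ≤ prm.shift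
  shift_le : prm.shift ≤ 1 / 10240

variable {prm c test}

/-- One round of the protocol preserves a ball that satisfies all constraints and all objective
cuts, and removes a constant fraction of the volume. -/
theorem IsBody.step (hd : 0 < d) (hprm : prm.IsFine d) {q : Vec d} {r v : ℝ} (hr : 0 < r)
    (htest : ∀ i z a, test i z = some a →
      a ≠ 0 ∧ ∀ x ∈ Metric.closedBall q r, inner ℝ a x ≤ inner ℝ a z)
    (hv : ∀ x ∈ Metric.closedBall q r, inner ℝ c x ≤ v) {o : List (Option (Cut d prm.resolution))}
    (hP : IsBody (body prm c o)) (hq : Metric.closedBall q r ⊆ body prm c o)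
    (hacc : nextOutcome prm c test o = none → v < inner ℝ c (centroid (body prm c o))) :
    IsBody (updateBody prm c (body prm c o) (nextOutcome prm c test o)) ∧
    Metric.closedBall q r ⊆ updateBody prm c (body prm c o) (nextOutcome prm c test o) ∧
    volume (updateBody prm c (body prm c o) (nextOutcome prm c test o)) ≤
      ENNReal.ofReal (1 - 1 / 2 ^ 24) * volume (body prm c o) := by
  have hmain : Metric.closedBall q r ⊆
        updateBody prm c (body prm c o) (nextOutcome prm c test o) ∧
      volume (updateBody prm c (body prm c o) (nextOutcome prm c test o)) ≤
        ENNReal.ofReal (1 - 1 / 2 ^ 24) * volume (body prm c o) := by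
    cases hcase : nextOutcome prm c test o with
    | none =>
      have hlt := hacc hcase
      refine ⟨fun x hx => ⟨hq hx, (hv x hx).trans hlt.le⟩, ?_⟩
      refine hP.volume_updateBody_none_le hd prm ?_
      -- For c = 0 the value 0 at the centroid would exceed v, whereas v bounds the value 0 at the
      -- centre of the ball.
      rintro rfl
      have := hv q (Metric.mem_closedBall_self hr.le)
      simp only [inner_zero_left] at this hlt
      linarith
    | some k =>
      obtain ⟨i, a, ha, rfl⟩ := exists_of_nextOutcome_eq_some prm c test hcase
      obtain ⟨ha0, hax⟩ := htest i _ a ha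
      exact ⟨fun x hx => ⟨hq hx, hP.inner_roundCut_le hd hprm.resolution_pos (hq hx) (hax x hx)
        hprm.le_shift⟩, hP.volume_updateBody_some_le hd hprm.resolution_pos hprm.two_mul_le
        hprm.shift_le c ha0⟩
  refine ⟨⟨convex_updateBody hP.convex _, measurableSet_updateBody hP.measurable _,
    hP.bounded.subset (updateBody_subset _), fun h0 => ?_⟩, hmain⟩
  exact (Metric.measure_closedBall_pos volume q hr).ne' (measure_mono_null hmain.1 h0)

/-- If a ball satisfies all constraints with objective values at most `v`, then after sufficiently
many rounds the best accepted centroid exists and has value at most `v`. -/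
theorem exists_best_le (hd : 0 < d) (hprm : prm.IsFine d) {q : Vec d} {r v : ℝ} (hr : 0 < r)
    (hcube : Metric.closedBall q r ⊆ cube d prm.halfWidth)
    (htest : ∀ i z a, test i z = some a →
      a ≠ 0 ∧ ∀ x ∈ Metric.closedBall q r, inner ℝ a x ≤ inner ℝ a z)
    (hv : ∀ x ∈ Metric.closedBall q r, inner ℝ c x ≤ v) (hH : 0 < prm.halfWidth)
    (hT : 2 ^ 24 * d * Real.log (prm.halfWidth * d / r) < prm.rounds) :
    ∃ z, best prm c (outcomes prm c test prm.rounds) = some z ∧ inner ℝ c z ≤ v := by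
  -- Otherwise every accepted centroid has value above v, so objective cuts spare the ball as well,
  -- and it outlives the volume of the body.
  by_contra! hcon
  have hno : ∀ t < prm.rounds, nextOutcome prm c test (outcomes prm c test t) = none →
      v < inner ℝ c (centroid (body prm c (outcomes prm c test t))) := by
    intro t ht hnone
    have hmem := (mem_accepted_iff prm c test).2 ⟨t, ht, hnone, rfl⟩
    obtain ⟨z, hz⟩ : ∃ z, best prm c (outcomes prm c test prm.rounds) = some z := by
      rw [← Option.ne_none_iff_exists']
      intro h
      rw [best, List.argmin_eq_none] at h
      rw [h] at hmem
      simp at hmem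
    exact (hcon z hz).trans_le (List.le_of_mem_argmin hmem hz)
  have hinv : ∀ t ≤ prm.rounds, IsBody (body prm c (outcomes prm c test t)) ∧
      Metric.closedBall q r ⊆ body prm c (outcomes prm c test t) ∧
      volume (body prm c (outcomes prm c test t)) ≤
        ENNReal.ofReal (1 - 1 / 2 ^ 24) ^ t * volume (cube d prm.halfWidth) := by
    intro t
    induction t with
    | zero =>
      intro _
      refine ⟨⟨convex_cube d _, measurableSet_cube d _, isBounded_cube d hH.le, fun h0 => ?_⟩,
        hcube, ?_⟩
      · exact (Metric.measure_closedBall_pos volume q hr).ne' (measure_mono_null hcube h0)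
      · simp [body, outcomes]
    | succ t ih =>
      intro ht
      obtain ⟨h1, h2, h3⟩ := ih (by omega)
      rw [body_outcomes_succ]
      obtain ⟨h4, h5, h6⟩ := h1.step hd hprm hr htest hv h2 (hno t (by omega))
      refine ⟨h4, h5, h6.trans ?_⟩
      rw [pow_succ' (ENNReal.ofReal _), mul_assoc]
      exact mul_le_mul_right h3 _
  obtain ⟨-, h2, h3⟩ := hinv _ le_rfl
  have h4 := (ofReal_pow_le_volume_closedBall hd q hr.le).trans ((measure_mono h2).trans h3)
  have hd' : (0 : ℝ) < d := by exact_mod_cast hd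
  rw [volume_cube, ← ENNReal.ofReal_pow (by positivity), ← ENNReal.ofReal_pow (by norm_num),
    ← ENNReal.ofReal_pow (by positivity), ← ENNReal.ofReal_mul (pow_nonneg (by norm_num) _),
    ENNReal.ofReal_le_ofReal_iff (by
      have : (0 : ℝ) ≤ 1 - 1 / 2 ^ 24 := by norm_num
      positivity)] at h4
  exact absurd (one_sub_pow_mul_lt hd hH hr hT) (not_lt.2 h4)

/-- The half of a ball on which a linear functional does not exceed its value at the centre contains
a ball of half the radius. -/
theorem exists_closedBall_half (c x₀ : Vec d) {r : ℝ} (hr : 0 ≤ r) :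
    ∃ q, Metric.closedBall q (r / 2) ⊆ Metric.closedBall x₀ r ∧
      ∀ x ∈ Metric.closedBall q (r / 2), inner ℝ c x ≤ inner ℝ c x₀ := by
  -- The centre moves by r/2 against c; for c = 0 the convention 0⁻¹ = 0 leaves it in place.
  refine ⟨x₀ - (r / 2 * ‖c‖⁻¹) • c, fun x hx => ?_, fun x hx => ?_⟩
  · rw [mem_closedBall_iff_norm] at hx ⊢
    have h1 : ‖(r / 2 * ‖c‖⁻¹) • c‖ ≤ r / 2 := by
      rw [norm_smul, Real.norm_of_nonneg (by positivity), mul_assoc]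
      have : ‖c‖⁻¹ * ‖c‖ ≤ 1 := by
        rw [inv_mul_eq_div]
        exact div_self_le_one _
      nlinarith
    calc ‖x - x₀‖ = ‖(x - (x₀ - (r / 2 * ‖c‖⁻¹) • c)) - (r / 2 * ‖c‖⁻¹) • c‖ := by
          congr 1
          abel
      _ ≤ _ := norm_sub_le _ _
      _ ≤ r := by linarith
  · rw [mem_closedBall_iff_norm] at hx
    have h1 : x = x₀ + ((x - (x₀ - (r / 2 * ‖c‖⁻¹) • c)) - (r / 2 * ‖c‖⁻¹) • c) := by abel
    have h2 := (real_inner_le_norm c (x - (x₀ - (r / 2 * ‖c‖⁻¹) • c))).trans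
      (mul_le_mul_of_nonneg_left hx (norm_nonneg c))
    have h3 : inner ℝ c ((r / 2 * ‖c‖⁻¹) • c) = r / 2 * ‖c‖ := by
      rw [real_inner_smul_right, real_inner_self_eq_norm_sq]
      rcases eq_or_ne ‖c‖ 0 with h | h
      · simp [h]
      · field_simp
    rw [h1, inner_add_right, inner_sub_right, h3]
    linarith

end DistOpt

end

/-! ### Parameters, cost, and convex programming -/

section

open MeasureTheory Set

namespace DistOpt

variable {d s : ℕ}

/-- The parameters of the protocol in terms of the radius `r` of the ball that has to be found in
the cube of half side length `H`. -/
noncomputable def fineParams (d : ℕ) (H r : ℝ) : CogParams where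
  rounds := ⌊2 ^ 24 * d * Real.log (H * d / r)⌋₊ + 1
  -- This makes 3d²/N equal to the shift 1/10240.
  resolution := 30720 * d ^ 2
  shift := 1 / 10240
  halfWidth := H

theorem fineParams_isFine (hd : 0 < d) (H r : ℝ) : (fineParams d H r).IsFine d where
  resolution_pos := by
    simp only [fineParams]
    positivity
  two_mul_le := by
    simp only [fineParams]
    nlinarith
  le_shift := by
    have : (0 : ℝ) < d := by exact_mod_cast hd
    simp only [fineParams]
    push_cast
    rw [div_le_iff₀ (by positivity)]
    linarith
  shift_le := le_rfl

theorem lt_rounds_fineParams (d : ℕ) (H r : ℝ) :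
    2 ^ 24 * d * Real.log (H * d / r) < (fineParams d H r).rounds := by
  simpa only [fineParams, Nat.cast_add, Nat.cast_one] using Nat.lt_floor_add_one _

/-- The resolution depends on d alone, so a coordinate costs O(log d) bits independently of the
accuracy: the gain from rounding relative to the covariance. -/
theorem size_le_log (hd : 2 ≤ d) :
    (Nat.size (2 * (30720 * d ^ 2)) : ℝ) ≤ 31 * Real.log d := by
  have h1 : Nat.size (2 * (30720 * d ^ 2)) ≤ 18 + 2 * Nat.log 2 d := by
    rw [Nat.size_le]
    have h2 : d < 2 ^ (Nat.log 2 d + 1) := Nat.lt_pow_succ_log_self (by norm_num) d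
    calc 2 * (30720 * d ^ 2) ≤ 2 ^ 16 * d ^ 2 := by
          rw [← mul_assoc]
          gcongr
          norm_num
      _ < 2 ^ 16 * (2 ^ (Nat.log 2 d + 1)) ^ 2 := by gcongr
      _ = 2 ^ (18 + 2 * Nat.log 2 d) := by ring
  have h3 : (2 : ℝ) ^ Nat.log 2 d ≤ d := by exact_mod_cast Nat.pow_log_le_self 2 (by omega)
  have h4 := Real.log_le_log (by positivity) h3
  rw [Real.log_pow] at h4
  have h5 := Real.log_two_gt_d9
  have h6 : Real.log 2 ≤ Real.log d := Real.log_le_log (by norm_num) (by exact_mod_cast hd)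
  have h7 : (Nat.log 2 d : ℝ) * 0.69 ≤ Real.log d := by
    refine le_trans ?_ h4
    gcongr
    linarith
  have h8 : (Nat.size (2 * (30720 * d ^ 2)) : ℝ) ≤ 18 + 2 * Nat.log 2 d := by exact_mod_cast h1
  linarith

theorem one_le_mul_log (hd : 2 ≤ d) : 1 ≤ d * Real.log d := by
  have hd' : (2 : ℝ) ≤ d := by exact_mod_cast hd
  have h5 := Real.log_two_gt_d9
  have h6 : Real.log 2 ≤ Real.log d := Real.log_le_log (by norm_num) hd'
  nlinarith

/-- O(dℓ) rounds with 2s messages of O(d log d) bits each. The lower bound on ℓ absorbs the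
additional round in `fineParams`. -/
theorem fineParams_cost_le (hd : 2 ≤ d) (s : ℕ) {H r ℓ : ℝ} (hℓ : Real.log (H * d / r) ≤ ℓ)
    (hℓ1 : 1 ≤ 2 * ℓ) :
    ((fineParams d H r).rounds *
      (2 * s * (1 + d * Nat.size (2 * (fineParams d H r).resolution))) : ℝ) ≤
      2 ^ 31 * s * d ^ 2 * Real.log d * ℓ := by
  have hd' : (2 : ℝ) ≤ d := by exact_mod_cast hd
  have h1 := size_le_log hd
  have h2 := one_le_mul_log hd
  have h3 : (1 + d * (Nat.size (2 * (30720 * d ^ 2)) : ℝ)) ≤ 32 * (d * Real.log d) := by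
    nlinarith
  have h4 : ((fineParams d H r).rounds : ℝ) ≤ 2 ^ 25 * d * ℓ := by
    have h5 : (⌊2 ^ 24 * d * Real.log (H * d / r)⌋₊ : ℝ) ≤ 2 ^ 24 * d * ℓ := by
      rcases le_total 0 (2 ^ 24 * d * Real.log (H * d / r)) with h | h
      · refine (Nat.floor_le h).trans ?_
        gcongr
      · rw [Nat.floor_of_nonpos h]
        have : 0 ≤ ℓ := by linarith
        simp only [Nat.cast_zero]
        positivity
    simp only [fineParams]
    push_cast
    nlinarith
  have h0 : 0 ≤ ℓ := by linarith
  have h7 : 0 ≤ Real.log d := by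
    have := Real.log_nonneg (by linarith : (1 : ℝ) ≤ d)
    exact this
  calc ((fineParams d H r).rounds *
        (2 * s * (1 + d * Nat.size (2 * (fineParams d H r).resolution))) : ℝ)
      ≤ (2 ^ 25 * d * ℓ) * (2 * s * (32 * (d * Real.log d))) := by
        gcongr
        exact h3
    _ = 2 ^ 31 * s * d ^ 2 * Real.log d * ℓ := by ring

theorem mem_enlarge_of_mem {K : Set (Vec d)} {x y : Vec d} {t : ℝ} (hx : x ∈ K)
    (hy : y ∈ Metric.closedBall x t) : y ∈ enlarge K t := ⟨x, hx, hy⟩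

theorem enlarge_mono {K : Set (Vec d)} {t t' : ℝ} (h : t ≤ t') : enlarge K t ⊆ enlarge K t' :=
  fun _ ⟨x, hx, hy⟩ => ⟨x, hx, hy.trans h⟩

theorem closedBall_subset_cube {x : Vec d} {r H : ℝ} (h : ‖x‖ + r ≤ H) :
    Metric.closedBall x r ⊆ cube d H := by
  intro y hy j
  rw [mem_closedBall_iff_norm] at hy
  have h1 : |y j| ≤ ‖y‖ := by simpa using PiLp.norm_apply_le y j
  have h2 : ‖y‖ ≤ ‖y - x‖ + ‖x‖ := by
    simpa using norm_add_le (y - x) x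
  linarith

/-- A point that is close to each of finitely many convex sets is close to their intersection, if
the intersection contains a ball. -/
theorem mem_enlarge_iInter {K : Fin s → Set (Vec d)} (hK : ∀ i, Convex ℝ (K i)) {p y : Vec d}
    {ε δ : ℝ} (hε : 0 < ε) (hδ : 0 < δ) (hp : Metric.closedBall p ε ⊆ ⋂ i, K i)
    (hy : ∀ i, y ∈ enlarge (K i) δ) : y ∈ enlarge (⋂ i, K i) (δ / (δ + ε) * dist y p) := by
  have h0 : δ + ε ≠ 0 := by positivity
  -- For x ∈ K i near y, this is a convex combination of x and the ball point p + (ε/δ)(y - x). The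
  -- vector x cancels, so one point serves all i.
  refine ⟨(ε / (δ + ε)) • y + (δ / (δ + ε)) • p, mem_iInter.2 fun i => ?_, ?_⟩
  · obtain ⟨x, hx, hyx⟩ := hy i
    have hp' : p + (ε / δ) • (y - x) ∈ K i := by
      apply mem_iInter.1 (hp _) i
      rw [mem_closedBall_iff_norm, add_sub_cancel_left, norm_smul,
        Real.norm_of_nonneg (by positivity), ← dist_eq_norm]
      calc ε / δ * dist y x ≤ ε / δ * δ := by gcongr
        _ = ε := by field_simp
    have h1 := hK i hx hp' (a := ε / (δ + ε)) (b := δ / (δ + ε)) (by positivity) (by positivity)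
      (by field_simp; ring)
    convert h1 using 1
    rw [smul_add, smul_smul, show δ / (δ + ε) * (ε / δ) = ε / (δ + ε) by field_simp]
    module
  · have h1 : y - ((ε / (δ + ε)) • y + (δ / (δ + ε)) • p) = (δ / (δ + ε)) • (y - p) := by
      have h2 : ε / (δ + ε) = 1 - δ / (δ + ε) := by
        field_simp
        ring
      rw [h2]
      module
    rw [dist_eq_norm, h1, norm_smul, Real.norm_of_nonneg (by positivity), dist_eq_norm]

theorem convexProgramming (d : ℕ) (R ε : ℝ) (hd : 2 ≤ d) (hε : 0 < ε) (hεR : ε ≤ R) :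
    ∃ (prm : CogParams) (δ : ℝ), 0 < δ ∧
      ∀ (s : ℕ) [NeZero s] (c : Vec d) (test : Fin s → Set (Vec d) → Vec d → Option (Vec d)),
        (∀ i, IsSeparationRule δ (test i)) → ∀ K : Fin s → Set (Vec d), (∀ i, Convex ℝ (K i)) →
          (∀ i, K i ⊆ Metric.closedBall 0 R) → (⋂ i, K i).Nonempty →
          ∃ y : Vec d, IsAdditiveSolution c K ε y ∧
            (cogCoordinator prm c test id).OutputsWithin K (some y)
              (2 ^ 37 * s * (d : ℝ) ^ 2 * Real.log d * Real.log (R * d / ε)) ∧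
            (cogBlackboard prm c test id).OutputsWithin K (some y)
              (2 ^ 37 * s * (d : ℝ) ^ 2 * Real.log d * Real.log (R * d / ε)) := by
  have hR : 0 < R := hε.trans_le hεR
  have hd' : (2 : ℝ) ≤ d := by exact_mod_cast hd
  -- Since y is within 3R of the centre p, its distance from the intersection will be at most (δ/ε)
  -- · 3R = 3ε/4.
  set δ := ε ^ 2 / (4 * R) with hδ
  have hδ0 : 0 < δ := by positivity
  have hδε : δ ≤ ε / 4 := by
    rw [hδ, div_le_iff₀ (by positivity)]
    nlinarith
  refine ⟨fineParams d (2 * R) (δ / 2), δ, hδ0, ?_⟩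
  set prm := fineParams d (2 * R) (δ / 2) with hprm
  intro s _ c test htest K hK hKR hne
  set tr : Fin s → Vec d → Option (Vec d) := fun i => test i (K i) with htr
  -- The δ-ball about a feasible x lies in every K i + δB, and half of it contains a ball of radius
  -- δ/2 at level at most ⟨c, x⟩. The best centroid does not depend on x, so it is at least as good
  -- as every feasible point.
  have hbest : ∀ x ∈ ⋂ i, K i, ∃ z, best prm c (outcomes prm c tr prm.rounds) = some z ∧
      inner ℝ c z ≤ inner ℝ c x := by
    intro x hx
    obtain ⟨q, hq, hqv⟩ := exists_closedBall_half c x hδ0.le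
    have hxn : ‖x‖ ≤ R := by
      simpa using hKR (Fin.ofNat s 0) (mem_iInter.1 hx _)
    refine exists_best_le (by omega) (fineParams_isFine (by omega) _ _) (half_pos hδ0)
      (hq.trans (closedBall_subset_cube (by simp only [fineParams]; linarith))) ?_ hqv
      (by simp only [fineParams]; positivity) (lt_rounds_fineParams _ _ _)
    intro i z a ha
    obtain ⟨h1, h2⟩ := (htest i (K i) (hK i) z).2 a ha
    exact ⟨h1, fun y hy => h2 y (mem_enlarge_of_mem (mem_iInter.1 hx i) (hq hy))⟩
  obtain ⟨x₀, hx₀⟩ := hne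
  obtain ⟨y, hy, -⟩ := hbest x₀ hx₀
  have hyK : ∀ i, y ∈ enlarge (K i) δ := fun i =>
    (htest i (K i) (hK i) y).1.1 (forall_test_of_best_eq_some prm c tr hy i)
  have hy1 : 2 ≤ R * d / ε := by
    rw [le_div_iff₀ hε]
    nlinarith
  have hlog : Real.log (2 * R * d / (δ / 2)) ≤ 6 * Real.log (R * d / ε) := by
    rw [show (6 : ℝ) = ((6 : ℕ) : ℝ) by norm_num, ← Real.log_pow]
    apply Real.log_le_log (by positivity)
    have e1 : 2 * R * d / (δ / 2) = 16 * (R * d / ε) ^ 2 / d := by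
      rw [hδ]
      field_simp
      ring
    have e2 : (2 : ℝ) ^ 4 ≤ (R * d / ε) ^ 4 := by gcongr
    rw [e1]
    calc 16 * (R * d / ε) ^ 2 / d ≤ 16 * (R * d / ε) ^ 2 :=
          div_le_self (by positivity) (by linarith)
      _ ≤ (R * d / ε) ^ 4 * (R * d / ε) ^ 2 := by
          gcongr
          linarith
      _ = (R * d / ε) ^ 6 := by ring
  have hlog2 : Real.log 2 ≤ Real.log (R * d / ε) := Real.log_le_log (by norm_num) hy1
  have hlog3 := Real.log_two_gt_d9
  have hlogd : 0 ≤ Real.log d := Real.log_nonneg (by linarith)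
  have hcost : (prm.rounds * (2 * s * (1 + d * Nat.size (2 * prm.resolution))) : ℝ) ≤
      2 ^ 37 * s * (d : ℝ) ^ 2 * Real.log d * Real.log (R * d / ε) := by
    refine (fineParams_cost_le hd s hlog (by linarith)).trans ?_
    have : 0 ≤ (s : ℝ) * d ^ 2 * Real.log d * Real.log (R * d / ε) := by
      have : 0 ≤ Real.log (R * d / ε) := by linarith
      positivity
    nlinarith
  refine ⟨y, ⟨?_, fun i => enlarge_mono (by linarith) (hyK i), ?_⟩, ?_, ?_⟩
  · intro x hx
    obtain ⟨z, hz, hzx⟩ := hbest x hx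
    rw [hy] at hz
    obtain rfl := Option.some_injective _ hz
    linarith
  · rintro ⟨p, hp⟩
    refine enlarge_mono ?_ (mem_enlarge_iInter hK hε hδ0 hp hyK)
    have hpn : ‖p‖ ≤ R := by
      simpa using hKR (Fin.ofNat s 0)
        (mem_iInter.1 (hp (Metric.mem_closedBall_self hε.le)) (Fin.ofNat s 0))
    obtain ⟨x, hx, hyx⟩ := hyK (Fin.ofNat s 0)
    have hxn : ‖x‖ ≤ R := by simpa using hKR _ hx
    have h1 : dist y p ≤ 3 * R := by
      have h2 := dist_triangle y x p
      have h3 : dist x p ≤ ‖x‖ + ‖p‖ := by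
        rw [dist_eq_norm]
        exact norm_sub_le _ _
      linarith
    calc δ / (δ + ε) * dist y p ≤ δ / ε * (3 * R) := by
          gcongr
          linarith
      _ = 3 / 4 * ε := by
          rw [hδ]
          field_simp
      _ ≤ ε := by linarith
  · have := cogCoordinator_outputsWithin prm c test id K hcost
    rwa [← htr, hy] at this
  · have := cogBlackboard_outputsWithin prm c test id K hcost
    rwa [← htr, hy] at this

end DistOpt

end

/-! ### Vertices of polyhedra and Cramer's rule -/

section

open Set Matrix

section Polyhedra

variable {n : ℕ} {ι : Type*}

/-- From a point of a polyhedron whose active constraints do not span one can move to a point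
with more active constraints without increasing the objective. -/
theorem exists_span_active_lt [Finite ι] {a : ι → Fin n → ℝ} {b : ι → ℝ} {c x : Fin n → ℝ} {m : ℝ}
    (hspan : Submodule.span ℝ (range a) = ⊤) (hx : ∀ r, a r ⬝ᵥ x ≤ b r)
    (hm : ∀ y, (∀ r, a r ⬝ᵥ y ≤ b r) → m ≤ c ⬝ᵥ y)
    (hW : Submodule.span ℝ (a '' {r | a r ⬝ᵥ x = b r}) ≠ ⊤) :
    ∃ y, (∀ r, a r ⬝ᵥ y ≤ b r) ∧ c ⬝ᵥ y ≤ c ⬝ᵥ x ∧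
      Submodule.span ℝ (a '' {r | a r ⬝ᵥ x = b r}) <
        Submodule.span ℝ (a '' {r | a r ⬝ᵥ y = b r}) := by
  -- This gives a direction `u₀` orthogonal to all active normals, but not to all normals, as these
  -- span.
  obtain ⟨f, hf0, hf⟩ := Submodule.exists_le_ker_of_lt_top _ (lt_top_iff_ne_top.2 hW)
  set u₀ : Fin n → ℝ := fun i => f (Pi.single i 1) with hu₀
  have hfu : ∀ w, f w = w ⬝ᵥ u₀ := by
    intro w
    conv_lhs => rw [← Finset.univ_sum_single w]
    rw [map_sum, dotProduct]
    refine Finset.sum_congr rfl fun i _ => ?_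
    rw [show Pi.single i (w i) = w i • (Pi.single i 1 : Fin n → ℝ) by
      rw [← Pi.single_smul]
      simp, map_smul, smul_eq_mul]
  have hact : ∀ w ∈ Submodule.span ℝ (a '' {r | a r ⬝ᵥ x = b r}), w ⬝ᵥ u₀ = 0 := by
    intro w hw
    rw [← hfu]
    exact hf hw
  obtain ⟨r₀, hr₀⟩ : ∃ r, a r ⬝ᵥ u₀ ≠ 0 := by
    by_contra! hcon
    apply hf0
    have : (⊤ : Submodule ℝ (Fin n → ℝ)) ≤ LinearMap.ker f := by
      rw [← hspan, Submodule.span_le]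
      rintro _ ⟨r, rfl⟩
      show f (a r) = 0
      rw [hfu, hcon]
    exact LinearMap.ker_eq_top.1 (top_le_iff.1 this)
  -- Along an unblocked descent direction, the step t below would reach the value m - 1.
  have hray : ∀ u : Fin n → ℝ, c ⬝ᵥ u < 0 → ∃ r, 0 < a r ⬝ᵥ u := by
    intro u hu
    by_contra! hcon
    set t : ℝ := (c ⬝ᵥ x - m + 1) / -(c ⬝ᵥ u) with ht
    have hmx := hm x hx
    have ht0 : 0 ≤ t := div_nonneg (by linarith) (by linarith)
    have h1 := hm (x + t • u) fun r => by
      rw [dotProduct_add, dotProduct_smul, smul_eq_mul]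
      have := mul_nonpos_of_nonneg_of_nonpos ht0 (hcon r)
      linarith [hx r]
    rw [dotProduct_add, dotProduct_smul, smul_eq_mul] at h1
    have h2 : t * (c ⬝ᵥ u) = -(c ⬝ᵥ x - m + 1) := by
      rw [ht, div_mul_eq_mul_div, div_eq_iff (by linarith)]
      ring
    linarith
  obtain ⟨u, hu, hcu, r₁, hr₁⟩ : ∃ u : Fin n → ℝ,
      (∀ w ∈ Submodule.span ℝ (a '' {r | a r ⬝ᵥ x = b r}), w ⬝ᵥ u = 0) ∧ c ⬝ᵥ u ≤ 0 ∧
        ∃ r, 0 < a r ⬝ᵥ u := by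
    have hneg : ∀ w ∈ Submodule.span ℝ (a '' {r | a r ⬝ᵥ x = b r}), w ⬝ᵥ (-u₀) = 0 :=
      fun w hw => by rw [dotProduct_neg, hact w hw, neg_zero]
    rcases lt_trichotomy (c ⬝ᵥ u₀) 0 with h | h | h
    · exact ⟨u₀, hact, h.le, hray u₀ h⟩
    · rcases lt_or_gt_of_ne hr₀ with h' | h'
      · exact ⟨-u₀, hneg, by rw [dotProduct_neg, h, neg_zero], r₀, by
          rw [dotProduct_neg]
          linarith⟩
      · exact ⟨u₀, hact, h.le, r₀, h'⟩
    · have h' : c ⬝ᵥ (-u₀) < 0 := by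
        rw [dotProduct_neg]
        linarith
      exact ⟨-u₀, hneg, h'.le, hray _ h'⟩
  -- Ratio test: the first row to become tight along u has a normal not orthogonal to u, hence
  -- outside the old active span.
  obtain ⟨r, hr, hmin⟩ := Set.exists_min_image {r | 0 < a r ⬝ᵥ u}
    (fun r => (b r - a r ⬝ᵥ x) / (a r ⬝ᵥ u)) (Set.toFinite _) ⟨r₁, hr₁⟩
  set t := (b r - a r ⬝ᵥ x) / (a r ⬝ᵥ u) with ht
  have hr' : 0 < a r ⬝ᵥ u := hr
  have ht0 : 0 ≤ t := div_nonneg (sub_nonneg.2 (hx r)) hr'.le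
  have hdot : ∀ w : Fin n → ℝ, w ⬝ᵥ (x + t • u) = w ⬝ᵥ x + t * (w ⬝ᵥ u) := fun w => by
    rw [dotProduct_add, dotProduct_smul, smul_eq_mul]
  refine ⟨x + t • u, fun r' => ?_, ?_, ?_⟩
  · rw [hdot]
    rcases le_or_gt (a r' ⬝ᵥ u) 0 with h | h
    · have := mul_nonpos_of_nonneg_of_nonpos ht0 h
      linarith [hx r']
    · have h1 := hmin r' h
      have h2 : t * (a r' ⬝ᵥ u) ≤ b r' - a r' ⬝ᵥ x := (le_div_iff₀ h).1 h1
      linarith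
  · rw [hdot]
    have := mul_nonpos_of_nonneg_of_nonpos ht0 hcu
    linarith
  · refine lt_of_le_of_ne (Submodule.span_mono (image_mono fun r' hr' => ?_)) fun heq => ?_
    · show a r' ⬝ᵥ (x + t • u) = b r'
      rw [hdot, hu _ (Submodule.subset_span ⟨r', hr', rfl⟩), mul_zero, add_zero]
      exact hr'
    · have h1 : a r ∈ Submodule.span ℝ (a '' {r | a r ⬝ᵥ (x + t • u) = b r}) := by
        refine Submodule.subset_span ⟨r, ?_, rfl⟩
        show a r ⬝ᵥ (x + t • u) = b r
        rw [hdot, ht, div_mul_cancel₀ _ hr'.ne']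
        ring
      rw [← heq] at h1
      exact hr'.ne' (hu _ h1)

/-- A linear objective that is bounded below on a polyhedron without lines is improved by
a vertex. -/
theorem exists_vertex_le [Finite ι] {a : ι → Fin n → ℝ} {b : ι → ℝ} {c x : Fin n → ℝ} {m : ℝ}
    (hspan : Submodule.span ℝ (range a) = ⊤) (hx : ∀ r, a r ⬝ᵥ x ≤ b r)
    (hm : ∀ y, (∀ r, a r ⬝ᵥ y ≤ b r) → m ≤ c ⬝ᵥ y) :
    ∃ y, (∀ r, a r ⬝ᵥ y ≤ b r) ∧ c ⬝ᵥ y ≤ c ⬝ᵥ x ∧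
      Submodule.span ℝ (a '' {r | a r ⬝ᵥ y = b r}) = ⊤ := by
  -- Induction on the codimension of the span of the active normals.
  induction hk : n - Module.finrank ℝ (Submodule.span ℝ (a '' {r | a r ⬝ᵥ x = b r}))
    using Nat.strong_induction_on generalizing x with
  | _ k ih =>
    by_cases hW : Submodule.span ℝ (a '' {r | a r ⬝ᵥ x = b r}) = ⊤
    · exact ⟨x, hx, le_rfl, hW⟩
    · obtain ⟨y, hy, hcy, hlt⟩ := exists_span_active_lt hspan hx hm hW
      have h1 := Submodule.finrank_lt_finrank_of_lt hlt
      have h2 := Submodule.finrank_le (Submodule.span ℝ (a '' {r | a r ⬝ᵥ y = b r}))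
      rw [Module.finrank_fin_fun] at h2
      obtain ⟨z, hz, hcz, hzW⟩ := ih _ (by omega) hy rfl
      exact ⟨z, hz, hcz.trans hcy, hzW⟩

theorem exists_det_ne_zero_of_span_eq_top {a : ι → Fin n → ℝ} {s : Set ι}
    (h : Submodule.span ℝ (a '' s) = ⊤) :
    ∃ f : Fin n → ι, (∀ i, f i ∈ s) ∧ (Matrix.of fun i => a (f i)).det ≠ 0 := by
  obtain ⟨t, hts, htspan, hli⟩ := exists_linearIndependent ℝ (a '' s)
  rw [h] at htspan
  have hb := Module.Basis.mk hli (by simp [htspan])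
  have : Fintype t := FiniteDimensional.fintypeBasisIndex hb
  have hcard : Fintype.card t = n := by
    rw [← Module.finrank_eq_card_basis hb, Module.finrank_fin_fun]
  obtain ⟨e⟩ : Nonempty (Fin n ≃ t) := ⟨(Fintype.equivFinOfCardEq hcard).symm⟩
  choose f hf hfa using fun i => hts (e i).2
  refine ⟨f, hf, ?_⟩
  rw [← isUnit_iff_ne_zero, ← Matrix.isUnit_iff_isUnit_det, ← Matrix.linearIndependent_rows_iff_isUnit]
  have : (Matrix.of fun i => a (f i)).row = fun i => ((e i : t) : Fin n → ℝ) := by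
    ext i j
    simp [Matrix.row, hfa]
  rw [this]
  exact hli.comp e e.injective

/-- Cramer's rule for integer matrices, with bounds. -/
theorem cramer_integrality {A : Matrix (Fin n) (Fin n) ℤ} {U : ℕ} (hU : 1 ≤ U)
    (hA : ∀ i j, |A i j| ≤ U) (hdet : A.det ≠ 0) {b y : Fin n → ℝ}
    (hy : A.map (fun k : ℤ => (k : ℝ)) *ᵥ y = b) {q₀ : ℕ} (hb : ∀ i, ∃ k : ℤ, q₀ * b i = k)
    {β : ℝ} (hβ0 : 0 < β) (hβ : ∀ i, |b i| ≤ β) :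
    ∃ q : ℕ, 1 ≤ q ∧ q ≤ n.factorial * U ^ n ∧ (∀ j, ∃ k : ℤ, q₀ * q * y j = k) ∧
      ∀ j, |y j| ≤ n.factorial * U ^ n * β := by
  set A' : Matrix (Fin n) (Fin n) ℝ := A.map (fun k : ℤ => (k : ℝ)) with hA'
  have hdet' : A'.det = A.det := by
    rw [hA']
    exact (Int.cast_det A).symm
  have hcr : ∀ j, A'.cramer b j = A.det * y j := by
    intro j
    rw [← hy, cramer_eq_adjugate_mulVec, mulVec_mulVec, adjugate_mul, smul_mulVec, one_mulVec,
      Pi.smul_apply, smul_eq_mul, hdet']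
  have hdle : |A.det| ≤ n.factorial * U ^ n := by
    have := det_le (A := A) (abv := AbsoluteValue.abs) (x := (U : ℤ)) hA
    simpa using this
  have habs : (1 : ℤ) ≤ |A.det| := Int.one_le_abs hdet
  have hnat : ((A.det.natAbs : ℕ) : ℤ) = |A.det| := Int.natCast_natAbs _
  refine ⟨A.det.natAbs, by omega, ?_, fun j => ?_, fun j => ?_⟩
  · rw [← hnat] at hdle
    exact_mod_cast hdle
  · choose k hk using hb
    have h1 : (A.cramer k j : ℝ) = q₀ * (A.det * y j) := by
      rw [← hcr, ← smul_eq_mul, ← Pi.smul_apply, ← map_smul]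
      have : ((q₀ : ℝ) • b) = fun i => ((k i : ℤ) : ℝ) := by
        ext i
        rw [Pi.smul_apply, smul_eq_mul, hk]
      rw [this, cramer_apply, cramer_apply, Int.cast_det]
      congr 1
      ext i j'
      by_cases h : j' = j
      · subst h
        simp
      · simp [hA', updateCol_ne h]
    have h2 : ((A.det.natAbs : ℕ) : ℝ) = |(A.det : ℝ)| := by
      rw [Nat.cast_natAbs, Int.cast_abs]
    rw [h2]
    rcases abs_choice (A.det : ℝ) with h | h
    · exact ⟨A.cramer k j, by rw [h, h1]; ring⟩
    · exact ⟨-A.cramer k j, by rw [h, Int.cast_neg, h1]; ring⟩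
  · have h1 : |A.det * y j| ≤ n.factorial * U ^ n * β := by
      rw [← hcr]
      -- After scaling by β the replaced column has entries at most 1 ≤ U, so the Leibniz bound
      -- applies to the determinant in Cramer's rule.
      have hbb : b = β • fun i => b i / β := by
        ext i
        rw [Pi.smul_apply, smul_eq_mul, mul_div_cancel₀ _ hβ0.ne']
      rw [hbb, map_smul, Pi.smul_apply, smul_eq_mul, abs_mul, abs_of_pos hβ0, mul_comm]
      apply mul_le_mul_of_nonneg_right _ hβ0.le
      rw [cramer_apply]
      have h2 := det_le (A := A'.updateCol j fun i => b i / β) (abv := AbsoluteValue.abs)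
        (x := (U : ℝ)) fun i j' => by
          by_cases h : j' = j
          · subst h
            rw [updateCol_self, AbsoluteValue.abs_apply, abs_div, abs_of_pos hβ0]
            have : |b i| / β ≤ 1 := (div_le_one hβ0).2 (hβ i)
            exact this.trans (by exact_mod_cast hU)
          · rw [updateCol_ne h, AbsoluteValue.abs_apply, hA', map_apply]
            exact_mod_cast hA i j'
      simpa using h2
    have h2 : (1 : ℝ) ≤ |(A.det : ℝ)| := by exact_mod_cast habs
    rw [abs_mul] at h1
    nlinarith [abs_nonneg (y j)]

/-- The row of integers `a` as a real vector. -/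
def realRow (a : Fin n → ℤ) : Fin n → ℝ := fun j => (a j : ℝ)

/-- A linear objective that is bounded below on a polyhedron given by integer rows is improved by
a point with small numerators and denominators. -/
theorem exists_basic_le [Finite ι] {a : ι → Fin n → ℤ} {b : ι → ℝ} {U : ℕ} (hU : 1 ≤ U)
    (ha : ∀ r j, |a r j| ≤ U) {q₀ : ℕ} (hb : ∀ r, ∃ k : ℤ, q₀ * b r = k)
    {β : ℝ} (hβ0 : 0 < β) (hβ : ∀ r, |b r| ≤ β) {c x : Fin n → ℝ} {m : ℝ}
    (hx : ∀ r, realRow (a r) ⬝ᵥ x ≤ b r)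
    (hm : ∀ y, (∀ r, realRow (a r) ⬝ᵥ y ≤ b r) → m ≤ c ⬝ᵥ y) :
    ∃ y, (∀ r, realRow (a r) ⬝ᵥ y ≤ b r) ∧ c ⬝ᵥ y ≤ c ⬝ᵥ x ∧
      ∃ q : ℕ, 1 ≤ q ∧ q ≤ n.factorial * U ^ n ∧ (∀ j, ∃ k : ℤ, q₀ * q * y j = k) ∧
        ∀ j, |y j| ≤ n.factorial * U ^ n * β := by
  -- The polyhedron may contain lines. Restricting it to a closed orthant containing x excludes
  -- them, keeps x, and adds only integer rows with entries 0 and ±1.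
  set σ : Fin n → ℤ := fun j => if 0 ≤ x j then -1 else 1 with hσ
  set a' : ι ⊕ Fin n → Fin n → ℤ := Sum.elim a fun j => Pi.single j (σ j) with ha'
  set b' : ι ⊕ Fin n → ℝ := Sum.elim b fun _ => 0 with hb'
  have hσabs : ∀ j, |σ j| = 1 := fun j => by
    simp only [hσ]
    split_ifs <;> simp
  have hσ0 : ∀ j, (σ j : ℝ) ≠ 0 := fun j h => by
    have h1 := hσabs j
    rw [Int.cast_eq_zero.1 h] at h1
    simp at h1
  have hrow : ∀ j, realRow (Pi.single j (σ j)) = (σ j : ℝ) • (Pi.single j 1 : Fin n → ℝ) := by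
    intro j
    ext k
    by_cases h : k = j
    · subst h
      simp [realRow]
    · simp [realRow, h]
  have hspan : Submodule.span ℝ (range fun r => realRow (a' r)) = ⊤ := by
    rw [eq_top_iff]
    intro w _
    rw [← Finset.univ_sum_single w]
    refine Submodule.sum_mem _ fun j _ => ?_
    have h1 : (Pi.single j (w j) : Fin n → ℝ) = (w j / σ j) • realRow (a' (Sum.inr j)) := by
      rw [ha', Sum.elim_inr, hrow, smul_smul, div_mul_cancel₀ _ (hσ0 j), ← Pi.single_smul]
      simp
    rw [h1]
    exact Submodule.smul_mem _ _ (Submodule.subset_span ⟨_, rfl⟩)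
  have hx' : ∀ r, realRow (a' r) ⬝ᵥ x ≤ b' r := by
    rintro (r | j)
    · exact hx r
    · show realRow (Pi.single j (σ j)) ⬝ᵥ x ≤ 0
      rw [hrow, smul_dotProduct, single_dotProduct, one_mul, smul_eq_mul]
      simp only [hσ]
      split_ifs with h
      · push_cast
        linarith
      · push_cast
        linarith
  obtain ⟨y, hy, hcy, hW⟩ := exists_vertex_le (a := fun r => realRow (a' r)) hspan hx'
    (fun y hy => hm y fun r => hy (Sum.inl r))
  obtain ⟨f, hf, hdet⟩ := exists_det_ne_zero_of_span_eq_top hW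
  refine ⟨y, fun r => hy (Sum.inl r), hcy, ?_⟩
  have hmap : (Matrix.of fun i => realRow (a' (f i))) =
      (Matrix.of fun i => a' (f i)).map (fun k : ℤ => (k : ℝ)) := rfl
  refine cramer_integrality (A := Matrix.of fun i => a' (f i)) hU (fun i j => ?_) ?_
    (b := fun i => b' (f i)) ?_ (fun i => ?_) hβ0 (fun i => ?_)
  · rw [of_apply]
    rcases f i with r | k
    · exact ha r j
    · simp only [ha', Sum.elim_inr]
      by_cases h : j = k
      · subst h
        rw [Pi.single_eq_same, hσabs]
        exact_mod_cast hU
      · rw [Pi.single_eq_of_ne h]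
        simp
  · intro h0
    apply hdet
    rw [hmap]
    have := Int.cast_det (R := ℝ) (Matrix.of fun i => a' (f i))
    rw [h0, Int.cast_zero] at this
    exact this.symm
  · rw [← hmap]
    ext i
    exact hf i
  · rcases f i with r | k
    · exact hb r
    · exact ⟨0, by simp [hb']⟩
  · rcases f i with r | k
    · exact hβ r
    · simpa [hb'] using hβ0.le

end Polyhedra

end

/-! ### Integer programs: exactness from approximate feasibility -/

section

open Set Matrix

namespace DistOpt

variable {d : ℕ}

theorem inner_intVec (a : Fin d → ℤ) (x : Vec d) :
    inner ℝ (intVec a) x = realRow a ⬝ᵥ x.ofLp := by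
  rw [PiLp.inner_apply, dotProduct]
  refine Finset.sum_congr rfl fun j _ => ?_
  simp [intVec, realRow, mul_comm]

/-- A set of integer rows `(a, b)`, standing for the constraints `⟨a, x⟩ ≤ b`, with all
coefficients bounded by `U`. -/
def BoundedRows (U : ℕ) (S : Set ((Fin d → ℤ) × ℤ)) : Prop :=
  ∀ p ∈ S, (∀ j, |p.1 j| ≤ U) ∧ |p.2| ≤ U

/-- The polyhedron given by a set of integer rows. -/
def rowPolyhedron (S : Set ((Fin d → ℤ) × ℤ)) : Set (Vec d) :=
  {x | ∀ p ∈ S, inner ℝ (intVec p.1) x ≤ (p.2 : ℝ)}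

variable {U : ℕ} {S : Set ((Fin d → ℤ) × ℤ)} {c : Fin d → ℤ}

theorem BoundedRows.finite (hS : BoundedRows U S) : Finite S := by
  refine (((Set.finite_Icc (fun _ : Fin d => -(U : ℤ)) fun _ => (U : ℤ)).prod
    (Set.finite_Icc (-(U : ℤ)) U)).subset fun p hp => ?_).to_subtype
  obtain ⟨h1, h2⟩ := hS p hp
  exact ⟨⟨fun j => (abs_le.1 (h1 j)).1, fun j => (abs_le.1 (h1 j)).2⟩, abs_le.1 h2⟩

theorem realRow_cons_dotProduct (t : ℤ) (a : Fin d → ℤ) (y : Fin (d + 1) → ℝ) :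
    realRow (Fin.cons t a : Fin (d + 1) → ℤ) ⬝ᵥ y =
      t * y 0 + realRow a ⬝ᵥ fun j => y j.succ := by
  simp [dotProduct, Fin.sum_univ_succ, realRow]

/-- A polyhedron given by bounded integer rows has a point of objective value at most `v`, if there
is such a point that satisfies the rows up to a sufficiently small error. -/
theorem BoundedRows.exists_mem_of_approx (hS : BoundedRows U S) (hU : 1 ≤ U)
    (hc : ∀ j, |c j| ≤ U) {v η : ℝ} {q₀ : ℕ} (hv : ∃ k : ℤ, q₀ * v = k) (hq₀ : 1 ≤ q₀)
    (hη0 : 0 ≤ η) (hη : η * (q₀ * ((d + 1).factorial * U ^ (d + 1))) < 1) {z : Vec d}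
    (hz : ∀ p ∈ S, inner ℝ (intVec p.1) z ≤ (p.2 : ℝ) + η) (hcz : inner ℝ (intVec c) z ≤ v) :
    ∃ y ∈ rowPolyhedron S, inner ℝ (intVec c) y ≤ v := by
  have := hS.finite
  -- A slack variable t is added as coordinate 0, with rows t ≥ 0, ⟨c, y⟩ ≤ v and ⟨a, y⟩ - t ≤ b.
  -- Minimising t from the feasible point (η, z) gives a basic solution.
  set a : Option (Option S) → Fin (d + 1) → ℤ := fun r =>
    r.elim (Fin.cons (-1) fun _ => 0) fun r => r.elim (Fin.cons 0 c) fun p => Fin.cons (-1) p.1.1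
    with ha
  set b : Option (Option S) → ℝ := fun r => r.elim 0 fun r => r.elim v fun p => p.1.2 with hb
  have hone : |(-1 : ℤ)| ≤ U := by
    rw [abs_neg, abs_one]
    exact_mod_cast hU
  have haU : ∀ r j, |a r j| ≤ U := by
    rintro (_ | _ | p) j
    · refine Fin.cases ?_ (fun j => ?_) j
      · exact hone
      · simp [ha]
    · refine Fin.cases ?_ (fun j => ?_) j
      · simp [ha]
      · exact hc j
    · refine Fin.cases ?_ (fun j => ?_) j
      · exact hone
      · exact (hS p.1 p.2).1 j
  have hbq : ∀ r, ∃ k : ℤ, q₀ * b r = k := by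
    rintro (_ | _ | p)
    · exact ⟨0, by simp [hb]⟩
    · exact hv
    · exact ⟨q₀ * p.1.2, by simp [hb]⟩
  have hbβ : ∀ r, |b r| ≤ |v| + U := by
    have hU0 : (0 : ℝ) ≤ U := Nat.cast_nonneg U
    rintro (_ | _ | p)
    · simp only [hb, Option.elim_none, abs_zero]
      positivity
    · exact le_add_of_nonneg_right hU0
    · have h1 : |(p.1.2 : ℝ)| ≤ U := by exact_mod_cast (hS p.1 p.2).2
      exact h1.trans (le_add_of_nonneg_left (abs_nonneg v))
  have hU1 : (1 : ℝ) ≤ U := by exact_mod_cast hU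
  have hzero : realRow (fun _ => 0 : Fin d → ℤ) = 0 := by
    ext j
    simp [realRow]
  obtain ⟨y, hy, hcy, q, hq1, hq, hqy, -⟩ := exists_basic_le hU haU hbq
    (by positivity : 0 < |v| + (U : ℝ)) hbβ (c := Pi.single 0 1)
    (x := Fin.cons η z.ofLp) (m := 0) (by
      rintro (_ | _ | p)
      · simp only [ha, hb, Option.elim_none, realRow_cons_dotProduct, hzero]
        simpa using hη0
      · simp only [ha, hb, Option.elim_none, Option.elim_some, realRow_cons_dotProduct]
        simpa [inner_intVec] using hcz
      · have := hz p.1 p.2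
        rw [inner_intVec] at this
        simp only [ha, hb, Option.elim_some, realRow_cons_dotProduct]
        simp
        linarith) (fun y hy => by
      have := hy none
      simp only [ha, hb, Option.elim_none, realRow_cons_dotProduct, hzero] at this
      simpa using this)
  rw [single_dotProduct, single_dotProduct, one_mul, one_mul, Fin.cons_zero] at hcy
  have hy0 : 0 ≤ y 0 := by
    have := hy none
    simp only [ha, hb, Option.elim_none, realRow_cons_dotProduct, hzero] at this
    simpa using this
  -- The slack is a multiple of 1/(q₀q), nonnegative and at most η < 1/(q₀q).
  have hy00 : y 0 = 0 := by
    obtain ⟨k, hk⟩ := hqy 0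
    have hqpos : (0 : ℝ) < q₀ * q := by
      have h1 : (1 : ℝ) ≤ q₀ := by exact_mod_cast hq₀
      have h2 : (1 : ℝ) ≤ q := by exact_mod_cast hq1
      positivity
    have hq' : (q : ℝ) ≤ (d + 1).factorial * U ^ (d + 1) := by exact_mod_cast hq
    have h1 : (k : ℝ) < 1 := by
      rw [← hk]
      calc q₀ * q * y 0 ≤ q₀ * ((d + 1).factorial * U ^ (d + 1)) * η := by gcongr
        _ < 1 := by linarith
    have h2 : (0 : ℝ) ≤ k := by
      rw [← hk]
      positivity
    have h3 : k = 0 := by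
      have h4 : k < 1 := by exact_mod_cast h1
      have h5 : 0 ≤ k := by exact_mod_cast h2
      omega
    rw [h3, Int.cast_zero] at hk
    exact (mul_eq_zero.1 hk).resolve_left hqpos.ne'
  refine ⟨WithLp.toLp 2 fun j => y j.succ, fun p hp => ?_, ?_⟩
  · have := hy (some (some ⟨p, hp⟩))
    simp only [ha, hb, Option.elim_some, realRow_cons_dotProduct, hy00] at this
    rw [inner_intVec]
    simpa using this
  · have := hy (some none)
    simp only [ha, hb, Option.elim_some, Option.elim_none, realRow_cons_dotProduct, hy00] at this
    rw [inner_intVec]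
    simpa using this

theorem BoundedRows.exists_basic_le (hS : BoundedRows U S) (hU : 1 ≤ U) {x : Vec d} {m : ℝ}
    (hx : x ∈ rowPolyhedron S) (hm : ∀ y ∈ rowPolyhedron S, m ≤ inner ℝ (intVec c) y) :
    ∃ y ∈ rowPolyhedron S, inner ℝ (intVec c) y ≤ inner ℝ (intVec c) x ∧
      ∃ q : ℕ, 1 ≤ q ∧ q ≤ d.factorial * U ^ d ∧ (∀ j, ∃ k : ℤ, q * y j = k) ∧
        ∀ j, |y j| ≤ d.factorial * U ^ d * U := by
  have := hS.finite
  have hU1 : (1 : ℝ) ≤ U := by exact_mod_cast hU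
  obtain ⟨y, hy, hcy, q, hq1, hq, hqy, hyb⟩ := _root_.exists_basic_le (a := fun p : S => p.1.1)
    (b := fun p : S => p.1.2) hU (fun p => (hS p.1 p.2).1) (q₀ := 1)
    (fun p => ⟨p.1.2, by simp⟩) (by linarith : (0 : ℝ) < U)
    (fun p => by exact_mod_cast (hS p.1 p.2).2) (c := realRow c) (x := x.ofLp) (m := m)
    (fun p => by
      rw [← inner_intVec]
      exact hx p.1 p.2) (fun y hy => by
      have := hm (WithLp.toLp 2 y) fun p hp => by
        rw [inner_intVec]
        exact hy ⟨p, hp⟩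
      rwa [inner_intVec] at this)
  refine ⟨WithLp.toLp 2 y, fun p hp => ?_, ?_, q, hq1, hq, fun j => ?_, hyb⟩
  · rw [inner_intVec]
    exact hy ⟨p, hp⟩
  · rwa [inner_intVec, inner_intVec]
  · simpa using hqy j

/-- A linear program with bounded integer data that is feasible and bounded has an optimal solution
with small numerators and denominators. -/
theorem BoundedRows.exists_minimizer (hS : BoundedRows U S) (hU : 1 ≤ U) {m : ℝ}
    (hne : (rowPolyhedron S).Nonempty) (hm : ∀ y ∈ rowPolyhedron S, m ≤ inner ℝ (intVec c) y) :
    ∃ y ∈ rowPolyhedron S, (∀ x ∈ rowPolyhedron S, inner ℝ (intVec c) y ≤ inner ℝ (intVec c) x) ∧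
      (∃ q : ℕ, 1 ≤ q ∧ q ≤ d.factorial * U ^ d ∧ ∃ k : ℤ, q * inner ℝ (intVec c) y = k) ∧
        ∀ j, |y j| ≤ d.factorial * U ^ d * U := by
  set Δ := d.factorial * U ^ d with hΔ
  -- Each feasible point is matched or beaten by one in `G`, where values are multiples of 1/Δ!,
  -- since denominators q ≤ Δ divide Δ!. Being bounded below, they have a least element.
  set G : Set (Vec d) := {y | y ∈ rowPolyhedron S ∧
    (∃ q : ℕ, 1 ≤ q ∧ q ≤ Δ ∧ ∀ j, ∃ k : ℤ, q * y j = k) ∧ ∀ j, |y j| ≤ d.factorial * U ^ d * U}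
    with hG
  have hval : ∀ y : Vec d, ∀ q : ℕ, (∀ j, ∃ k : ℤ, q * y j = k) →
      ∃ k : ℤ, q * inner ℝ (intVec c) y = k := by
    intro y q hq
    choose k hk using hq
    refine ⟨∑ j, c j * k j, ?_⟩
    rw [inner_intVec, dotProduct, Finset.mul_sum]
    push_cast
    refine Finset.sum_congr rfl fun j _ => ?_
    rw [← hk, realRow]
    ring
  have hGF : ∀ x ∈ rowPolyhedron S, ∃ y ∈ G, inner ℝ (intVec c) y ≤ inner ℝ (intVec c) x := by
    intro x hx
    obtain ⟨y, hy, hcy, q, hq1, hq, hqy, hyb⟩ := hS.exists_basic_le hU hx hm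
    exact ⟨y, ⟨hy, ⟨q, hq1, hq, hqy⟩, hyb⟩, hcy⟩
  have hfac : (0 : ℝ) < Δ.factorial := by exact_mod_cast Nat.factorial_pos Δ
  have hint : ∀ y ∈ G, ∃ k : ℤ, Δ.factorial * inner ℝ (intVec c) y = k := by
    rintro y ⟨-, ⟨q, hq1, hq, hqy⟩, -⟩
    obtain ⟨k, hk⟩ := hval y q hqy
    obtain ⟨t, ht⟩ := Nat.dvd_factorial hq1 hq
    refine ⟨t * k, ?_⟩
    rw [ht]
    push_cast
    rw [← hk]
    ring
  obtain ⟨x₀, hx₀⟩ := hne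
  obtain ⟨y₀, hy₀, -⟩ := hGF x₀ hx₀
  obtain ⟨k₀, hk₀⟩ := hint y₀ hy₀
  obtain ⟨k, ⟨y, hyG, hky⟩, hkmin⟩ := Int.exists_least_of_bdd
    (P := fun k => ∃ y ∈ G, Δ.factorial * inner ℝ (intVec c) y = (k : ℝ))
    ⟨⌊(Δ.factorial : ℝ) * m⌋, fun k ⟨y, hy, hk⟩ => by
      have h1 := mul_le_mul_of_nonneg_left (hm y hy.1) hfac.le
      rw [hk] at h1
      have h2 : (⌊(Δ.factorial : ℝ) * m⌋ : ℝ) ≤ k := (Int.floor_le _).trans h1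
      exact_mod_cast h2⟩ ⟨k₀, y₀, hy₀, hk₀⟩
  have hyG' := hyG
  obtain ⟨hyF, ⟨q, hq1, hq, hqy⟩, hyb⟩ := hyG'
  refine ⟨y, hyF, fun x hx => ?_, ⟨q, hq1, hq, hval y q hqy⟩, hyb⟩
  obtain ⟨y', hy', hcy'⟩ := hGF x hx
  refine le_trans ?_ hcy'
  obtain ⟨k', hk'⟩ := hint y' hy'
  have h1 := hkmin k' ⟨y', hy', hk'⟩
  have h2 : (k : ℝ) ≤ k' := by exact_mod_cast h1
  rw [← hky, ← hk'] at h2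
  exact le_of_mul_le_mul_left h2 hfac

/-- If a polyhedron given by bounded integer rows has a point of objective value at most `v`,
then it has a bounded one. -/
theorem BoundedRows.exists_bounded_mem (hS : BoundedRows U S) (hU : 1 ≤ U)
    (hc : ∀ j, |c j| ≤ U) {v β : ℝ} (hβU : U ≤ β) (hβv : |v| ≤ β) {x : Vec d}
    (hx : x ∈ rowPolyhedron S) (hxv : inner ℝ (intVec c) x ≤ v) :
    ∃ y ∈ rowPolyhedron S, inner ℝ (intVec c) y ≤ v ∧ ∀ j, |y j| ≤ d.factorial * U ^ d * β := by
  have := hS.finite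
  have hU1 : (1 : ℝ) ≤ U := by exact_mod_cast hU
  -- The level bound becomes a row. Its right-hand side v may be any real: q₀ = 0 makes the
  -- denominator condition void, and only the size bound is used.
  obtain ⟨y, hy, -, -, -, -, -, hyb⟩ := _root_.exists_basic_le
    (a := fun r : Option S => r.elim c fun p => p.1.1)
    (b := fun r : Option S => r.elim v fun p => p.1.2) hU
    (by
      rintro (_ | p)
      · exact hc
      · exact (hS p.1 p.2).1) (q₀ := 0)
    (fun r => ⟨0, by simp⟩) (by linarith : (0 : ℝ) < β)
    (by
      rintro (_ | p)
      · exact hβv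
      · have h1 : |(p.1.2 : ℝ)| ≤ U := by exact_mod_cast (hS p.1 p.2).2
        exact h1.trans hβU) (c := 0) (x := x.ofLp) (m := 0)
    (by
      rintro (_ | p)
      · simpa [inner_intVec] using hxv
      · have := hx p.1 p.2
        rwa [inner_intVec] at this) (fun y _ => by simp)
  refine ⟨WithLp.toLp 2 y, fun p hp => ?_, ?_, hyb⟩
  · rw [inner_intVec]
    exact hy (some ⟨p, hp⟩)
  · rw [inner_intVec]
    exact hy none

end DistOpt

end

/-! ### Linear programming -/

section

open Set

namespace DistOpt

variable {d s : ℕ}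

/-- The rows of all servers. -/
def programRows (M : Fin s → ConstraintBlock d) : Set ((Fin d → ℤ) × ℤ) :=
  {p | ∃ i r, p = ((M i).A r, (M i).b r)}

theorem feasibleRegion_eq (M : Fin s → ConstraintBlock d) :
    feasibleRegion M = rowPolyhedron (programRows M) := by
  ext x
  constructor
  · rintro hx _ ⟨i, r, rfl⟩
    exact hx i r
  · exact fun hx i r => hx _ ⟨i, r, rfl⟩

/-- All bounded integer rows that a point satisfies up to an error of `η`. -/
def approxRows (U : ℕ) (η : ℝ) (z : Vec d) : Set ((Fin d → ℤ) × ℤ) :=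
  {p | ((∀ j, |p.1 j| ≤ U) ∧ |p.2| ≤ U) ∧ inner ℝ (intVec p.1) z ≤ (p.2 : ℝ) + η}

theorem boundedRows_approxRows (U : ℕ) (η : ℝ) (z : Vec d) : BoundedRows U (approxRows U η z) :=
  fun _ hp => hp.1

theorem rowPolyhedron_anti {S S' : Set ((Fin d → ℤ) × ℤ)} (h : S ⊆ S') :
    rowPolyhedron S' ⊆ rowPolyhedron S := fun _ hx p hp => hx p (h hp)

open Classical in
/-- The final computation for linear programs: the program given by all bounded integer rows that
the point satisfies up to an error of `η` is solved exactly. -/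
noncomputable def roundToOptimum (U : ℕ) (η : ℝ) (c : Fin d → ℤ) : Option (Vec d) → LPAnswer d
  | none => .infeasible
  | some z =>
      if h : ∃ x ∈ rowPolyhedron (approxRows U η z), ∀ x' ∈ rowPolyhedron (approxRows U η z),
          inner ℝ (intVec c) x ≤ inner ℝ (intVec c) x' then .optimal h.choose
      else .unbounded

/-- A bound on the numerators and denominators of basic solutions. -/
def basicBound (d L : ℕ) : ℕ := ((d + 1) * 2 ^ L) ^ (d + 1)

theorem mul_le_basicBound (d L : ℕ) : (d + 1) * 2 ^ L ≤ basicBound d L :=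
  Nat.le_self_pow (by omega) _

theorem factorial_succ_mul_le_basicBound (d L : ℕ) :
    (d + 1).factorial * (2 ^ L) ^ (d + 1) ≤ basicBound d L := by
  rw [basicBound, mul_pow]
  exact Nat.mul_le_mul_right _ (Nat.factorial_le_pow _)

theorem factorial_mul_mul_le_basicBound (d L : ℕ) :
    d.factorial * (2 ^ L) ^ d * 2 ^ L ≤ basicBound d L := by
  refine le_trans ?_ (factorial_succ_mul_le_basicBound d L)
  rw [mul_assoc, ← pow_succ]
  exact Nat.mul_le_mul_right _ (Nat.factorial_le (Nat.le_succ d))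

theorem factorial_mul_le_basicBound (d L : ℕ) :
    d.factorial * (2 ^ L) ^ d ≤ basicBound d L :=
  (Nat.le_mul_of_pos_right _ (by positivity)).trans (factorial_mul_mul_le_basicBound d L)

theorem log_basicBound_le {L : ℕ} (hd : 2 ≤ d) (hL : 1 ≤ L) :
    Real.log (basicBound d L) ≤ 5 * d * L * Real.log d := by
  have hd' : (2 : ℝ) ≤ d := by exact_mod_cast hd
  have hL' : (1 : ℝ) ≤ L := by exact_mod_cast hL
  have h1 : Real.log (basicBound d L) = (d + 1) * (Real.log (d + 1) + L * Real.log 2) := by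
    rw [basicBound]
    push_cast
    rw [Real.log_pow, Real.log_mul (by positivity) (by positivity), Real.log_pow]
    push_cast
    ring
  have h2 : Real.log (d + 1) ≤ 2 * Real.log d := by
    rw [show (2 : ℝ) = ((2 : ℕ) : ℝ) by norm_num, ← Real.log_pow]
    exact Real.log_le_log (by positivity) (by nlinarith)
  have h3 : Real.log 2 ≤ Real.log d := Real.log_le_log (by norm_num) hd'
  have h4 := Real.log_two_gt_d9
  have h5 : 0 ≤ Real.log d := by linarith
  rw [h1]
  calc ((d : ℝ) + 1) * (Real.log (d + 1) + L * Real.log 2)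
      ≤ (3 / 2 * d) * (2 * (L * Real.log d) + L * Real.log d) := by
        have h6 : 0 ≤ Real.log ((d : ℝ) + 1) := Real.log_nonneg (by linarith)
        have h7 : Real.log (d + 1) ≤ 2 * (L * Real.log d) := by nlinarith
        gcongr
        linarith
    _ ≤ 5 * d * L * Real.log d := by
        have : 0 ≤ (d : ℝ) * L * Real.log d := by positivity
        nlinarith

theorem norm_intVec_le {U : ℕ} {a : Fin d → ℤ} (ha : ∀ j, |a j| ≤ U) : ‖intVec a‖ ≤ d * U :=
  norm_le_of_forall_abs_le (Nat.cast_nonneg U) fun j => by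
    simp only [intVec]
    exact_mod_cast ha j

section LinearProgram

variable {L : ℕ} {c : Fin d → ℤ}

/-- The tolerance of the row tests. -/
noncomputable def rowTolerance (d L : ℕ) : ℝ := 1 / (basicBound d L : ℝ) ^ 3

/-- The parameters of the protocol for linear programs. -/
noncomputable def lpParams (d L : ℕ) : CogParams :=
  fineParams d ((basicBound d L : ℝ) ^ 6) (rowTolerance d L / basicBound d L / 2)

theorem two_le_basicBound (hd : 2 ≤ d) (L : ℕ) : (2 : ℝ) ≤ basicBound d L := by
  have h1 := mul_le_basicBound d L
  have h2 : 2 * 1 ≤ (d + 1) * 2 ^ L := Nat.mul_le_mul (by omega) Nat.one_le_two_pow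
  exact_mod_cast h2.trans h1

theorem rowTolerance_pos (hd : 2 ≤ d) (L : ℕ) : 0 < rowTolerance d L := by
  have := two_le_basicBound hd L
  rw [rowTolerance]
  positivity

/-- Both the denominator of the level and the determinant bound are at most Z = `basicBound d L`;
the third power in the tolerance leaves a factor 1/Z. -/
theorem rowTolerance_mul_lt (hd : 2 ≤ d) (L : ℕ) {q₀ : ℕ} (hq₀ : q₀ ≤ basicBound d L) :
    rowTolerance d L * (q₀ * ((d + 1).factorial * ((2 ^ L : ℕ) : ℝ) ^ (d + 1))) < 1 := by
  have hZ := two_le_basicBound hd L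
  have h1 : ((d + 1).factorial * ((2 ^ L : ℕ) : ℝ) ^ (d + 1)) ≤ (basicBound d L : ℝ) := by
    exact_mod_cast factorial_succ_mul_le_basicBound d L
  have h2 : (q₀ : ℝ) ≤ basicBound d L := by exact_mod_cast hq₀
  set Z : ℝ := (basicBound d L : ℝ)
  calc rowTolerance d L * (q₀ * ((d + 1).factorial * ((2 ^ L : ℕ) : ℝ) ^ (d + 1)))
      ≤ rowTolerance d L * (Z * Z) := by
        have := (rowTolerance_pos hd L).le
        gcongr
    _ = 1 / Z := by
        change 1 / Z ^ 3 * (Z * Z) = 1 / Z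
        field_simp
    _ < 1 := by
        rw [div_lt_one (by linarith)]
        linarith

variable {test : Fin s → ConstraintBlock d → Vec d → Option (Vec d)} {M : Fin s → ConstraintBlock d}

/-- Acceptance means that every row passes the tolerance test. The coordinator can thus work with a
superset of the rows without learning any of them. -/
theorem programRows_subset_approxRows {η : ℝ} (htest : ∀ i, IsRowRule η (test i))
    (hM : ∀ i, (M i).BoundedBy L) {z : Vec d} (hz : ∀ i, test i (M i) z = none) :
    programRows M ⊆ approxRows (2 ^ L) η z := by
  rintro _ ⟨i, r, rfl⟩
  refine ⟨⟨fun j => ?_, ?_⟩, ((htest i (M i) z).1.1 (hz i)) r⟩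
  · push_cast
    exact (hM i).1 r j
  · push_cast
    exact (hM i).2 r

theorem boundedRows_programRows (hM : ∀ i, (M i).BoundedBy L) :
    BoundedRows (2 ^ L) (programRows M) := by
  rintro _ ⟨i, r, rfl⟩
  refine ⟨fun j => ?_, ?_⟩
  · push_cast
    exact (hM i).1 r j
  · push_cast
    exact (hM i).2 r

/-- If the program has a point of value at most `v`, then so has the program given by the rows that
the best accepted centroid satisfies approximately. -/
theorem exists_best_of_level (hd : 2 ≤ d) (hc : ∀ j, |c j| ≤ 2 ^ L)
    (htest : ∀ i, IsRowRule (rowTolerance d L) (test i)) (hM : ∀ i, (M i).BoundedBy L) {v : ℝ}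
    {q₀ : ℕ} (hq1 : 1 ≤ q₀) (hq₀ : q₀ ≤ basicBound d L) (hv : ∃ k : ℤ, q₀ * v = k)
    (hvZ : |v| ≤ (basicBound d L : ℝ) ^ 3) {x : Vec d} (hx : x ∈ rowPolyhedron (programRows M))
    (hxv : inner ℝ (intVec c) x ≤ v) :
    ∃ z, best (lpParams d L) (intVec c) (outcomes (lpParams d L) (intVec c)
        (fun i => test i (M i)) (lpParams d L).rounds) = some z ∧
      ∃ y ∈ rowPolyhedron (approxRows (2 ^ L) (rowTolerance d L) z),
        inner ℝ (intVec c) y ≤ v := by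
  have hZ2 := two_le_basicBound hd L
  have hη := rowTolerance_pos hd L
  have hU : 1 ≤ 2 ^ L := Nat.one_le_two_pow
  have hdU : (d : ℝ) * (2 ^ L : ℕ) ≤ basicBound d L := by
    have := (Nat.mul_le_mul_right (2 ^ L) (Nat.le_succ d)).trans (mul_le_basicBound d L)
    exact_mod_cast this
  have hd1 : (1 : ℝ) ≤ d := by
    have : (2 : ℝ) ≤ d := by exact_mod_cast hd
    linarith
  have hU1 : (1 : ℝ) ≤ (2 ^ L : ℕ) := by exact_mod_cast hU
  have hUZ : ((2 ^ L : ℕ) : ℝ) ≤ basicBound d L := by nlinarith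
  have hdZ : (d : ℝ) ≤ basicBound d L := by nlinarith
  have hfac : (d.factorial * ((2 ^ L : ℕ) : ℝ) ^ d) ≤ (basicBound d L : ℝ) := by
    exact_mod_cast factorial_mul_le_basicBound d L
  have hc' : ∀ j, |c j| ≤ (2 ^ L : ℕ) := fun j => by
    push_cast
    exact hc j
  have hprm : (lpParams d L).IsFine d := fineParams_isFine (by omega) _ _
  have hHalf : (lpParams d L).halfWidth = (basicBound d L : ℝ) ^ 6 := rfl
  have hrounds := lt_rounds_fineParams d ((basicBound d L : ℝ) ^ 6)
    (rowTolerance d L / basicBound d L / 2)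
  set Z : ℝ := (basicBound d L : ℝ) with hZ
  obtain ⟨x₀, hx₀, hx₀v, hx₀b⟩ := (boundedRows_programRows hM).exists_bounded_mem hU hc'
    (hUZ.trans (le_self_pow₀ (by linarith) (by norm_num))) hvZ hx hxv
  -- Rows have norm at most d · 2^L ≤ Z, so moving by ρ changes a row by at most the tolerance, and
  -- no reported cut excludes the ball.
  set ρ := rowTolerance d L / Z with hρ
  have hρ0 : 0 < ρ := by positivity
  obtain ⟨q, hq, hqv⟩ := exists_closedBall_half (intVec c) x₀ hρ0.le
  have hnorm : ‖x₀‖ ≤ Z ^ 5 := by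
    have h1 := norm_le_of_forall_abs_le (by positivity) hx₀b
    calc ‖x₀‖ ≤ d * (d.factorial * ((2 ^ L : ℕ) : ℝ) ^ d * Z ^ 3) := h1
      _ ≤ Z * (Z * Z ^ 3) := by gcongr
      _ = Z ^ 5 := by ring
  have hρ1 : ρ ≤ 1 := by
    rw [hρ, rowTolerance, div_le_one (by linarith)]
    have : 1 / Z ^ 3 ≤ 1 := by
      rw [div_le_one (by positivity)]
      exact one_le_pow₀ (by linarith)
    linarith
  have hcube : Metric.closedBall q (ρ / 2) ⊆ cube d (lpParams d L).halfWidth := by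
    refine hq.trans (closedBall_subset_cube ?_)
    rw [hHalf]
    have : 1 ≤ Z ^ 5 := one_le_pow₀ (by linarith)
    calc ‖x₀‖ + ρ ≤ Z ^ 5 + Z ^ 5 := by linarith
      _ = 2 * Z ^ 5 := by ring
      _ ≤ Z * Z ^ 5 := by gcongr
      _ = Z ^ 6 := by ring
  obtain ⟨z, hz, hzv⟩ := exists_best_le (c := intVec c) (test := fun i => test i (M i)) (by omega)
    hprm (half_pos hρ0) hcube (by
      intro i z a ha
      obtain ⟨r, rfl, hr⟩ := (htest i (M i) z).2 a ha
      have hle : ∀ y ∈ Metric.closedBall q (ρ / 2),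
          inner ℝ (intVec ((M i).A r)) y < inner ℝ (intVec ((M i).A r)) z := by
        intro y hy
        have h1 := hq hy
        rw [mem_closedBall_iff_norm] at h1
        have h2 : ‖intVec ((M i).A r)‖ ≤ d * (2 ^ L : ℕ) := norm_intVec_le fun j => by
          push_cast
          exact (hM i).1 r j
        have h3 := real_inner_le_norm (intVec ((M i).A r)) (y - x₀)
        have h4 : ‖intVec ((M i).A r)‖ * ‖y - x₀‖ ≤ rowTolerance d L := by
          calc ‖intVec ((M i).A r)‖ * ‖y - x₀‖ ≤ Z * ρ :=
                mul_le_mul (h2.trans hdU) h1 (norm_nonneg _) (by linarith)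
            _ = rowTolerance d L := by
                rw [hρ]
                field_simp
        have h5 : inner ℝ (intVec ((M i).A r)) x₀ ≤ ((M i).b r : ℝ) := hx₀ _ ⟨i, r, rfl⟩
        rw [inner_sub_right] at h3
        linarith
      refine ⟨fun h0 => ?_, fun y hy => (hle y hy).le⟩
      have := hle q (Metric.mem_closedBall_self (by positivity))
      rw [h0] at this
      simp at this) (fun y hy => (hqv y hy).trans hx₀v)
    (by rw [hHalf]; positivity) hrounds
  exact ⟨z, hz, (boundedRows_approxRows (2 ^ L) (rowTolerance d L) z).exists_mem_of_approx hU hc'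
    hv hq1 hη.le (rowTolerance_mul_lt hd L hq₀) (fun p hp => hp.2) hzv⟩

theorem abs_inner_intVec_le {U : ℕ} (hc : ∀ j, |c j| ≤ U) {y : Vec d} {t : ℝ}
    (hy : ∀ j, |y j| ≤ t) : |inner ℝ (intVec c) y| ≤ d * U * t := by
  rw [inner_intVec, dotProduct]
  calc |∑ j, realRow c j * y j| ≤ ∑ j, |realRow c j * y j| := Finset.abs_sum_le_sum_abs _ _
    _ ≤ ∑ _j : Fin d, U * t := Finset.sum_le_sum fun j _ => by
        rw [abs_mul]
        have h1 : |realRow c j| ≤ U := by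
          rw [realRow]
          exact_mod_cast hc j
        exact mul_le_mul h1 (hy j) (abs_nonneg _) (Nat.cast_nonneg _)
    _ = d * U * t := by
        rw [Finset.sum_const, Finset.card_univ, Fintype.card_fin, nsmul_eq_mul]
        ring

/-- The polyhedron of the approximate rows is contained in the feasible region, and by integrality
reaches every level v that has a small denominator and size and is reached there. It remains to
choose v. -/
theorem roundToOptimum_best_isCorrect (hd : 2 ≤ d) (hc : ∀ j, |c j| ≤ 2 ^ L)
    (htest : ∀ i, IsRowRule (rowTolerance d L) (test i)) (hM : ∀ i, (M i).BoundedBy L) :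
    (roundToOptimum (2 ^ L) (rowTolerance d L) c (best (lpParams d L) (intVec c)
      (outcomes (lpParams d L) (intVec c) (fun i => test i (M i))
        (lpParams d L).rounds))).IsCorrect (intVec c) (feasibleRegion M) := by
  have hZ2 := two_le_basicBound hd L
  have hη := rowTolerance_pos hd L
  have hU : 1 ≤ 2 ^ L := Nat.one_le_two_pow
  have hc' : ∀ j, |c j| ≤ (2 ^ L : ℕ) := fun j => by
    push_cast
    exact hc j
  have hdU : (d : ℝ) * (2 ^ L : ℕ) ≤ basicBound d L := by
    have := (Nat.mul_le_mul_right (2 ^ L) (Nat.le_succ d)).trans (mul_le_basicBound d L)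
    exact_mod_cast this
  have hfac : (d.factorial * ((2 ^ L : ℕ) : ℝ) ^ d * (2 ^ L : ℕ)) ≤ (basicBound d L : ℝ) := by
    exact_mod_cast factorial_mul_mul_le_basicBound d L
  have hBM := boundedRows_programRows hM
  rw [feasibleRegion_eq]
  set F := rowPolyhedron (programRows M) with hF
  set o := outcomes (lpParams d L) (intVec c) (fun i => test i (M i)) (lpParams d L).rounds with ho
  have hsub : ∀ z, best (lpParams d L) (intVec c) o = some z →
      programRows M ⊆ approxRows (2 ^ L) (rowTolerance d L) z := fun z hz =>
    programRows_subset_approxRows htest hM (forall_test_of_best_eq_some _ _ _ hz)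
  have hsmall : ∀ {y : Vec d}, (∀ j, |y j| ≤ d.factorial * ((2 ^ L : ℕ) : ℝ) ^ d * (2 ^ L : ℕ)) →
      |inner ℝ (intVec c) y| ≤ (basicBound d L : ℝ) ^ 2 := by
    intro y hy
    calc |inner ℝ (intVec c) y| ≤ d * (2 ^ L : ℕ) * basicBound d L :=
          abs_inner_intVec_le hc' fun j => (hy j).trans hfac
      _ ≤ basicBound d L * basicBound d L := by gcongr
      _ = _ := (sq _).symm
  rcases F.eq_empty_or_nonempty with hempty | hne
  -- An accepted centroid satisfies the program's rows up to the tolerance, which by integrality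
  -- (with the zero objective) would make the program feasible.
  · cases hb : best (lpParams d L) (intVec c) o with
    | none => exact hempty
    | some z =>
      obtain ⟨y, hy, -⟩ := hBM.exists_mem_of_approx (c := 0) (v := 0) (q₀ := 1) hU (by simp)
        ⟨0, by simp⟩ le_rfl hη.le (rowTolerance_mul_lt hd L (by
          have : (1 : ℝ) ≤ basicBound d L := by linarith
          exact_mod_cast this)) (z := z) (fun p hp => (hsub z hb hp).2) (by
          rw [inner_intVec]
          simp [realRow, dotProduct])
      exact absurd hy (by rw [← hF, hempty]; simp)
  by_cases hbdd : ∃ m : ℝ, ∀ y ∈ F, m ≤ inner ℝ (intVec c) y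
  · obtain ⟨m, hm⟩ := hbdd
    obtain ⟨x, hx, hxmin, ⟨q, hq1, hq, hqk⟩, hxb⟩ := hBM.exists_minimizer hU hne hm
    -- The level is the optimum itself, whose denominator q is small because it is attained at a
    -- basic point.
    obtain ⟨z, hz, y, hy, hyv⟩ := exists_best_of_level hd hc htest hM hq1
      (hq.trans (factorial_mul_le_basicBound d L)) hqk
      ((hsmall hxb).trans (pow_le_pow_right₀ (by linarith) (by norm_num))) hx le_rfl
    have hsubF : rowPolyhedron (approxRows (2 ^ L) (rowTolerance d L) z) ⊆ F :=
      rowPolyhedron_anti (hsub z hz)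
    obtain ⟨x', hx', hmin', -⟩ := (boundedRows_approxRows (2 ^ L) (rowTolerance d L)
      z).exists_minimizer (c := c) hU ⟨y, hy⟩ fun y hy => hm y (hsubF hy)
    have hex : ∃ x ∈ rowPolyhedron (approxRows (2 ^ L) (rowTolerance d L) z),
        ∀ x' ∈ rowPolyhedron (approxRows (2 ^ L) (rowTolerance d L) z),
          inner ℝ (intVec c) x ≤ inner ℝ (intVec c) x' := ⟨x', hx', hmin'⟩
    rw [hz, roundToOptimum, dif_pos hex]
    obtain ⟨h1, h2⟩ := hex.choose_spec
    exact ⟨hsubF h1, fun w hw => (h2 y hy).trans (hyv.trans (hxmin w hw))⟩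
  · push Not at hbdd
    -- A program with bounded rows that attains its minimum does so with value at least -Z², so a
    -- point at this integer level certifies that the approximating program has no minimum.
    set v : ℝ := -((basicBound d L : ℝ) ^ 2 + 1) with hv
    obtain ⟨x, hx, hxv⟩ := hbdd v
    obtain ⟨z, hz, y, hy, hyv⟩ := exists_best_of_level hd hc htest hM (v := v) le_rfl
      (by
        have : (1 : ℝ) ≤ basicBound d L := by linarith
        exact_mod_cast this)
      ⟨-((basicBound d L : ℤ) ^ 2 + 1), by rw [hv]; push_cast; ring⟩
      (by
        rw [hv, abs_neg, abs_of_pos (by positivity)]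
        nlinarith [mul_le_mul_of_nonneg_right hZ2 (sq_nonneg (basicBound d L : ℝ))]) hx hxv.le
    have hnot : ¬ ∃ x ∈ rowPolyhedron (approxRows (2 ^ L) (rowTolerance d L) z),
        ∀ x' ∈ rowPolyhedron (approxRows (2 ^ L) (rowTolerance d L) z),
          inner ℝ (intVec c) x ≤ inner ℝ (intVec c) x' := by
      rintro ⟨w, hw, hwmin⟩
      obtain ⟨x', hx', hmin', -, hxb'⟩ := (boundedRows_approxRows (2 ^ L) (rowTolerance d L)
        z).exists_minimizer (c := c) hU ⟨y, hy⟩ hwmin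
      have h1 := (abs_le.1 (hsmall hxb')).1
      have h2 := (hmin' y hy).trans hyv
      linarith
    rw [hz, roundToOptimum, dif_neg hnot]
    exact hbdd

theorem linearProgramming (d L : ℕ) (hd : 2 ≤ d) (hL : 1 ≤ L) :
    ∃ (prm : CogParams) (η : ℝ), 0 < η ∧ ∀ c : Fin d → ℤ, (∀ j, |c j| ≤ 2 ^ L) →
      ∃ finish : Option (Vec d) → LPAnswer d, ∀ (s : ℕ) [NeZero s]
        (test : Fin s → ConstraintBlock d → Vec d → Option (Vec d)),
        (∀ i, IsRowRule η (test i)) → ∀ M : Fin s → ConstraintBlock d,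
          (∀ i, (M i).BoundedBy L) →
          ∃ ans : LPAnswer d, ans.IsCorrect (intVec c) (feasibleRegion M) ∧
            (cogCoordinator prm (intVec c) test finish).OutputsWithin M ans
              (2 ^ 37 * s * (d : ℝ) ^ 3 * L * Real.log d ^ 2) ∧
            (cogBlackboard prm (intVec c) test finish).OutputsWithin M ans
              (2 ^ 37 * s * (d : ℝ) ^ 3 * L * Real.log d ^ 2) := by
  refine ⟨lpParams d L, rowTolerance d L, rowTolerance_pos hd L, fun c hc =>
    ⟨roundToOptimum (2 ^ L) (rowTolerance d L) c, ?_⟩⟩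
  intro s _ test htest M hM
  have hZ2 := two_le_basicBound hd L
  have hd' : (2 : ℝ) ≤ d := by exact_mod_cast hd
  have hL' : (1 : ℝ) ≤ L := by exact_mod_cast hL
  have hlogd : 1 ≤ d * Real.log d := one_le_mul_log hd
  have hlogd0 : 0 ≤ Real.log d := Real.log_nonneg (by linarith)
  have hdZ : (d : ℝ) ≤ basicBound d L := by
    have h1 : d * 1 ≤ (d + 1) * 2 ^ L := Nat.mul_le_mul (by omega) Nat.one_le_two_pow
    rw [mul_one] at h1
    exact_mod_cast h1.trans (mul_le_basicBound d L)
  -- The argument is 2dZ¹⁰ ≤ Z¹² and log Z ≤ 5dL log d, so there are O(d²L log d) rounds.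
  have hlog : Real.log ((basicBound d L : ℝ) ^ 6 * d / (rowTolerance d L / basicBound d L / 2)) ≤
      60 * d * L * Real.log d := by
    have h1 : (basicBound d L : ℝ) ^ 6 * d / (rowTolerance d L / basicBound d L / 2) ≤
        (basicBound d L : ℝ) ^ 12 := by
      have e : (basicBound d L : ℝ) ^ 6 * d / (rowTolerance d L / basicBound d L / 2) =
          (basicBound d L : ℝ) ^ 10 * d * 2 := by
        rw [rowTolerance]
        field_simp
      rw [e]
      calc (basicBound d L : ℝ) ^ 10 * d * 2 ≤
            (basicBound d L : ℝ) ^ 10 * basicBound d L * basicBound d L := by gcongr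
        _ = _ := by ring
    have h0 := rowTolerance_pos hd L
    refine (Real.log_le_log (by positivity) h1).trans ?_
    rw [Real.log_pow]
    have := log_basicBound_le hd hL
    push_cast
    linarith
  have hcost := fineParams_cost_le hd s hlog (by nlinarith)
  have hcost' : ((lpParams d L).rounds *
      (2 * s * (1 + d * Nat.size (2 * (lpParams d L).resolution))) : ℝ) ≤
      2 ^ 37 * s * (d : ℝ) ^ 3 * L * Real.log d ^ 2 := by
    refine hcost.trans ?_
    have : 0 ≤ (s : ℝ) * d ^ 3 * L * Real.log d ^ 2 := by positivity
    nlinarith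
  exact ⟨_, roundToOptimum_best_isCorrect hd hc htest hM,
    cogCoordinator_outputsWithin _ _ _ _ _ hcost', cogBlackboard_outputsWithin _ _ _ _ _ hcost'⟩

end LinearProgram

end DistOpt

end

theorem mainTheorem8 :
    ∃ C : ℝ, 0 < C ∧
      (∀ (d : ℕ) (R ε : ℝ), 2 ≤ d → 0 < ε → ε ≤ R →
        ∃ (prm : DistOpt.CogParams) (δ : ℝ), 0 < δ ∧
          ∀ (s : ℕ) [NeZero s] (c : DistOpt.Vec d)
            (test : Fin s → Set (DistOpt.Vec d) → DistOpt.Vec d → Option (DistOpt.Vec d)),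
            (∀ i, DistOpt.IsSeparationRule δ (test i)) →
            ∀ K : Fin s → Set (DistOpt.Vec d),
              (∀ i, Convex ℝ (K i)) → (∀ i, K i ⊆ Metric.closedBall 0 R) →
              (⋂ i, K i).Nonempty →
              ∃ y : DistOpt.Vec d, DistOpt.IsAdditiveSolution c K ε y ∧
                (DistOpt.cogCoordinator prm c test id).OutputsWithin K (some y)
                  (C * s * (d : ℝ) ^ 2 * Real.log d * Real.log (R * d / ε)) ∧
                (DistOpt.cogBlackboard prm c test id).OutputsWithin K (some y)
                  (C * s * (d : ℝ) ^ 2 * Real.log d * Real.log (R * d / ε))) ∧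
      (∀ d L : ℕ, 2 ≤ d → 1 ≤ L →
        ∃ (prm : DistOpt.CogParams) (η : ℝ), 0 < η ∧
          ∀ c : Fin d → ℤ, (∀ j, |c j| ≤ 2 ^ L) →
            ∃ finish : Option (DistOpt.Vec d) → DistOpt.LPAnswer d,
              ∀ (s : ℕ) [NeZero s]
                (test : Fin s → DistOpt.ConstraintBlock d → DistOpt.Vec d →
                  Option (DistOpt.Vec d)),
                (∀ i, DistOpt.IsRowRule η (test i)) →
                ∀ M : Fin s → DistOpt.ConstraintBlock d, (∀ i, (M i).BoundedBy L) →
                  ∃ ans : DistOpt.LPAnswer d,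
                    ans.IsCorrect (DistOpt.intVec c) (DistOpt.feasibleRegion M) ∧
                    (DistOpt.cogCoordinator prm (DistOpt.intVec c) test finish).OutputsWithin M ans
                      (C * s * (d : ℝ) ^ 3 * L * Real.log d ^ 2) ∧
                    (DistOpt.cogBlackboard prm (DistOpt.intVec c) test finish).OutputsWithin M ans
                      (C * s * (d : ℝ) ^ 3 * L * Real.log d ^ 2)) := by
  refine ⟨2 ^ 37, by positivity, ?_, ?_⟩
  · exact DistOpt.convexProgramming
  · exact DistOpt.linearProgramming
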